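/- \textbf{Setting.} Let $\mathbb K=\mathbb R$ or $\mathbb C$; ``smooth'' means complex-analytic for $\mathbb K=\mathbb C$, and either $C^\infty$ or real-analytic (one of the two, fixed throughout) for $\mathbb K=\mathbb R$. Let $\mathcal D_m$ be the group of germs of smooth diffeomorphisms of $(\mathbb K^m,0)$, and let $\mathcal C$ be the group of smooth families $\theta=(\theta_x)_{x\in(\mathbb K^n,0)}$ of origin-preserving diffeomorphism germs of $(\mathbb K^p,0)$, i.e. $(x,y)\mapsto(x,\theta_x(y))$ is in $\mathcal D_{n+p}$ and $\theta_x(0)=0$. A pair $(\varphi,\theta)$ with $\varphi\in\mathcal D_n$, $\theta\in\mathcal C$ sends a smooth map-germ $f:(\mathbb K^n,0)\to(\mathbb K^p,0)$ to the germ $x\mapsto\theta_x(f(\varphi(x)))$. The group $\mathcal K$ consists of all such pairs, $\mathcal A$ of those for which $\theta_x=\psi$ does not depend on $x$ (so that $f\mapsto\psi\circ f\circ\varphi$), $\mathcal L$ of those with in addition $\varphi=\mathrm{id}$, and $\mathcal C$ of the pairs with $\varphi=\mathrm{id}$. For $q=n$ the $q$-component of $(\varphi,\theta)$ is $\varphi$,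 for $q=p$ it is $\theta$. For a germ of a smooth volume form $\Omega_q$ on $(\mathbb K^q,0)$ let $G_{\Omega_q}$ be the subgroup of $G$ whose $q$-components preserve $\Omega_q$ ($\varphi^*\Omega_n=\Omega_n$, respectively $\theta_x^*\Omega_p=\Omega_p$ for all $x$). For $\mathbb K=\mathbb R$ let $G^+$ be the subgroup of $G$ whose $q$-components preserve the orientation. Let $G_f$ be the stabilizer of $f$ in $G$ and $G_f^q$ the set of $q$-components of its elements. Two volume forms $\Omega_0,\Omega_1$ on $(\mathbb K^q,0)$ are \emph{$G_f^q$-isotopic} if there is a smooth family $\Phi_t\in G_f^q$, $t\in[0,1]$, with $\Phi_0=\mathrm{id}$ and $\Phi_1^*\Omega_1=\Omega_0$. A germ $f$ is quasihomogeneous for weights $w_i\in\mathbb Z$ $(1\le i\le n)$ and weighted degrees $\delta_j\in\mathbb Z$ $(1\le j\le p)$ if $f_j(s^{w_1}x_1,\dots,s^{w_n}x_n)=s^{\delta_j}f_j(x)$ for all $j$, all $x$ near $0$ and all scalars $s$ near $1$. It is \emph{weakly quasihomogeneous} (w.q.h.) for $G_{\Omega_q}$ if it is quasihomogeneous for some weights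 and degrees such that \begin{itemize} \item for $\mathcal A_{\Omega_p}$: all $\delta_j\ge0$ and $\sum_j\delta_j>0$; \item for $\mathcal K_{\Omega_n}$: all $w_i\ge0$ and $\sum_iw_i>0$; \item for $\mathcal K_{\Omega_p}$: $\sum_j\delta_j\ne0$. \end{itemize} It is \emph{trivially w.q.h.} for $G_{\Omega_q}=\mathcal A_{\Omega_p},\mathcal L_{\Omega_p},\mathcal C_{\Omega_p}$ or $\mathcal K_{\Omega_p}$ if it is $G$-equivalent to a map-germ having a zero component function, and trivially w.q.h. for $\mathcal K_{\Omega_n}$ or $\mathcal K_{\Omega_p}$ if $df(0)$ has positive rank. \textbf{Theorem.} Let $f:(\mathbb K^n,0)\to(\mathbb K^p,0)$ be a smooth map-germ that is w.q.h. for $G_{\Omega_q}=\mathcal A_{\Omega_p}$, $\mathcal K_{\Omega_n}$ or $\mathcal K_{\Omega_p}$, or trivially w.q.h. for $G_{\Omega_q}=\mathcal A_{\Omega_p},\mathcal L_{\Omega_p},\mathcal C_{\Omega_p},\mathcal K_{\Omega_p}$ or $\mathcal K_{\Omega_n}$. Then: (i) Any two germs of volume forms on $(\mathbb K^q,0)$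 (which, for $\mathbb K=\mathbb R$, define the same orientation at $0$) are $G_f^q$-isotopic. (ii) For every volume form $\Omega_q$ on $(\mathbb K^q,0)$ and every smooth map-germ $f'$: if $f'\sim_Gf$ (for $\mathbb K=\mathbb C$), respectively $f'\sim_{G^+}f$ (for $\mathbb K=\mathbb R$), then $f'\sim_{G_{\Omega_q}}f$. (iii) Consequently, over $\mathbb C$, the $G$-orbit and the $G_{\Omega_q}$-orbit of every germ $g\sim_Gf$ coincide. (In particular this applies to the $\mathcal A$- and $\mathcal A_{\Omega_p}$-orbits of those $\mathcal A$-stable germs, and to the $\mathcal K$- and $\mathcal K_{\Omega_n}$-orbits of those $\mathcal K$-simple germs, whose $\mathcal A$-, respectively $\mathcal K$-, orbit contains a germ that is w.q.h. for $\mathcal A_{\Omega_p}$, respectively $\mathcal K_{\Omega_n}$.) -/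

import Mathlib

open Set Filter Topology
open scoped ContDiff

/-! Germs at the origin are represented by functions: a germ is smooth of class `r` if the function
is so on a neighbourhood of the origin, and an equality of germs is an equality on a neighbourhood.
The three smooth categories are `𝕜 = ℝ, r = ∞`; `𝕜 = ℝ, r = ω`; `𝕜 = ℂ, r = ω`. -/

section Germs

/-- `f` is of class `C^r` over `𝕜` on a neighbourhood of `a`. -/
def SmoothNear (𝕜 : Type*) [RCLike 𝕜] (r : WithTop ℕ∞) {E F : Type*}
    [NormedAddCommGroup E] [NormedSpace 𝕜 E] [NormedAddCommGroup F] [NormedSpace 𝕜 F]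
    (f : E → F) (a : E) : Prop :=
  ∀ᶠ x in 𝓝 a, ContDiffAt 𝕜 r f x

/-- `f` represents a smooth map-germ `(𝕜ⁿ, 0) → (𝕜ᵖ, 0)`. -/
structure IsMapGerm {𝕜 : Type*} [RCLike 𝕜] (r : WithTop ℕ∞) {n p : ℕ}
    (f : (Fin n → 𝕜) → (Fin p → 𝕜)) : Prop where
  map_zero : f 0 = 0
  smooth : SmoothNear 𝕜 r f 0

/-- `φ` represents a germ of a diffeomorphism of `(E, 0)`: it fixes the origin, is smooth, and has a
smooth inverse germ. -/
structure IsDiffeoGerm (𝕜 : Type*) [RCLike 𝕜] (r : WithTop ℕ∞) {E : Type*}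
    [NormedAddCommGroup E] [NormedSpace 𝕜 E] (φ : E → E) : Prop where
  map_zero : φ 0 = 0
  smooth : SmoothNear 𝕜 r φ 0
  exists_inverse : ∃ ψ : E → E, ψ 0 = 0 ∧ SmoothNear 𝕜 r ψ 0 ∧
    (∀ᶠ x in 𝓝 (0 : E), ψ (φ x) = x) ∧ (∀ᶠ x in 𝓝 (0 : E), φ (ψ x) = x)

/-- Mather's group `𝒞`: germs `(x, y) ↦ (x, θ x y)` of diffeomorphisms of `(𝕜ⁿ × 𝕜ᵖ, 0)` with
`θ x 0 = 0`, that is, smooth `n`-parameter families `θ x` of diffeomorphisms of `(𝕜ᵖ, 0)`. -/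
structure IsFamilyGerm (𝕜 : Type*) [RCLike 𝕜] (r : WithTop ℕ∞) {n p : ℕ}
    (θ : (Fin n → 𝕜) → (Fin p → 𝕜) → (Fin p → 𝕜)) : Prop where
  fixes_zero : ∀ᶠ x in 𝓝 (0 : Fin n → 𝕜), θ x 0 = 0
  diffeo : IsDiffeoGerm 𝕜 r (fun z : (Fin n → 𝕜) × (Fin p → 𝕜) => (z.1, θ z.1 z.2))

end Germs

section Groups

/-- The Mather groups `𝒜`, `𝒦`, `ℛ`, `ℒ`, `𝒞`. -/
inductive Mather
  | A | K | R | L | C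

/-- The pair `(φ, θ)`, acting on map-germs by `f ↦ (x ↦ θ x (f (φ x)))`, belongs to the Mather
group `G`. For `𝒦` the diffeomorphism `φ` of the source and the family `θ` of diffeomorphisms of
the target are arbitrary. For `𝒜` the family is a single diffeomorphism `ψ` of the target (it does
not depend on `x`), so that the action is `f ↦ ψ ∘ f ∘ φ`. The groups `ℛ`, `ℒ`, `𝒞` are obtained by
making one of the two factors trivial. -/
def Mather.Mem {𝕜 : Type*} [RCLike 𝕜] (r : WithTop ℕ∞) {n p : ℕ} (G : Mather)
    (φ : (Fin n → 𝕜) → (Fin n → 𝕜)) (θ : (Fin n → 𝕜) → (Fin p → 𝕜) → (Fin p → 𝕜)) : Prop :=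
  IsDiffeoGerm 𝕜 r φ ∧ IsFamilyGerm 𝕜 r θ ∧
  match G with
  | .K => True
  | .A => ∀ᶠ z in 𝓝 (0 : (Fin n → 𝕜) × (Fin p → 𝕜)), θ z.1 z.2 = θ 0 z.2
  | .R => ∀ᶠ z in 𝓝 (0 : (Fin n → 𝕜) × (Fin p → 𝕜)), θ z.1 z.2 = z.2
  | .L => (∀ᶠ x in 𝓝 (0 : Fin n → 𝕜), φ x = x) ∧
      ∀ᶠ z in 𝓝 (0 : (Fin n → 𝕜) × (Fin p → 𝕜)), θ z.1 z.2 = θ 0 z.2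
  | .C => ∀ᶠ x in 𝓝 (0 : Fin n → 𝕜), φ x = x

/-- As germs, `f' = (φ, θ) · f`. -/
def IsImage {𝕜 : Type*} [RCLike 𝕜] {n p : ℕ} (φ : (Fin n → 𝕜) → (Fin n → 𝕜))
    (θ : (Fin n → 𝕜) → (Fin p → 𝕜) → (Fin p → 𝕜)) (f f' : (Fin n → 𝕜) → (Fin p → 𝕜)) : Prop :=
  ∀ᶠ x in 𝓝 (0 : Fin n → 𝕜), f' x = θ x (f (φ x))

/-- `G`-equivalence `f' ∼ f`. -/
def Mather.Equivalent {𝕜 : Type*} [RCLike 𝕜] (r : WithTop ℕ∞) {n p : ℕ} (G : Mather)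
    (f' f : (Fin n → 𝕜) → (Fin p → 𝕜)) : Prop :=
  ∃ φ θ, G.Mem r φ θ ∧ IsImage φ θ f f'

/-- The pair `(φ, θ)` belongs to the stabilizer `G_f` of `f` in `G`. -/
def Mather.Stabilizes {𝕜 : Type*} [RCLike 𝕜] (r : WithTop ℕ∞) {n p : ℕ} (G : Mather)
    (f : (Fin n → 𝕜) → (Fin p → 𝕜)) (φ : (Fin n → 𝕜) → (Fin n → 𝕜))
    (θ : (Fin n → 𝕜) → (Fin p → 𝕜) → (Fin p → 𝕜)) : Prop :=
  G.Mem r φ θ ∧ IsImage φ θ f f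

end Groups

section VolumeForms

/-- Differential forms of top degree on `𝕜ᵈ`. -/
abbrev TopForm (𝕜 : Type*) [RCLike 𝕜] (d : ℕ) : Type _ :=
  (Fin d → 𝕜) → (Fin d → 𝕜) [⋀^Fin d]→L[𝕜] 𝕜

/-- `Ω` represents a germ of a volume form on `(𝕜ᵈ, 0)`. -/
structure IsVolumeForm {𝕜 : Type*} [RCLike 𝕜] (r : WithTop ℕ∞) {d : ℕ}
    (Ω : TopForm 𝕜 d) : Prop where
  smooth : SmoothNear 𝕜 r Ω 0
  ne_zero : Ω 0 ≠ 0

/-- The pullback `Φ^* Ω`. -/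
noncomputable def pullbackForm {𝕜 : Type*} [RCLike 𝕜] {d : ℕ}
    (Φ : (Fin d → 𝕜) → (Fin d → 𝕜)) (Ω : TopForm 𝕜 d) : TopForm 𝕜 d :=
  fun x => (Ω (Φ x)).compContinuousLinearMap (fderiv 𝕜 Φ x)

/-- `Ω` and `Ω'` define the same orientation at the origin (used for `𝕜 = ℝ` only). -/
def SameOrientation {𝕜 : Type*} [RCLike 𝕜] {d : ℕ} (Ω Ω' : TopForm 𝕜 d) : Prop :=
  ∃ c : ℝ, 0 < c ∧ Ω' 0 = (c : 𝕜) • Ω 0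

/-- The space that carries the volume form: the source `𝕜ⁿ` (`q = n`) or the target `𝕜ᵖ`
(`q = p`). -/
inductive Side
  | source | target

/-- The dimension `q`. -/
def Side.dim (n p : ℕ) : Side → ℕ
  | .source => n
  | .target => p

/-- The `q`-component of `(φ, θ)` pulls `Ω'` back to `Ω`. For `q = p` this means
`(θ x)^* Ω' = Ω` for all `x`. -/
def PullsBack {𝕜 : Type*} [RCLike 𝕜] {n p : ℕ} (φ : (Fin n → 𝕜) → (Fin n → 𝕜))
    (θ : (Fin n → 𝕜) → (Fin p → 𝕜) → (Fin p → 𝕜)) :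
    (q : Side) → TopForm 𝕜 (q.dim n p) → TopForm 𝕜 (q.dim n p) → Prop
  | .source, Ω', Ω => ∀ᶠ x in 𝓝 (0 : Fin n → 𝕜), pullbackForm φ Ω' x = Ω x
  | .target, Ω', Ω => ∀ᶠ z in 𝓝 (0 : (Fin n → 𝕜) × (Fin p → 𝕜)),
      pullbackForm (θ z.1) Ω' z.2 = Ω z.2

/-- The `q`-component of `(φ, θ)` preserves the orientation (used for `𝕜 = ℝ` only). -/
def PreservesOrientation {𝕜 : Type*} [RCLike 𝕜] {n p : ℕ} (φ : (Fin n → 𝕜) → (Fin n → 𝕜))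
    (θ : (Fin n → 𝕜) → (Fin p → 𝕜) → (Fin p → 𝕜)) : Side → Prop
  | .source => 0 < RCLike.re (fderiv 𝕜 φ 0).det
  | .target => 0 < RCLike.re (fderiv 𝕜 (θ 0) 0).det

/-- `G⁺`-equivalence: the `q`-component preserves the orientation (used for `𝕜 = ℝ` only). -/
def Mather.PlusEquivalent {𝕜 : Type*} [RCLike 𝕜] (r : WithTop ℕ∞) {n p : ℕ} (G : Mather) (q : Side)
    (f' f : (Fin n → 𝕜) → (Fin p → 𝕜)) : Prop :=
  ∃ φ θ, G.Mem r φ θ ∧ PreservesOrientation φ θ q ∧ IsImage φ θ f f'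

/-- `G_Ω`-equivalence: equivalence under the subgroup of `G` whose `q`-component preserves `Ω`. -/
def Mather.VolumeEquivalent {𝕜 : Type*} [RCLike 𝕜] (r : WithTop ℕ∞) {n p : ℕ} (G : Mather)
    (q : Side) (Ω : TopForm 𝕜 (q.dim n p)) (f' f : (Fin n → 𝕜) → (Fin p → 𝕜)) : Prop :=
  ∃ φ θ, G.Mem r φ θ ∧ PullsBack φ θ q Ω Ω ∧ IsImage φ θ f f'

/-- `Ω₀` and `Ω₁` are `G_f^q`-isotopic: there is a smooth family `Φ t`, `t ∈ [0,1]`, in the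
projection `G_f^q` of the stabilizer `G_f` to its `q`-component, with `Φ 0 = id` and
`(Φ 1)^* Ω₁ = Ω₀`. The family is smooth jointly in `t` and the space variables. -/
def Mather.Isotopic {𝕜 : Type*} [RCLike 𝕜] (r : WithTop ℕ∞) {n p : ℕ} (G : Mather)
    (f : (Fin n → 𝕜) → (Fin p → 𝕜)) :
    (q : Side) → TopForm 𝕜 (q.dim n p) → TopForm 𝕜 (q.dim n p) → Prop
  | .source, Ω₀, Ω₁ => ∃ Φ : ℝ → (Fin n → 𝕜) → (Fin n → 𝕜),
      (∀ t ∈ Icc (0 : ℝ) 1,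
        SmoothNear ℝ r (fun z : ℝ × (Fin n → 𝕜) => Φ z.1 z.2) (t, 0)) ∧
      (∀ t ∈ Icc (0 : ℝ) 1, ∃ θ, G.Stabilizes r f (Φ t) θ) ∧
      (∀ᶠ x in 𝓝 (0 : Fin n → 𝕜), Φ 0 x = x) ∧
      PullsBack (p := p) (Φ 1) (fun _ y => y) .source Ω₁ Ω₀
  | .target, Ω₀, Ω₁ => ∃ Φ : ℝ → (Fin n → 𝕜) → (Fin p → 𝕜) → (Fin p → 𝕜),
      (∀ t ∈ Icc (0 : ℝ) 1,
        SmoothNear ℝ r (fun z : ℝ × (Fin n → 𝕜) × (Fin p → 𝕜) => Φ z.1 z.2.1 z.2.2) (t, 0)) ∧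
      (∀ t ∈ Icc (0 : ℝ) 1, ∃ φ, G.Stabilizes r f φ (Φ t)) ∧
      (∀ᶠ z in 𝓝 (0 : (Fin n → 𝕜) × (Fin p → 𝕜)), Φ 0 z.1 z.2 = z.2) ∧
      PullsBack (fun x => x) (Φ 1) .target Ω₁ Ω₀

end VolumeForms

section Quasihomogeneity

/-- `f` is quasihomogeneous for the integer weights `w` and weighted degrees `δ`:
`f_j (s^{w_1} x_1, …, s^{w_n} x_n) = s^{δ_j} f_j (x)`. Weights may be negative, so on germs the
identity is required for `x` near `0` and scalars `s` near `1`. (For convergent power series this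
says that every monomial `x^α` of `f_j` has weighted degree `∑ w_i α_i = δ_j`.) -/
def IsQuasihomogeneous {𝕜 : Type*} [RCLike 𝕜] {n p : ℕ} (w : Fin n → ℤ) (δ : Fin p → ℤ)
    (f : (Fin n → 𝕜) → (Fin p → 𝕜)) : Prop :=
  ∀ᶠ z in 𝓝 ((1, 0) : 𝕜 × (Fin n → 𝕜)), ∀ j,
    f (fun i => z.1 ^ w i * z.2 i) j = z.1 ^ δ j * f z.2 j

/-- `f` is weakly quasihomogeneous for `𝒜_{Ω_p}`, `𝒦_{Ω_n}` or `𝒦_{Ω_p}`; there is no such notion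
for the other groups. -/
def IsWeaklyQuasihomogeneous {𝕜 : Type*} [RCLike 𝕜] {n p : ℕ} (G : Mather) (q : Side)
    (f : (Fin n → 𝕜) → (Fin p → 𝕜)) : Prop :=
  ∃ (w : Fin n → ℤ) (δ : Fin p → ℤ), IsQuasihomogeneous w δ f ∧
    match G, q with
    | .A, .target => (∀ j, 0 ≤ δ j) ∧ 0 < ∑ j, δ j
    | .K, .source => (∀ i, 0 ≤ w i) ∧ 0 < ∑ i, w i
    | .K, .target => ∑ j, δ j ≠ 0
    | _, _ => False

/-- `f` is `G`-equivalent to a map-germ that has a zero component function. -/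
def HasZeroComponent {𝕜 : Type*} [RCLike 𝕜] (r : WithTop ℕ∞) {n p : ℕ} (G : Mather)
    (f : (Fin n → 𝕜) → (Fin p → 𝕜)) : Prop :=
  ∃ g : (Fin n → 𝕜) → (Fin p → 𝕜), IsMapGerm r g ∧ G.Equivalent r g f ∧
    ∃ j, ∀ᶠ x in 𝓝 (0 : Fin n → 𝕜), g x j = 0

/-- The differential of `f` at the origin has positive rank. -/
def HasPositiveRank {𝕜 : Type*} [RCLike 𝕜] {n p : ℕ} (f : (Fin n → 𝕜) → (Fin p → 𝕜)) : Prop :=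
  0 < Module.finrank 𝕜 (LinearMap.range (fderiv 𝕜 f 0 : (Fin n → 𝕜) →ₗ[𝕜] (Fin p → 𝕜)))

/-- `f` is trivially weakly quasihomogeneous for one of the groups `𝒜_{Ω_p}`, `ℒ_{Ω_p}`, `𝒞_{Ω_p}`,
`𝒦_{Ω_p}`, `𝒦_{Ω_n}`. -/
def IsTriviallyWeaklyQuasihomogeneous {𝕜 : Type*} [RCLike 𝕜] (r : WithTop ℕ∞) {n p : ℕ}
    (G : Mather) (q : Side) (f : (Fin n → 𝕜) → (Fin p → 𝕜)) : Prop :=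
  match G, q with
  | .A, .target => HasZeroComponent r .A f
  | .L, .target => HasZeroComponent r .L f
  | .C, .target => HasZeroComponent r .C f
  | .K, .target => HasZeroComponent r .K f ∨ HasPositiveRank f
  | .K, .source => HasPositiveRank f
  | _, _ => False

end Quasihomogeneity

-- A quasihomogeneous germ is fixed by a one-parameter group of scalings of source and target. The
-- point is to move volume forms along the trajectories of such a group, with a flow time that
-- varies from point to point, while staying in the stabilizer of `f`.
--
-- Let `E` be the Euler field of natural weights with sum `W > 0`, let `α` be the contraction of the
-- standard volume form with `E`, and let a volume form have density `ρ`. Averaging `ρ` over the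
-- contracting scalings gives a function `R` with `d(R α) = ρ vol`, that is, `E R + W R = ρ`
-- (`fderiv_eulerPrimitive`). A map `ψ` moving `y` along its `E`-trajectory for time `u(y)`
-- satisfies `ψ^* α = exp(W u) α`, because `α` annihilates `E`. So `ψ^*(ρ₁ vol) = ρ₀ vol` follows
-- from the scalar equation `exp(W u) R₁(ψ y) = R₀(y)`, which the implicit function theorem solves
-- for `u` (`exists_expScale_pullback`). No time-dependent vector field is integrated, and `t u` for
-- `t` in `[0,1]` gives the isotopy. Parameters are carried along, since elements of `𝒞` are
-- families. The averages keep the smoothness class by `SmoothNear.integral_contraction`.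
--
-- The scalings lift to the stabilizer in different ways. For `𝒜` with nonnegative degrees, a target
-- scaling is compensated by a source scaling (`targetMoser_of_scaling`). For `𝒦` and the source, a
-- source scaling with variable time is compensated by linear maps of the target depending on `x`
-- (`DilationSymmetry.sourceMoser`). For `𝒦` and the target, degrees of mixed sign are handled by
-- combining radial maps with a volume-preserving linear family and choosing the time so that the
-- result is correct on the graph of `f` (`DilationSymmetry.targetMoser`). A zero component leaves a
-- target coordinate free to be scaled. Positive rank makes some component a coordinate function,
-- which produces a scaling symmetry (`exists_dilationSymmetry_of_component`).
--
-- Finally, if `f'` is the image of `f` under `(φ, θ)`, the failure of `(φ, θ)` to preserve the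
-- volume form is corrected by an element of the stabilizer of `f` (`SourceMoser.volumeEquivalent`,
-- `TargetMoser.volumeEquivalent`).

attribute [fun_prop] SmoothNear

/-! ### Calculus of smooth germs -/

section SmoothNearAPI

variable {𝕜 : Type*} [RCLike 𝕜] {r : WithTop ℕ∞} {E F H : Type*}
  [NormedAddCommGroup E] [NormedSpace 𝕜 E] [NormedAddCommGroup F] [NormedSpace 𝕜 F]
  [NormedAddCommGroup H] [NormedSpace 𝕜 H]

theorem SmoothNear.contDiffAt {f : E → F} {a : E} (hf : SmoothNear 𝕜 r f a) :
    ContDiffAt 𝕜 r f a :=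
  hf.self_of_nhds

theorem SmoothNear.continuousAt {f : E → F} {a : E} (hf : SmoothNear 𝕜 r f a) :
    ContinuousAt f a :=
  hf.contDiffAt.continuousAt

theorem SmoothNear.differentiableAt {f : E → F} {a : E} (hf : SmoothNear 𝕜 r f a)
    (hr : r ≠ 0) : DifferentiableAt 𝕜 f a :=
  hf.contDiffAt.differentiableAt hr

theorem SmoothNear.congr {f g : E → F} {a : E} (hf : SmoothNear 𝕜 r f a) (h : f =ᶠ[𝓝 a] g) :
    SmoothNear 𝕜 r g a := by
  filter_upwards [hf, eventually_eventually_nhds.2 h] with x hx hx'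
  exact hx.congr_of_eventuallyEq (EventuallyEq.symm hx')

theorem ContDiff.smoothNear {f : E → F} (hf : ContDiff 𝕜 r f) (a : E) : SmoothNear 𝕜 r f a :=
  Eventually.of_forall fun _ => hf.contDiffAt

@[fun_prop]
theorem smoothNear_id (a : E) : SmoothNear 𝕜 r (fun x : E => x) a :=
  contDiff_id.smoothNear a

@[fun_prop]
theorem smoothNear_const (c : F) (a : E) : SmoothNear 𝕜 r (fun _ : E => c) a :=
  contDiff_const.smoothNear a

@[fun_prop]
theorem SmoothNear.comp {g : F → H} {f : E → F} (a : E) (hg : SmoothNear 𝕜 r g (f a))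
    (hf : SmoothNear 𝕜 r f a) : SmoothNear 𝕜 r (fun x => g (f x)) a := by
  filter_upwards [hf, hf.continuousAt.eventually hg] with x hx hx'
  exact ContDiffAt.comp x hx' hx

@[fun_prop]
theorem SmoothNear.prodMk {f : E → F} {g : E → H} {a : E} (hf : SmoothNear 𝕜 r f a)
    (hg : SmoothNear 𝕜 r g a) : SmoothNear 𝕜 r (fun x => (f x, g x)) a := by
  filter_upwards [hf, hg] with x hx hx'
  exact hx.prodMk hx'

@[fun_prop]
theorem SmoothNear.fst {f : E → F × H} {a : E} (hf : SmoothNear 𝕜 r f a) :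
    SmoothNear 𝕜 r (fun x => (f x).1) a := by
  filter_upwards [hf] with x hx
  exact hx.fst

@[fun_prop]
theorem SmoothNear.snd {f : E → F × H} {a : E} (hf : SmoothNear 𝕜 r f a) :
    SmoothNear 𝕜 r (fun x => (f x).2) a := by
  filter_upwards [hf] with x hx
  exact hx.snd

@[fun_prop]
theorem smoothNear_pi {ι : Type*} [Fintype ι] {f : E → ι → F} {a : E}
    (hf : ∀ i, SmoothNear 𝕜 r (fun x => f x i) a) : SmoothNear 𝕜 r f a := by
  filter_upwards [eventually_all.2 hf] with x hx
  exact contDiffAt_pi.2 hx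

@[fun_prop]
theorem SmoothNear.apply {ι : Type*} [Fintype ι] (i : ι) {a : ι → F} :
    SmoothNear 𝕜 r (fun f : ι → F => f i) a :=
  (contDiff_apply 𝕜 F i).smoothNear a

@[fun_prop]
theorem SmoothNear.add {f g : E → F} {a : E} (hf : SmoothNear 𝕜 r f a)
    (hg : SmoothNear 𝕜 r g a) : SmoothNear 𝕜 r (fun x => f x + g x) a := by
  filter_upwards [hf, hg] with x hx hx'
  exact hx.add hx'

@[fun_prop]
theorem SmoothNear.sub {f g : E → F} {a : E} (hf : SmoothNear 𝕜 r f a)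
    (hg : SmoothNear 𝕜 r g a) : SmoothNear 𝕜 r (fun x => f x - g x) a := by
  filter_upwards [hf, hg] with x hx hx'
  exact hx.sub hx'

@[fun_prop]
theorem SmoothNear.neg {f : E → F} {a : E} (hf : SmoothNear 𝕜 r f a) :
    SmoothNear 𝕜 r (fun x => -f x) a := by
  filter_upwards [hf] with x hx
  exact hx.neg

@[fun_prop]
theorem SmoothNear.mul {𝔸 : Type*} [NormedRing 𝔸] [NormedAlgebra 𝕜 𝔸] {f g : E → 𝔸} {a : E} (hf : SmoothNear 𝕜 r f a)
    (hg : SmoothNear 𝕜 r g a) : SmoothNear 𝕜 r (fun x => f x * g x) a := by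
  filter_upwards [hf, hg] with x hx hx'
  exact hx.mul hx'

@[fun_prop]
theorem SmoothNear.smul {f : E → 𝕜} {g : E → F} {a : E} (hf : SmoothNear 𝕜 r f a)
    (hg : SmoothNear 𝕜 r g a) : SmoothNear 𝕜 r (fun x => f x • g x) a := by
  filter_upwards [hf, hg] with x hx hx'
  exact hx.smul hx'

@[fun_prop]
theorem SmoothNear.sum {ι : Type*} {s : Finset ι} {f : ι → E → F} {a : E}
    (hf : ∀ i ∈ s, SmoothNear 𝕜 r (fun x => f i x) a) :
    SmoothNear 𝕜 r (fun x => ∑ i ∈ s, f i x) a := by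
  have : ∀ᶠ x in 𝓝 a, ∀ i ∈ s, ContDiffAt 𝕜 r (fun x => f i x) x :=
    (Finset.eventually_all s).2 hf
  filter_upwards [this] with x hx
  exact ContDiffAt.sum hx

@[fun_prop]
theorem SmoothNear.clm_apply {f : E → F →L[𝕜] H} {g : E → F} {a : E} (hf : SmoothNear 𝕜 r f a)
    (hg : SmoothNear 𝕜 r g a) : SmoothNear 𝕜 r (fun x => f x (g x)) a := by
  filter_upwards [hf, hg] with x hx hx'
  exact hx.clm_apply hx'

theorem contDiff_normedSpaceExp {𝔸 : Type*} [NormedRing 𝔸] [NormedAlgebra 𝕜 𝔸]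
    [CompleteSpace 𝔸] : ContDiff 𝕜 r (NormedSpace.exp : 𝔸 → 𝔸) := by
  have : ContDiff 𝕜 ω (NormedSpace.exp : 𝔸 → 𝔸) :=
    contDiff_iff_contDiffAt.2 fun x => (NormedSpace.exp_analytic (𝕂 := 𝕜) x).contDiffAt
  exact this.of_le le_top

@[fun_prop]
theorem SmoothNear.exp {𝔸 : Type*} [NormedRing 𝔸] [NormedAlgebra 𝕜 𝔸] [CompleteSpace 𝔸]
    {f : E → 𝔸} {a : E} (hf : SmoothNear 𝕜 r f a) :
    SmoothNear 𝕜 r (fun x => NormedSpace.exp (f x)) a :=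
  SmoothNear.comp a (contDiff_normedSpaceExp.smoothNear _) hf

/-- Losing one derivative costs nothing exactly because `r` is `∞` or `ω`; this is the source of the
hypothesis `hr` in most later statements. -/
theorem SmoothNear.fderiv_right (hr : r = ∞ ∨ r = ω) {f : E → F} {a : E} (hf : SmoothNear 𝕜 r f a) :
    SmoothNear 𝕜 r (fun x => fderiv 𝕜 f x) a := by
  filter_upwards [hf] with x hx
  refine hx.fderiv_right (m := r) ?_
  rcases hr with rfl | rfl <;> simp

end SmoothNearAPI

section Real

variable {𝕜 : Type*} [RCLike 𝕜] {r : WithTop ℕ∞} {E F : Type*}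
  [NormedAddCommGroup E] [NormedSpace 𝕜 E] [NormedSpace ℝ E] [IsScalarTower ℝ 𝕜 E]
  [NormedAddCommGroup F] [NormedSpace 𝕜 F] [NormedSpace ℝ F] [IsScalarTower ℝ 𝕜 F]

theorem SmoothNear.real {f : E → F} {a : E} (hf : SmoothNear 𝕜 r f a) : SmoothNear ℝ r f a := by
  filter_upwards [hf] with x hx
  exact hx.restrict_scalars ℝ

end Real

/-! ### Inverse and implicit functions -/

section Inverse

variable {𝕜 : Type*} [RCLike 𝕜] {r : WithTop ℕ∞} {E F X : Type*}
  [NormedAddCommGroup E] [NormedSpace 𝕜 E] [CompleteSpace E]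
  [NormedAddCommGroup F] [NormedSpace 𝕜 F]
  [NormedAddCommGroup X] [NormedSpace 𝕜 X] [CompleteSpace X]

/-- Invertibility of the derivative is an open condition, so the pointwise inverse function theorem
applies at every point near `a` and yields smoothness on a whole neighbourhood. -/
theorem SmoothNear.exists_local_inverse (hr : r = ∞ ∨ r = ω) {f : E → F} {a : E}
    (hf : SmoothNear 𝕜 r f a) {f' : E ≃L[𝕜] F} (hf' : HasFDerivAt f (f' : E →L[𝕜] F) a) :
    ∃ g : F → E, g (f a) = a ∧ SmoothNear 𝕜 r g (f a) ∧
      (∀ᶠ x in 𝓝 a, g (f x) = x) ∧ (∀ᶠ y in 𝓝 (f a), f (g y) = y) := by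
  have hr0 : r ≠ 0 := by rcases hr with rfl | rfl <;> simp
  set P := hf.contDiffAt.toOpenPartialHomeomorph f hf' hr0 with hP
  have hPf : ∀ x, P x = f x := fun x => rfl
  have hmem : a ∈ P.source := hf.contDiffAt.mem_toOpenPartialHomeomorph_source hf' hr0
  have hmem' : f a ∈ P.target := P.map_source hmem
  have hga : P.symm (f a) = a := P.left_inv hmem
  refine ⟨P.symm, hga, ?_, ?_, ?_⟩
  · have hcont : Tendsto P.symm (𝓝 (f a)) (𝓝 a) := by
      have := (P.continuousAt_symm hmem').tendsto
      rwa [hga] at this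
    have hinv : ∀ᶠ x in 𝓝 a, fderiv 𝕜 f x ∈ range ((↑) : (E ≃L[𝕜] F) → E →L[𝕜] F) := by
      have hc : ContinuousAt (fun x => fderiv 𝕜 f x) a := (hf.fderiv_right hr).continuousAt
      refine hc.eventually (p := fun L => L ∈ range ((↑) : (E ≃L[𝕜] F) → E →L[𝕜] F)) ?_
      change _ ∈ 𝓝 (fderiv 𝕜 f a)
      rw [hf'.fderiv]
      exact f'.nhds
    filter_upwards [P.open_target.mem_nhds hmem', hcont.eventually hf, hcont.eventually hinv]
      with y hy hfy ⟨e, he⟩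
    refine P.contDiffAt_symm (f₀' := e) hy ?_ hfy
    rw [he]
    exact (hfy.differentiableAt hr0).hasFDerivAt
  · filter_upwards [P.open_source.mem_nhds hmem] with x hx
    exact P.left_inv hx
  · filter_upwards [P.open_target.mem_nhds hmem'] with y hy
    exact P.right_inv hy

theorem SmoothNear.isDiffeoGerm (hr : r = ∞ ∨ r = ω) {φ : E → E} (h0 : φ 0 = 0)
    (hφ : SmoothNear 𝕜 r φ 0) {φ' : E ≃L[𝕜] E} (hφ' : HasFDerivAt φ (φ' : E →L[𝕜] E) 0) :
    IsDiffeoGerm 𝕜 r φ := by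
  obtain ⟨g, hg0, hg, hgf, hfg⟩ := hφ.exists_local_inverse hr hφ'
  rw [h0] at hg0 hg hfg
  exact ⟨h0, hφ, g, hg0, hg, hgf, hfg⟩

/-- The inverse function theorem is applied to `(x, u) ↦ (x, G (x, u))`. A scalar unknown suffices,
since the unknown will always be a flow time. -/
theorem SmoothNear.exists_implicit (hr : r = ∞ ∨ r = ω) {G : X × 𝕜 → 𝕜} {a : X} {u₀ : 𝕜}
    (hG : SmoothNear 𝕜 r G (a, u₀)) (h0 : G (a, u₀) = 0) {c : 𝕜} (hc : c ≠ 0)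
    (hd : HasDerivAt (fun u => G (a, u)) c u₀) :
    ∃ u : X → 𝕜, SmoothNear 𝕜 r u a ∧ u a = u₀ ∧ ∀ᶠ x in 𝓝 a, G (x, u x) = 0 := by
  have hr0 : r ≠ 0 := by rcases hr with rfl | rfl <;> simp
  have hGd := (hG.differentiableAt hr0).hasFDerivAt
  set A := fderiv 𝕜 G (a, u₀) with hA
  have hA2 : ∀ s, A (0, s) = c * s := by
    intro s
    have h1 : HasFDerivAt (fun u : 𝕜 => (a, u)) (ContinuousLinearMap.inr 𝕜 X 𝕜) u₀ :=
      hasFDerivAt_prodMk_right a u₀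
    have h2 := (hGd.comp u₀ h1).hasDerivAt.unique hd
    have h3 : A (0, 1) = c := by simpa using h2
    have : ((0 : X), s) = s • ((0 : X), (1 : 𝕜)) := by ext <;> simp
    rw [this, map_smul, h3, smul_eq_mul, mul_comm]
  have hA1 : ∀ z, A z = A (z.1, 0) + c * z.2 := by
    intro z
    rw [← hA2, ← map_add]
    simp
  -- The inverse solves `A (x, 0) + c * u = s` for `u`, hence the factor `c⁻¹`.
  let e : (X × 𝕜) ≃L[𝕜] (X × 𝕜) := ContinuousLinearEquiv.equivOfInverse
    ((ContinuousLinearMap.fst 𝕜 X 𝕜).prod A)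
    ((ContinuousLinearMap.fst 𝕜 X 𝕜).prod
      (c⁻¹ • (ContinuousLinearMap.snd 𝕜 X 𝕜 -
        (A.comp (ContinuousLinearMap.inl 𝕜 X 𝕜)).comp (ContinuousLinearMap.fst 𝕜 X 𝕜))))
    (fun z => by
      ext
      · simp
      · simp [hA1 z, hc])
    (fun z => by
      ext
      · simp
      · simp only [ContinuousLinearMap.prod_apply, ContinuousLinearMap.coe_fst']
        rw [hA1]
        simp [hc])
  have hF : SmoothNear 𝕜 r (fun z : X × 𝕜 => (z.1, G z)) (a, u₀) := by fun_prop
  have hF' : HasFDerivAt (fun z : X × 𝕜 => (z.1, G z)) (e : (X × 𝕜) →L[𝕜] (X × 𝕜)) (a, u₀) :=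
    HasFDerivAt.prodMk hasFDerivAt_fst hGd
  obtain ⟨g, hg0, hg, -, hfg⟩ := hF.exists_local_inverse hr hF'
  simp only [h0] at hg0 hg hfg
  have hpair : ContinuousAt (fun x : X => (x, (0 : 𝕜))) a := by fun_prop
  refine ⟨fun x => (g (x, 0)).2, by fun_prop, by simp [hg0], ?_⟩
  filter_upwards [hpair.eventually hfg] with x hx
  have h1 : (g (x, 0)).1 = x := congrArg Prod.fst hx
  have h2 : G (g (x, 0)) = 0 := congrArg Prod.snd hx
  have h3 : ((x, (g (x, 0)).2) : X × 𝕜) = g (x, 0) := Prod.ext h1.symm rfl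
  change G (x, (g (x, 0)).2) = 0
  rw [h3, h2]

end Inverse

/-! ### Integrals along families of contractions -/

section ParametricIntegral

open MeasureTheory intervalIntegral
open scoped Interval

universe u

variable {𝕜 : Type u} [RCLike 𝕜] {E F F' : Type u}
  [NormedAddCommGroup E] [NormedSpace 𝕜 E]
  [NormedAddCommGroup F] [NormedSpace 𝕜 F]
  [NormedAddCommGroup F'] [NormedSpace 𝕜 F'] [NormedSpace ℝ F'] [SMulCommClass 𝕜 ℝ F']

theorem mem_ball_contraction {T : ℝ → E →L[𝕜] E} (hT1 : ∀ τ ∈ Icc (0 : ℝ) 1, ‖T τ‖ ≤ 1)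
    {ε : ℝ} {z : E} (hz : z ∈ Metric.ball 0 ε) {τ : ℝ} (hτ : τ ∈ Icc (0 : ℝ) 1) :
    T τ z ∈ Metric.ball (0 : E) ε := by
  rw [mem_ball_zero_iff] at hz ⊢
  calc ‖T τ z‖ ≤ ‖T τ‖ * ‖z‖ := (T τ).le_opNorm z
    _ ≤ 1 * ‖z‖ := by gcongr; exact hT1 τ hτ
    _ < ε := by simpa using hz

/-- Differentiation under the integral sign along a family of contractions. -/
theorem hasFDerivAt_integral_contraction [ProperSpace E] {T : ℝ → E →L[𝕜] E} (hT : Continuous T)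
    (hT1 : ∀ τ ∈ Icc (0 : ℝ) 1, ‖T τ‖ ≤ 1) {C : ℝ → F →L[𝕜] F'} (hC : Continuous C)
    {ρ : E → F} {ε : ℝ} (hρ : ContDiffOn 𝕜 1 ρ (Metric.ball 0 ε)) {z : E}
    (hz : z ∈ Metric.ball 0 ε) :
    HasFDerivAt (fun z => ∫ τ in (0 : ℝ)..1, C τ (ρ (T τ z)))
      (∫ τ in (0 : ℝ)..1, (C τ).comp ((fderiv 𝕜 ρ (T τ z)).comp (T τ))) z := by
  have hz' : ‖z‖ < ε := by simpa using hz
  -- On the compact ball of intermediate radius the derivative of `ρ` is bounded, and the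
  -- contractions do not leave that ball; this gives a constant dominating function.
  obtain ⟨ε', h1, h2⟩ := exists_between hz'
  have hIcc : ∀ τ ∈ Ι (0 : ℝ) 1, τ ∈ Icc (0 : ℝ) 1 := by
    intro τ hτ
    rw [uIoc_of_le zero_le_one] at hτ
    exact Ioc_subset_Icc_self hτ
  have hρd : DifferentiableOn 𝕜 ρ (Metric.ball 0 ε) := hρ.differentiableOn (by simp)
  have hρ' : ContinuousOn (fderiv 𝕜 ρ) (Metric.ball 0 ε) :=
    hρ.continuousOn_fderiv_of_isOpen Metric.isOpen_ball le_rfl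
  have hsub : Metric.closedBall (0 : E) ε' ⊆ Metric.ball 0 ε := Metric.closedBall_subset_ball h2
  obtain ⟨M, hM⟩ := (isCompact_closedBall (0 : E) ε').exists_bound_of_continuousOn
    (hρ'.mono hsub)
  obtain ⟨K, hK⟩ := (isCompact_Icc (a := (0 : ℝ)) (b := 1)).exists_bound_of_continuousOn
    hC.continuousOn
  have hcont : ∀ x ∈ Metric.ball (0 : E) ε, ContinuousOn (fun τ => T τ x) (Icc (0 : ℝ) 1) :=
    fun x _ => (hT.clm_apply continuous_const).continuousOn
  have hcF : ∀ x ∈ Metric.ball (0 : E) ε,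
      ContinuousOn (fun τ => C τ (ρ (T τ x))) (Icc (0 : ℝ) 1) := by
    intro x hx
    exact hC.continuousOn.clm_apply (hρd.continuousOn.comp (hcont x hx)
      fun τ hτ => mem_ball_contraction hT1 hx hτ)
  have hcF' : ContinuousOn (fun τ => (C τ).comp ((fderiv 𝕜 ρ (T τ z)).comp (T τ)))
      (Icc (0 : ℝ) 1) :=
    hC.continuousOn.clm_comp ((hρ'.comp (hcont z hz)
      fun τ hτ => mem_ball_contraction hT1 hz hτ).clm_comp hT.continuousOn)
  have hball : Metric.ball (0 : E) ε' ∈ 𝓝 z := Metric.isOpen_ball.mem_nhds (by simpa using h1)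
  refine intervalIntegral.hasFDerivAt_integral_of_dominated_of_fderiv_le (𝕜 := 𝕜) (μ := volume)
    (F := fun z τ => C τ (ρ (T τ z)))
    (F' := fun z τ => (C τ).comp ((fderiv 𝕜 ρ (T τ z)).comp (T τ)))
    (bound := fun _ => K * (M * 1)) hball ?_ ?_ ?_ ?_ ?_ ?_
  · filter_upwards [hball] with x hx
    rw [uIoc_of_le zero_le_one]
    exact ((hcF x (hsub (Metric.ball_subset_closedBall hx))).mono
      Ioc_subset_Icc_self).aestronglyMeasurable measurableSet_Ioc
  · refine ContinuousOn.intervalIntegrable ?_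
    rw [uIcc_of_le zero_le_one]
    exact hcF z hz
  · rw [uIoc_of_le zero_le_one]
    exact (hcF'.mono Ioc_subset_Icc_self).aestronglyMeasurable measurableSet_Ioc
  · refine Eventually.of_forall fun τ hτ x hx => ?_
    have hτ' := hIcc τ hτ
    have hTx : T τ x ∈ Metric.closedBall (0 : E) ε' :=
      Metric.ball_subset_closedBall (mem_ball_contraction hT1 hx hτ')
    have hM0 : 0 ≤ M := (norm_nonneg _).trans (hM _ hTx)
    have hK0 : 0 ≤ K := (norm_nonneg _).trans (hK _ hτ')
    refine (ContinuousLinearMap.opNorm_comp_le _ _).trans ?_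
    gcongr
    · exact hK _ hτ'
    · refine (ContinuousLinearMap.opNorm_comp_le _ _).trans ?_
      gcongr
      · exact hM _ hTx
      · exact hT1 _ hτ'
  · exact _root_.intervalIntegrable_const
  · refine Eventually.of_forall fun τ hτ x hx => ?_
    have hτ' := hIcc τ hτ
    have hTx : T τ x ∈ Metric.ball (0 : E) ε :=
      mem_ball_contraction hT1 (hsub (Metric.ball_subset_closedBall hx)) hτ'
    have h3 : HasFDerivAt ρ (fderiv 𝕜 ρ (T τ x)) (T τ x) :=
      (hρd.differentiableAt (Metric.isOpen_ball.mem_nhds hTx)).hasFDerivAt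
    exact (C τ).hasFDerivAt.comp x (h3.comp x (T τ).hasFDerivAt)

/-- The derivative of the integral is an integral of the same shape: `ρ` becomes its derivative, and
`C τ` becomes `A ↦ C τ ∘ A ∘ T τ`. The induction on the order therefore has to vary the target
spaces and needs operator-valued coefficients, which also forces a common universe. -/
theorem contDiffOn_integral_contraction [ProperSpace E] {T : ℝ → E →L[𝕜] E} (hT : Continuous T)
    (hT1 : ∀ τ ∈ Icc (0 : ℝ) 1, ‖T τ‖ ≤ 1) {ε : ℝ} (k : ℕ) :
    ∀ {F F' : Type u} [NormedAddCommGroup F] [NormedSpace 𝕜 F] [NormedAddCommGroup F']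
      [NormedSpace 𝕜 F'] [NormedSpace ℝ F'] [SMulCommClass 𝕜 ℝ F']
      {C : ℝ → F →L[𝕜] F'} (_ : Continuous C)
      {ρ : E → F} (_ : ContDiffOn 𝕜 ∞ ρ (Metric.ball 0 ε)),
      ContDiffOn 𝕜 k (fun z => ∫ τ in (0 : ℝ)..1, C τ (ρ (T τ z))) (Metric.ball 0 ε) := by
  induction k with
  | zero =>
    intro F F' _ _ _ _ _ _ C hC ρ hρ
    rw [Nat.cast_zero, contDiffOn_zero]
    intro z hz
    exact (hasFDerivAt_integral_contraction hT hT1 hC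
      (hρ.of_le (by simp)) hz).continuousAt.continuousWithinAt
  | succ k ih =>
    intro F F' _ _ _ _ _ _ C hC ρ hρ
    have hd := fun z (hz : z ∈ Metric.ball (0 : E) ε) =>
      hasFDerivAt_integral_contraction hT hT1 hC (hρ.of_le (by simp)) hz
    rw [Nat.cast_succ, contDiffOn_succ_iff_fderiv_of_isOpen Metric.isOpen_ball]
    refine ⟨fun z hz => (hd z hz).differentiableAt.differentiableWithinAt, by simp, ?_⟩
    let C' : ℝ → (E →L[𝕜] F) →L[𝕜] (E →L[𝕜] F') := fun τ =>
      (ContinuousLinearMap.compL 𝕜 E F F' (C τ)).comp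
        ((ContinuousLinearMap.compL 𝕜 E E F).flip (T τ))
    have hC' : Continuous C' := by
      refine Continuous.clm_comp ?_ ?_
      · exact (ContinuousLinearMap.continuous _).comp hC
      · exact (ContinuousLinearMap.continuous _).comp hT
    have hρ' : ContDiffOn 𝕜 ∞ (fderiv 𝕜 ρ) (Metric.ball 0 ε) :=
      hρ.fderiv_of_isOpen Metric.isOpen_ball (by simp)
    refine (ih hC' hρ').congr fun z hz => ?_
    rw [(hd z hz).fderiv]
    rfl

/-- The power series at the origin is integrated term by term. Composition with a contraction does
not increase the norm of a coefficient, so the integrated series converges on every ball strictly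
inside the original one, by dominated convergence. -/
theorem analyticAt_integral_contraction {T : ℝ → E →L[𝕜] E} (hT : Continuous T)
    (hT1 : ∀ τ ∈ Icc (0 : ℝ) 1, ‖T τ‖ ≤ 1) {c : ℝ → 𝕜} (hc : Continuous c)
    {ρ : E → 𝕜} (hρ : AnalyticAt 𝕜 ρ 0) :
    AnalyticAt 𝕜 (fun z => ∫ τ in (0 : ℝ)..1, c τ * ρ (T τ z)) 0 := by
  obtain ⟨P, R, hP⟩ := hρ
  have hIcc : ∀ τ ∈ Ι (0 : ℝ) 1, τ ∈ Icc (0 : ℝ) 1 := by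
    intro τ hτ
    rw [uIoc_of_le zero_le_one] at hτ
    exact Ioc_subset_Icc_self hτ
  obtain ⟨K, hK⟩ := (isCompact_Icc (a := (0 : ℝ)) (b := 1)).exists_bound_of_continuousOn
    hc.continuousOn
  have hK0 : 0 ≤ K := (norm_nonneg _).trans (hK 0 (by simp))
  let q : ℝ → FormalMultilinearSeries 𝕜 E 𝕜 := fun τ k =>
    c τ • (P k).compContinuousLinearMap fun _ => T τ
  have hq : ∀ k, Continuous fun τ => q τ k := by
    intro k
    refine hc.smul ?_
    have h1 : Continuous fun τ : ℝ =>
        ContinuousMultilinearMap.compContinuousLinearMapContinuousMultilinear 𝕜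
          (fun _ : Fin k => E) (fun _ : Fin k => E) 𝕜 (fun _ => T τ) :=
      (ContinuousMultilinearMap.cont _).comp (continuous_pi fun _ => hT)
    exact h1.clm_apply continuous_const
  have hqn : ∀ k, ∀ τ ∈ Icc (0 : ℝ) 1, ‖q τ k‖ ≤ K * ‖P k‖ := by
    intro k τ hτ
    have hn : ‖q τ k‖ = ‖c τ‖ * ‖(P k).compContinuousLinearMap fun _ => T τ‖ := norm_smul _ _
    rw [hn]
    gcongr
    · exact hK τ hτ
    · refine ((P k).norm_compContinuousLinearMap_le _).trans ?_
      refine mul_le_of_le_one_right (norm_nonneg _) ?_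
      exact Finset.prod_le_one (fun _ _ => norm_nonneg _) fun _ _ => hT1 τ hτ
  have hqi : ∀ k, IntervalIntegrable (fun τ => q τ k) volume 0 1 :=
    fun k => (hq k).intervalIntegrable _ _
  let Q : FormalMultilinearSeries 𝕜 E 𝕜 := fun k => ∫ τ in (0 : ℝ)..1, q τ k
  have hQn : ∀ k, ‖Q k‖ ≤ K * ‖P k‖ := by
    intro k
    have := intervalIntegral.norm_integral_le_of_norm_le_const (a := (0 : ℝ)) (b := 1)
      (f := fun τ => q τ k) (C := K * ‖P k‖) fun τ hτ => hqn k τ (hIcc τ hτ)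
    simpa using this
  -- The radius is shrunk strictly to get geometric bounds on the coefficients and absolute
  -- summability.
  obtain ⟨s, hs0, hsR⟩ := ENNReal.lt_iff_exists_nnreal_btwn.1 hP.r_pos
  have hsP : (s : ENNReal) < P.radius := hsR.trans_le hP.r_le
  refine ⟨Q, s, ?_, hs0, ?_⟩
  · obtain ⟨M, -, hM⟩ := P.norm_mul_pow_le_of_lt_radius hsP
    refine Q.le_radius_of_bound (K * M) fun k => ?_
    calc ‖Q k‖ * (s : ℝ) ^ k ≤ (K * ‖P k‖) * (s : ℝ) ^ k := by gcongr; exact hQn k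
      _ = K * (‖P k‖ * (s : ℝ) ^ k) := by ring
      _ ≤ K * M := by gcongr; exact hM k
  · intro y hy
    have hys : ‖y‖ < s := by simpa [Metric.eball_coe] using hy
    have hQy : ∀ k, (Q k fun _ => y) = ∫ τ in (0 : ℝ)..1, c τ * P k fun _ => T τ y := by
      intro k
      exact ((ContinuousMultilinearMap.apply 𝕜 (fun _ : Fin k => E) 𝕜
        (fun _ => y)).intervalIntegral_comp_comm (hqi k)).symm
    have hsum : Summable fun k => K * (‖P k‖ * ‖y‖ ^ k) := by
      have h1 : (‖y‖₊ : ENNReal) < P.radius := by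
        refine lt_trans ?_ hsP
        rw [ENNReal.coe_lt_coe]
        exact hys
      have h2 := P.summable_norm_mul_pow h1
      simp only [coe_nnnorm] at h2
      exact h2.mul_left K
    simp only [hQy, zero_add]
    refine intervalIntegral.hasSum_integral_of_dominated_convergence
      (fun k _ => K * (‖P k‖ * ‖y‖ ^ k)) ?_ ?_ ?_ ?_ ?_
    · intro k
      refine Continuous.aestronglyMeasurable ?_
      exact hc.mul ((P k).cont.comp (continuous_pi fun _ => hT.clm_apply continuous_const))
    · intro k
      refine Eventually.of_forall fun τ hτ => ?_
      have h := hIcc τ hτ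
      rw [norm_mul]
      gcongr
      · exact hK τ h
      · refine ((P k).le_opNorm _).trans ?_
        gcongr
        rw [Finset.prod_const, Finset.card_univ, Fintype.card_fin]
        gcongr
        exact ((T τ).le_opNorm y).trans (mul_le_of_le_one_left (norm_nonneg _) (hT1 τ h))
    · exact Eventually.of_forall fun τ _ => hsum
    · exact _root_.intervalIntegrable_const
    · refine Eventually.of_forall fun τ hτ => ?_
      have hmem : T τ y ∈ Metric.eball (0 : E) R := by
        refine Metric.eball_subset_eball hsR.le ?_
        rw [Metric.eball_coe]
        exact mem_ball_contraction hT1 (by simpa using hys) (hIcc τ hτ)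
      have hsum := hP.hasSum hmem
      rw [zero_add] at hsum
      exact hsum.mul_left (c τ)

theorem SmoothNear.integral_contraction [ProperSpace E] {r : WithTop ℕ∞} (hr : r = ∞ ∨ r = ω)
    {T : ℝ → E →L[𝕜] E} (hT : Continuous T)
    (hT1 : ∀ τ ∈ Icc (0 : ℝ) 1, ‖T τ‖ ≤ 1) {c : ℝ → 𝕜} (hc : Continuous c)
    {ρ : E → 𝕜} (hρ : SmoothNear 𝕜 r ρ 0) :
    SmoothNear 𝕜 r (fun z => ∫ τ in (0 : ℝ)..1, c τ * ρ (T τ z)) 0 := by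
  rcases hr with rfl | rfl
  · obtain ⟨ε, hε, h⟩ := Metric.eventually_nhds_iff_ball.1 hρ
    have hρ' : ContDiffOn 𝕜 ∞ ρ (Metric.ball 0 ε) := fun x hx => (h x hx).contDiffWithinAt
    filter_upwards [Metric.ball_mem_nhds (0 : E) hε] with z hz
    have hC : Continuous fun τ => c τ • ContinuousLinearMap.id 𝕜 𝕜 := hc.smul continuous_const
    refine ContDiffOn.contDiffAt (s := Metric.ball 0 ε) ?_ (Metric.isOpen_ball.mem_nhds hz)
    rw [contDiffOn_infty]
    intro k
    exact contDiffOn_integral_contraction hT hT1 k hC hρ'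
  · have h := analyticAt_integral_contraction hT hT1 hc
      (hρ.contDiffAt.analyticAt)
    filter_upwards [h.eventually_analyticAt] with z hz
    exact hz.contDiffAt

end ParametricIntegral

/-! ### The divergence equation for the Euler field -/

section Euler

open MeasureTheory intervalIntegral
open scoped Interval

universe u

variable {𝕜 : Type u} [RCLike 𝕜] {X : Type u} [NormedAddCommGroup X] [NormedSpace 𝕜 X] {d : ℕ}

/-- The quasihomogeneous dilation of the second factor. -/
noncomputable def dilation (X : Type u) [NormedAddCommGroup X] [NormedSpace 𝕜 X] (w : Fin d → ℕ)
    (s : 𝕜) : X × (Fin d → 𝕜) →L[𝕜] X × (Fin d → 𝕜) :=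
  (ContinuousLinearMap.fst 𝕜 X (Fin d → 𝕜)).prod
    (ContinuousLinearMap.pi fun i => s ^ w i •
      (ContinuousLinearMap.proj i).comp (ContinuousLinearMap.snd 𝕜 X (Fin d → 𝕜)))

theorem dilation_apply (w : Fin d → ℕ) (s : 𝕜) (z : X × (Fin d → 𝕜)) :
    dilation X w s z = (z.1, fun i => s ^ w i * z.2 i) :=
  rfl

theorem norm_dilation_le (w : Fin d → ℕ) {s : 𝕜} (hs : ‖s‖ ≤ 1) : ‖dilation X w s‖ ≤ 1 := by
  refine ContinuousLinearMap.opNorm_le_bound _ zero_le_one fun z => ?_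
  rw [dilation_apply, one_mul, Prod.norm_mk]
  refine max_le (norm_fst_le z) ?_
  refine (pi_norm_le_iff_of_nonneg (norm_nonneg _)).2 fun i => ?_
  rw [norm_mul, norm_pow]
  calc ‖s‖ ^ w i * ‖z.2 i‖ ≤ 1 * ‖z.2 i‖ := by
        gcongr
        exact pow_le_one₀ (norm_nonneg _) hs
    _ ≤ ‖z.2‖ := by rw [one_mul]; exact norm_le_pi_norm _ i
    _ ≤ ‖z‖ := norm_snd_le z

theorem continuous_dilation (w : Fin d → ℕ) : Continuous (dilation (𝕜 := 𝕜) X w) := by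
  have h : dilation (𝕜 := 𝕜) X w = fun s =>
      (ContinuousLinearMap.inl 𝕜 X (Fin d → 𝕜)).comp (ContinuousLinearMap.fst 𝕜 X (Fin d → 𝕜)) +
      ∑ i, s ^ w i • ((ContinuousLinearMap.inr 𝕜 X (Fin d → 𝕜)).comp
        (ContinuousLinearMap.single 𝕜 (fun _ : Fin d => 𝕜) i)).comp
          ((ContinuousLinearMap.proj i).comp (ContinuousLinearMap.snd 𝕜 X (Fin d → 𝕜))) := by
    funext s
    ext z i
    · simp [dilation_apply]
    · simp [dilation_apply]
    · simp [dilation_apply, Prod.fst_sum]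
    · simp [dilation_apply, Finset.sum_apply, Pi.single_apply, Prod.snd_sum]
  rw [h]
  fun_prop

/-- A primitive of `ρ` along the dilations of the second factor: if `α` is the contraction of the
volume form of the second factor with the Euler field of weights `w`, then the form
`eulerPrimitive w ρ • α` has exterior derivative `ρ` times the volume form. -/
noncomputable def eulerPrimitive (w : Fin d → ℕ) (ρ : X × (Fin d → 𝕜) → 𝕜)
    (z : X × (Fin d → 𝕜)) : 𝕜 :=
  ∫ τ in (0 : ℝ)..1, (τ : 𝕜) ^ (∑ i, w i - 1) * ρ (dilation X w (τ : 𝕜) z)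

theorem eulerPrimitive_def (w : Fin d → ℕ) (ρ : X × (Fin d → 𝕜) → 𝕜) :
    eulerPrimitive w ρ = fun z =>
      ∫ τ in (0 : ℝ)..1, (τ : 𝕜) ^ (∑ i, w i - 1) * ρ (dilation X w (τ : 𝕜) z) := by
  funext z
  simp only [eulerPrimitive]

theorem continuous_dilation_ofReal (w : Fin d → ℕ) :
    Continuous fun τ : ℝ => dilation X w (τ : 𝕜) :=
  (continuous_dilation w).comp RCLike.continuous_ofReal

theorem norm_dilation_ofReal_le (w : Fin d → ℕ) (τ : ℝ) (hτ : τ ∈ Icc (0 : ℝ) 1) :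
    ‖dilation X w (τ : 𝕜)‖ ≤ 1 := by
  refine norm_dilation_le w ?_
  rw [RCLike.norm_ofReal, abs_of_nonneg hτ.1]
  exact hτ.2

variable {r : WithTop ℕ∞}

theorem smoothNear_eulerPrimitive [ProperSpace X] (hr : r = ∞ ∨ r = ω) (w : Fin d → ℕ)
    {ρ : X × (Fin d → 𝕜) → 𝕜} (hρ : SmoothNear 𝕜 r ρ 0) :
    SmoothNear 𝕜 r (eulerPrimitive w ρ) 0 := by
  have hc : Continuous fun τ : ℝ => (τ : 𝕜) ^ (∑ i, w i - 1) := by fun_prop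
  have h := hρ.integral_contraction hr (continuous_dilation_ofReal (𝕜 := 𝕜) (X := X) w)
    (norm_dilation_ofReal_le w) hc
  rw [eulerPrimitive_def]
  exact h

theorem hasDerivAt_dilation (w : Fin d → ℕ) (z : X × (Fin d → 𝕜)) (s : 𝕜) :
    HasDerivAt (fun s => dilation X w s z)
      (0, fun i => ((w i : 𝕜) * s ^ (w i - 1)) * z.2 i) s := by
  simp only [dilation_apply]
  refine (hasDerivAt_const s z.1).prodMk (hasDerivAt_pi.2 fun i => ?_)
  exact (hasDerivAt_pow (w i) s).mul_const (z.2 i)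

/-- The equation `div (R E) = ρ` for `R = eulerPrimitive w ρ` and the Euler field `E`. -/
theorem fderiv_eulerPrimitive [ProperSpace X] (hr : r = ∞ ∨ r = ω) {w : Fin d → ℕ} (hw : 0 < ∑ i, w i)
    {ρ : X × (Fin d → 𝕜) → 𝕜} (hρ : SmoothNear 𝕜 r ρ 0) :
    ∀ᶠ z in 𝓝 0, fderiv 𝕜 (eulerPrimitive w ρ) z (0, fun i => (w i : 𝕜) * z.2 i) +
      ((∑ i, w i : ℕ) : 𝕜) * eulerPrimitive w ρ z = ρ z := by
  obtain ⟨ε, hε, h⟩ := Metric.eventually_nhds_iff_ball.1 hρ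
  have hr1 : 1 ≤ r := by rcases hr with rfl | rfl <;> simp
  have hρ' : ContDiffOn 𝕜 1 ρ (Metric.ball 0 ε) :=
    fun x hx => ((h x hx).of_le hr1).contDiffWithinAt
  filter_upwards [Metric.ball_mem_nhds (0 : X × (Fin d → 𝕜)) hε] with z hz
  set W := ∑ i, w i with hW
  have hC : Continuous fun τ : ℝ => (τ : 𝕜) ^ (W - 1) • ContinuousLinearMap.id 𝕜 𝕜 := by
    fun_prop
  have hd := hasFDerivAt_integral_contraction (T := fun τ : ℝ => dilation X w (τ : 𝕜))
    (continuous_dilation_ofReal w) (norm_dilation_ofReal_le w) hC hρ' hz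
  have hmem : ∀ τ ∈ Icc (0 : ℝ) 1, dilation X w (τ : 𝕜) z ∈ Metric.ball 0 ε := fun τ hτ =>
    mem_ball_contraction (T := fun τ : ℝ => dilation X w (τ : 𝕜)) (norm_dilation_ofReal_le w) hz hτ
  have hcd : ContinuousOn (fun τ : ℝ => dilation X w (τ : 𝕜) z) (Icc 0 1) :=
    ((continuous_dilation_ofReal w).clm_apply continuous_const).continuousOn
  have hcρ : ContinuousOn (fun τ : ℝ => ρ (dilation X w (τ : 𝕜) z)) (Icc 0 1) :=
    hρ'.continuousOn.comp hcd hmem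
  have hcρ' : ContinuousOn (fun τ : ℝ => fderiv 𝕜 ρ (dilation X w (τ : 𝕜) z)) (Icc 0 1) :=
    (hρ'.continuousOn_fderiv_of_isOpen Metric.isOpen_ball le_rfl).comp hcd hmem
  have hcc : ContinuousOn (fun τ : ℝ =>
      ((τ : 𝕜) ^ (W - 1) • ContinuousLinearMap.id 𝕜 𝕜).comp
        ((fderiv 𝕜 ρ (dilation X w (τ : 𝕜) z)).comp (dilation X w (τ : 𝕜)))) (Icc 0 1) :=
    hC.continuousOn.clm_comp (hcρ'.clm_comp (continuous_dilation_ofReal w).continuousOn)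
  have hint1 : IntervalIntegrable (fun τ : ℝ =>
      ((τ : 𝕜) ^ (W - 1) • ContinuousLinearMap.id 𝕜 𝕜).comp
        ((fderiv 𝕜 ρ (dilation X w (τ : 𝕜) z)).comp (dilation X w (τ : 𝕜)))) volume 0 1 := by
    refine ContinuousOn.intervalIntegrable ?_
    rwa [uIcc_of_le zero_le_one]
  set v : X × (Fin d → 𝕜) := (0, fun i => (w i : 𝕜) * z.2 i) with hv
  have hint2 : IntervalIntegrable (fun τ : ℝ => (τ : 𝕜) ^ (W - 1) *
      fderiv 𝕜 ρ (dilation X w (τ : 𝕜) z) (dilation X w (τ : 𝕜) v)) volume 0 1 := by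
    refine ContinuousOn.intervalIntegrable ?_
    rw [uIcc_of_le zero_le_one]
    exact hcc.clm_apply continuousOn_const
  have hint3 : IntervalIntegrable (fun τ : ℝ => (W : 𝕜) * ((τ : 𝕜) ^ (W - 1) *
      ρ (dilation X w (τ : 𝕜) z))) volume 0 1 := by
    refine ContinuousOn.intervalIntegrable ?_
    rw [uIcc_of_le zero_le_one]
    have : Continuous fun τ : ℝ => (τ : 𝕜) ^ (W - 1) := by fun_prop
    exact continuousOn_const.mul (this.continuousOn.mul hcρ)
  have happ : (∫ τ in (0 : ℝ)..1, ((τ : 𝕜) ^ (W - 1) • ContinuousLinearMap.id 𝕜 𝕜).comp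
        ((fderiv 𝕜 ρ (dilation X w (τ : 𝕜) z)).comp (dilation X w (τ : 𝕜)))) v =
      ∫ τ in (0 : ℝ)..1, (τ : 𝕜) ^ (W - 1) *
        fderiv 𝕜 ρ (dilation X w (τ : 𝕜) z) (dilation X w (τ : 𝕜) v) :=
    ((ContinuousLinearMap.apply 𝕜 𝕜 v).intervalIntegral_comp_comm hint1).symm
  simp only [eulerPrimitive_def]
  rw [← hW]
  simp only [smul_apply, ContinuousLinearMap.id_apply, smul_eq_mul] at hd
  rw [hd.fderiv, happ, ← intervalIntegral.integral_const_mul,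
    ← intervalIntegral.integral_add hint2 hint3]
  -- The integrand of `E R + W R` is the `τ`-derivative of `τ ^ W * ρ (dilation τ z)`. This function
  -- equals `ρ z` at `τ = 1` and vanishes at `τ = 0` because `W > 0`.
  have hder : ∀ τ ∈ uIcc (0 : ℝ) 1, HasDerivAt
      (fun τ : ℝ => (τ : 𝕜) ^ W * ρ (dilation X w (τ : 𝕜) z))
      ((τ : 𝕜) ^ (W - 1) * fderiv 𝕜 ρ (dilation X w (τ : 𝕜) z) (dilation X w (τ : 𝕜) v) +
        (W : 𝕜) * ((τ : 𝕜) ^ (W - 1) * ρ (dilation X w (τ : 𝕜) z))) τ := by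
    intro τ hτ
    rw [uIcc_of_le zero_le_one] at hτ
    have h1 : HasFDerivAt ρ (fderiv 𝕜 ρ (dilation X w (τ : 𝕜) z)) (dilation X w (τ : 𝕜) z) :=
      ((hρ'.differentiableOn (by simp)).differentiableAt
        (Metric.isOpen_ball.mem_nhds (hmem τ hτ))).hasFDerivAt
    have h2 := (hasDerivAt_pow W (τ : 𝕜)).mul
      (h1.comp_hasDerivAt (τ : 𝕜) (hasDerivAt_dilation w z (τ : 𝕜)))
    have h3 : HasDerivAt (fun τ : ℝ => (τ : 𝕜)) 1 τ := by
      simpa using (RCLike.ofRealCLM (K := 𝕜)).hasDerivAt (x := τ)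
    have h4 := h2.scomp τ h3
    refine HasDerivAt.congr_deriv (f := fun τ : ℝ => (τ : 𝕜) ^ W * ρ (dilation X w (τ : 𝕜) z)) h4 ?_
    have h5 : (τ : 𝕜) ^ W = (τ : 𝕜) ^ (W - 1) * τ := (pow_sub_one_mul hw.ne' _).symm
    have h6 : dilation X w (τ : 𝕜) v = (τ : 𝕜) •
        ((0, fun i => ((w i : 𝕜) * (τ : 𝕜) ^ (w i - 1)) * z.2 i) : X × (Fin d → 𝕜)) := by
      rw [dilation_apply, hv]
      ext i
      · simp
      · simp only [Prod.smul_mk, Pi.smul_apply, smul_eq_mul]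
        -- For weight zero the truncated exponent `w i - 1` is harmless: its coefficient `w i`
        -- vanishes.
        rcases Nat.eq_zero_or_pos (w i) with h0 | h0
        · simp [h0]
        · rw [← pow_sub_one_mul h0.ne']
          ring
    rw [h6, map_smul, one_smul, h5, smul_eq_mul]
    simp only [Function.comp_apply]
    ring
  rw [intervalIntegral.integral_eq_sub_of_hasDerivAt hder (hint2.add hint3)]
  simp [hw.ne', dilation_apply]

end Euler

/-! ### Scalings with variable flow time -/

section Scaling

universe u

variable {𝕜 : Type u} [RCLike 𝕜] {d : ℕ}

/-- The linear map given by a diagonal matrix. -/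
noncomputable def diagonalCLM (e : Fin d → 𝕜) : (Fin d → 𝕜) →L[𝕜] (Fin d → 𝕜) :=
  ContinuousLinearMap.pi fun i => e i • ContinuousLinearMap.proj i

@[simp]
theorem diagonalCLM_apply (e y : Fin d → 𝕜) : diagonalCLM e y = e * y :=
  rfl

theorem det_diagonalCLM (e : Fin d → 𝕜) : (diagonalCLM e).det = ∏ i, e i := by
  have h : LinearMap.toMatrix' (diagonalCLM e : (Fin d → 𝕜) →ₗ[𝕜] (Fin d → 𝕜)) =
      Matrix.diagonal e := by
    ext i j
    simp [LinearMap.toMatrix'_apply, Matrix.diagonal_apply, Pi.single_apply]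
  rw [ContinuousLinearMap.det, ← LinearMap.det_toMatrix', h, Matrix.det_diagonal]

theorem det_id_add_smulRight (f : (Fin d → 𝕜) →L[𝕜] 𝕜) (v : Fin d → 𝕜) :
    (ContinuousLinearMap.id 𝕜 (Fin d → 𝕜) + f.smulRight v).det = 1 + f v := by
  have h : ((ContinuousLinearMap.id 𝕜 (Fin d → 𝕜) + f.smulRight v :
      (Fin d → 𝕜) →L[𝕜] (Fin d → 𝕜)) : (Fin d → 𝕜) →ₗ[𝕜] (Fin d → 𝕜)) =
      LinearMap.transvection (f : Module.Dual 𝕜 (Fin d → 𝕜)) v := by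
    ext i
    simp [LinearMap.transvection]
  rw [ContinuousLinearMap.det, h, LinearMap.transvection.det]
  rfl

theorem det_comp_clm {E : Type*} [NormedAddCommGroup E] [NormedSpace 𝕜 E] (A B : E →L[𝕜] E) :
    (A.comp B).det = A.det * B.det := by
  simp only [ContinuousLinearMap.det]
  exact LinearMap.det_comp _ _

/-- The flow at time `s` of the linear vector field with eigenvalues `a`. -/
noncomputable def expScale (a : Fin d → 𝕜) (s : 𝕜) (y : Fin d → 𝕜) : Fin d → 𝕜 :=
  fun i => NormedSpace.exp (a i * s) * y i

theorem expScale_apply (a : Fin d → 𝕜) (s : 𝕜) (y : Fin d → 𝕜) (i : Fin d) :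
    expScale a s y i = NormedSpace.exp (a i * s) * y i :=
  rfl

@[simp]
theorem expScale_zero_right (a : Fin d → 𝕜) (s : 𝕜) : expScale a s 0 = 0 := by
  ext i
  simp [expScale]

@[simp]
theorem expScale_zero (a : Fin d → 𝕜) (y : Fin d → 𝕜) : expScale a 0 y = y := by
  ext i
  simp [expScale]

theorem expScale_add (a : Fin d → 𝕜) (s t : 𝕜) (y : Fin d → 𝕜) :
    expScale a (s + t) y = expScale a s (expScale a t y) := by
  ext i
  simp only [expScale]
  rw [mul_add, NormedSpace.exp_add, mul_assoc]

theorem expScale_neg_self (a : Fin d → 𝕜) (s : 𝕜) (y : Fin d → 𝕜) :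
    expScale a (-s) (expScale a s y) = y := by
  rw [← expScale_add]
  simp

theorem expScale_self_neg (a : Fin d → 𝕜) (s : 𝕜) (y : Fin d → 𝕜) :
    expScale a s (expScale a (-s) y) = y := by
  rw [← expScale_add]
  simp

variable {r : WithTop ℕ∞} {E : Type*} [NormedAddCommGroup E] [NormedSpace 𝕜 E]

@[fun_prop]
theorem SmoothNear.expScale (a : Fin d → 𝕜) {s : E → 𝕜} {y : E → Fin d → 𝕜} {x : E}
    (hs : SmoothNear 𝕜 r s x) (hy : SmoothNear 𝕜 r y x) :
    SmoothNear 𝕜 r (fun x => expScale a (s x) (y x)) x := by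
  unfold _root_.expScale
  fun_prop

@[fun_prop]
theorem SmoothNear.expScale_real {E : Type*} [NormedAddCommGroup E] [NormedSpace ℝ E]
    (a : Fin d → 𝕜) {s : E → 𝕜} {y : E → Fin d → 𝕜} {x : E}
    (hs : SmoothNear ℝ r s x) (hy : SmoothNear ℝ r y x) :
    SmoothNear ℝ r (fun x => _root_.expScale a (s x) (y x)) x := by
  unfold _root_.expScale
  fun_prop

/-- The derivative is written as a diagonal map after a rank-one perturbation of the identity, the
shape from which the determinant can be read off. -/
theorem hasFDerivAt_expScale (a : Fin d → 𝕜) {u : (Fin d → 𝕜) → 𝕜} {y : Fin d → 𝕜}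
    (hu : DifferentiableAt 𝕜 u y) :
    HasFDerivAt (fun y => expScale a (u y) y)
      ((diagonalCLM fun i => NormedSpace.exp (a i * u y)).comp
        (ContinuousLinearMap.id 𝕜 (Fin d → 𝕜) + (fderiv 𝕜 u y).smulRight (a * y))) y := by
  rw [hasFDerivAt_pi']
  intro i
  have h1 : HasFDerivAt (fun y : Fin d → 𝕜 => y i) (ContinuousLinearMap.proj (R := 𝕜) i) y :=
    (ContinuousLinearMap.proj (R := 𝕜) (φ := fun _ : Fin d => 𝕜) i).hasFDerivAt
  have h2 := (_root_.hasDerivAt_exp (𝕂 := 𝕜) (x := a i * u y)).comp_hasFDerivAt y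
    (hu.hasFDerivAt.const_mul (a i))
  refine (h2.mul h1).congr_fderiv ?_
  ext v
  simp only [ContinuousLinearMap.comp_apply, ContinuousLinearMap.proj_apply, diagonalCLM_apply,
    Pi.mul_apply, add_apply, smul_apply, smul_eq_mul, ContinuousLinearMap.id_apply,
    ContinuousLinearMap.smulRight_apply, Pi.add_apply, Pi.smul_apply, Function.comp_apply]
  ring

theorem det_fderiv_expScale (a : Fin d → 𝕜) {u : (Fin d → 𝕜) → 𝕜} {y : Fin d → 𝕜}
    (hu : DifferentiableAt 𝕜 u y) :
    (fderiv 𝕜 (fun y => expScale a (u y) y) y).det =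
      NormedSpace.exp ((∑ i, a i) * u y) * (1 + fderiv 𝕜 u y (a * y)) := by
  rw [(hasFDerivAt_expScale a hu).fderiv, det_comp_clm, det_diagonalCLM, det_id_add_smulRight,
    Finset.sum_mul, NormedSpace.exp_sum]

end Scaling

/-! ### Moser's theorem along Euler trajectories -/

section Moser

universe u

variable {𝕜 : Type u} [RCLike 𝕜] {X : Type u} [NormedAddCommGroup X] [NormedSpace 𝕜 X]
  [ProperSpace X] {d : ℕ} {r : WithTop ℕ∞}

/-- Moser's theorem for families of volume forms `ρ₀`, `ρ₁` (given by their densities): a family of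
diffeomorphisms preserving the trajectories of the Euler field pulls `ρ₁` back to `ρ₀`. -/
theorem exists_expScale_pullback (hr : r = ∞ ∨ r = ω) {w : Fin d → ℕ} (hw : 0 < ∑ i, w i)
    {ρ₀ ρ₁ : X × (Fin d → 𝕜) → 𝕜} (h₀ : SmoothNear 𝕜 r ρ₀ 0) (h₁ : SmoothNear 𝕜 r ρ₁ 0)
    (hne : ρ₁ 0 ≠ 0) {u₀ : 𝕜} (hu₀ : NormedSpace.exp ((∑ i, (w i : 𝕜)) * u₀) * ρ₁ 0 = ρ₀ 0) :
    ∃ u : X × (Fin d → 𝕜) → 𝕜, SmoothNear 𝕜 r u 0 ∧ u 0 = u₀ ∧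
      ∀ᶠ z in 𝓝 (0 : X × (Fin d → 𝕜)),
        ρ₁ (z.1, expScale (fun i => (w i : 𝕜)) (u z) z.2) *
          (fderiv 𝕜 (fun y => expScale (fun i => (w i : 𝕜)) (u (z.1, y)) y) z.2).det = ρ₀ z := by
  have hr0 : r ≠ 0 := by rcases hr with rfl | rfl <;> simp
  have : CompleteSpace X := inferInstance
  set a : Fin d → 𝕜 := fun i => (w i : 𝕜) with ha
  set W : 𝕜 := ∑ i, a i with hW
  have hWcast : ((∑ i, w i : ℕ) : 𝕜) = W := by simp [hW, ha]
  have hW0 : W ≠ 0 := by rw [← hWcast]; exact_mod_cast hw.ne'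
  set R₀ := eulerPrimitive w ρ₀ with hR₀
  set R₁ := eulerPrimitive w ρ₁ with hR₁
  have sR₀ : SmoothNear 𝕜 r R₀ 0 := smoothNear_eulerPrimitive hr w h₀
  have sR₁ : SmoothNear 𝕜 r R₁ 0 := smoothNear_eulerPrimitive hr w h₁
  have e₀ := fderiv_eulerPrimitive hr hw h₀
  have e₁ := fderiv_eulerPrimitive hr hw h₁
  rw [hWcast, ← hR₀] at e₀
  rw [hWcast, ← hR₁] at e₁
  have hzero : ((0 : X), fun i => (w i : 𝕜) * (0 : X × (Fin d → 𝕜)).2 i) = 0 := by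
    ext <;> simp
  have v₀ : W * R₀ 0 = ρ₀ 0 := by
    have := e₀.self_of_nhds
    rw [hzero] at this
    simpa using this
  have v₁ : W * R₁ 0 = ρ₁ 0 := by
    have := e₁.self_of_nhds
    rw [hzero] at this
    simpa using this
  -- `G = 0` says that the scaling with time `u` pulls the primitive `R₁ α` back to `R₀ α`; the
  -- Euler contraction `α` only picks up the factor `exp (W u)`.
  let G : (X × (Fin d → 𝕜)) × 𝕜 → 𝕜 := fun q =>
    NormedSpace.exp (W * q.2) * R₁ (q.1.1, expScale a q.2 q.1.2) - R₀ q.1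
  have hG0 : ∀ s, G (0, s) = NormedSpace.exp (W * s) * R₁ 0 - R₀ 0 := by
    intro s
    simp only [G, Prod.fst_zero, Prod.snd_zero, expScale_zero_right, Prod.mk_zero_zero]
  have sG : SmoothNear 𝕜 r G (0, u₀) := by
    have : SmoothNear 𝕜 r R₁ ((0 : X × (Fin d → 𝕜)).1, expScale a u₀ (0 : X × (Fin d → 𝕜)).2) := by
      rw [Prod.fst_zero, Prod.snd_zero, expScale_zero_right]
      exact sR₁
    fun_prop
  have hGz : G (0, u₀) = 0 := by
    rw [hG0]
    refine mul_left_cancel₀ hW0 ?_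
    linear_combination hu₀ + NormedSpace.exp (W * u₀) * v₁ - v₀
  have hc : NormedSpace.exp (W * u₀) * ρ₁ 0 ≠ 0 := mul_ne_zero (NormedSpace.isUnit_exp _).ne_zero hne
  -- Scalings fix the origin, so at `0` only the exponential varies with `s`, and `W * R₁ 0 = ρ₁ 0`
  -- is nonzero.
  have hGd : HasDerivAt (fun s => G (0, s)) (NormedSpace.exp (W * u₀) * ρ₁ 0) u₀ := by
    simp only [hG0]
    have h1 : HasDerivAt (fun s : 𝕜 => W * s) (W * 1) u₀ := (hasDerivAt_id u₀).const_mul W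
    have h2 := (((_root_.hasDerivAt_exp (𝕂 := 𝕜) (x := W * u₀)).comp u₀ h1).mul_const
      (R₁ 0)).sub_const (R₀ 0)
    refine h2.congr_deriv ?_
    rw [← v₁]
    ring
  obtain ⟨u, su, hu0, hu⟩ := sG.exists_implicit hr hGz hc hGd
  refine ⟨u, su, hu0, ?_⟩
  let Ψ : X × (Fin d → 𝕜) → X × (Fin d → 𝕜) := fun z => (z.1, expScale a (u z) z.2)
  have sΨ : SmoothNear 𝕜 r Ψ 0 := by fun_prop
  have hΨ0 : Ψ 0 = 0 := by simp [Ψ]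
  have tΨ : Tendsto Ψ (𝓝 0) (𝓝 0) := by
    have := sΨ.continuousAt.tendsto
    rwa [hΨ0] at this
  filter_upwards [eventually_eventually_nhds.2 hu, su, sR₀, e₀, tΨ.eventually sR₁,
    tΨ.eventually e₁] with z huz suz sR₀z e₀z sR₁z e₁z
  set Z : X × (Fin d → 𝕜) := (0, fun i => (w i : 𝕜) * z.2 i) with hZ
  have duz : HasFDerivAt u (fderiv 𝕜 u z) z := (suz.differentiableAt hr0).hasFDerivAt
  set α := fderiv 𝕜 u z Z with hα
  -- Only the derivative of `G = 0` in the Euler direction `Z` is needed, so it is enough to move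
  -- along a straight line tangent to `Z`.
  have hline : HasDerivAt (fun t : 𝕜 => z + t • Z) Z 0 := by
    simpa using ((hasDerivAt_id (0 : 𝕜)).smul_const Z).const_add z
  have hz0 : z + (0 : 𝕜) • Z = z := by simp
  have d1 : HasDerivAt (fun t : 𝕜 => u (z + t • Z)) α 0 :=
    HasFDerivAt.comp_hasDerivAt (0 : 𝕜) (by rw [hz0]; exact duz) hline
  have d2 : HasDerivAt (fun t : 𝕜 => R₀ (z + t • Z)) (fderiv 𝕜 R₀ z Z) 0 :=
    HasFDerivAt.comp_hasDerivAt (l := R₀) (0 : 𝕜)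
      (by rw [hz0]; exact (sR₀z.differentiableAt hr0).hasFDerivAt) hline
  -- The flow time changes at rate `α` in this direction, so `Ψ` pushes the Euler vector at `z` to
  -- `1 + α` times the Euler vector at `Ψ z`.
  have d3 : HasDerivAt (fun t : 𝕜 => Ψ (z + t • Z))
      ((1 + α) • ((0, fun i => (w i : 𝕜) * (Ψ z).2 i) : X × (Fin d → 𝕜))) 0 := by
    have h1 : HasDerivAt (fun t : 𝕜 => (z + t • Z).1) 0 0 := by
      simpa [hZ] using hasDerivAt_const (0 : 𝕜) z.1
    have h2 : ∀ i, HasDerivAt (fun t : 𝕜 => (z + t • Z).2 i) ((w i : 𝕜) * z.2 i) 0 := by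
      intro i
      have := ((hasDerivAt_id (0 : 𝕜)).mul_const ((w i : 𝕜) * z.2 i)).const_add (z.2 i)
      simpa [hZ] using this
    have h3 : HasDerivAt (fun t : 𝕜 => expScale a (u (z + t • Z)) (z + t • Z).2)
        (fun i => (1 + α) * ((w i : 𝕜) * (Ψ z).2 i)) 0 := by
      refine hasDerivAt_pi.2 fun i => ?_
      have := ((_root_.hasDerivAt_exp (𝕂 := 𝕜) (x := a i * u (z + (0 : 𝕜) • Z))).comp (0 : 𝕜)
        (d1.const_mul (a i))).mul (h2 i)
      refine this.congr_deriv ?_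
      simp only [hz0, Function.comp_apply, Ψ, expScale, ha]
      ring
    refine (h1.prodMk h3).congr_deriv ?_
    ext i
    · simp
    · simp
  have d4 : HasDerivAt (fun t : 𝕜 => R₁ (Ψ (z + t • Z)))
      (fderiv 𝕜 R₁ (Ψ z) ((1 + α) • ((0, fun i => (w i : 𝕜) * (Ψ z).2 i) : X × (Fin d → 𝕜)))) 0 :=
    HasFDerivAt.comp_hasDerivAt (l := R₁) (0 : 𝕜)
      (by rw [hz0]; exact (sR₁z.differentiableAt hr0).hasFDerivAt) d3
  have d5 : HasDerivAt (fun t : 𝕜 => NormedSpace.exp (W * u (z + t • Z)))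
      (NormedSpace.exp (W * u z) * (W * α)) 0 := by
    have := (_root_.hasDerivAt_exp (𝕂 := 𝕜) (x := W * u (z + (0 : 𝕜) • Z))).comp (0 : 𝕜)
        (d1.const_mul W)
    rwa [hz0] at this
  have d6 := d5.mul d4
  have heq : (fun t : 𝕜 => NormedSpace.exp (W * u (z + t • Z)) * R₁ (Ψ (z + t • Z))) =ᶠ[𝓝 0]
      fun t : 𝕜 => R₀ (z + t • Z) := by
    have : Tendsto (fun t : 𝕜 => z + t • Z) (𝓝 0) (𝓝 z) := by
      have := hline.continuousAt.tendsto
      rwa [hz0] at this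
    filter_upwards [this.eventually huz] with t ht
    exact sub_eq_zero.1 ht
  have key := (d2.congr_of_eventuallyEq heq).unique d6
  have hval : NormedSpace.exp (W * u z) * R₁ (Ψ z) = R₀ z := sub_eq_zero.1 huz.self_of_nhds
  rw [map_smul, smul_eq_mul, hz0] at key
  have hinr : HasFDerivAt (fun y : Fin d → 𝕜 => (z.1, y))
      (ContinuousLinearMap.inr 𝕜 X (Fin d → 𝕜)) z.2 := hasFDerivAt_prodMk_right z.1 z.2
  have duy : HasFDerivAt (fun y => u (z.1, y))
      ((fderiv 𝕜 u z).comp (ContinuousLinearMap.inr 𝕜 X (Fin d → 𝕜))) z.2 :=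
    HasFDerivAt.comp z.2 (by exact duz) hinr
  rw [det_fderiv_expScale a duy.differentiableAt, duy.fderiv]
  have hαy : ((fderiv 𝕜 u z).comp (ContinuousLinearMap.inr 𝕜 X (Fin d → 𝕜))) (a * z.2) = α := rfl
  rw [hαy]
  change ρ₁ (Ψ z) * (NormedSpace.exp (W * u z) * (1 + α)) = ρ₀ z
  -- The differentiated identity is combined with the Euler equations of `R₁` at `Ψ z` and of `R₀`
  -- at `z`; the undifferentiated identity absorbs the remaining multiple of `W`.
  linear_combination (-(NormedSpace.exp (W * u z) * (1 + α))) * e₁z - key + e₀z + W * hval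

end Moser

/-! ### The group of diffeomorphism germs -/

section DiffeoGerms

variable {𝕜 : Type*} [RCLike 𝕜] {r : WithTop ℕ∞} {E F : Type*}
  [NormedAddCommGroup E] [NormedSpace 𝕜 E] [NormedAddCommGroup F] [NormedSpace 𝕜 F]

theorem IsDiffeoGerm.tendsto {φ : E → E} (h : IsDiffeoGerm 𝕜 r φ) : Tendsto φ (𝓝 0) (𝓝 0) := by
  have := h.smooth.continuousAt.tendsto
  rwa [h.map_zero] at this

theorem IsDiffeoGerm.id : IsDiffeoGerm 𝕜 r (fun x : E => x) :=
  ⟨rfl, by fun_prop, fun x => x, rfl, by fun_prop, by simp, by simp⟩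

theorem IsDiffeoGerm.congr {φ φ' : E → E} (h : IsDiffeoGerm 𝕜 r φ) (he : φ =ᶠ[𝓝 0] φ') :
    IsDiffeoGerm 𝕜 r φ' := by
  obtain ⟨ψ, ψ0, sψ, h1, h2⟩ := h.exists_inverse
  have tψ : Tendsto ψ (𝓝 0) (𝓝 0) := by
    have := sψ.continuousAt.tendsto
    rwa [ψ0] at this
  refine ⟨by rw [← he.self_of_nhds, h.map_zero], h.smooth.congr he, ψ, ψ0, sψ, ?_, ?_⟩
  · filter_upwards [h1, he] with x hx hx'
    rw [← hx', hx]
  · filter_upwards [h2, tψ.eventually he] with x hx hx'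
    rw [← hx', hx]

theorem IsDiffeoGerm.exists_symm {φ : E → E} (h : IsDiffeoGerm 𝕜 r φ) :
    ∃ ψ : E → E, IsDiffeoGerm 𝕜 r ψ ∧ (∀ᶠ x in 𝓝 (0 : E), ψ (φ x) = x) ∧
      (∀ᶠ x in 𝓝 (0 : E), φ (ψ x) = x) := by
  obtain ⟨ψ, ψ0, sψ, h1, h2⟩ := h.exists_inverse
  exact ⟨ψ, ⟨ψ0, sψ, φ, h.map_zero, h.smooth, h2, h1⟩, h1, h2⟩

theorem IsDiffeoGerm.comp {φ ψ : E → E} (hφ : IsDiffeoGerm 𝕜 r φ) (hψ : IsDiffeoGerm 𝕜 r ψ) :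
    IsDiffeoGerm 𝕜 r (fun x => φ (ψ x)) := by
  obtain ⟨φ', dφ', h1, h2⟩ := hφ.exists_symm
  obtain ⟨ψ', dψ', h3, h4⟩ := hψ.exists_symm
  have key : ∀ {α β : E → E}, IsDiffeoGerm 𝕜 r α → IsDiffeoGerm 𝕜 r β →
      SmoothNear 𝕜 r (fun x => α (β x)) 0 := by
    intro α β hα hβ
    have : SmoothNear 𝕜 r α (β 0) := by
      rw [hβ.map_zero]
      exact hα.smooth
    exact this.comp 0 hβ.smooth
  refine ⟨by rw [hψ.map_zero, hφ.map_zero], key hφ hψ, fun x => ψ' (φ' x),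
    by simp only [dφ'.map_zero, dψ'.map_zero], key dψ' dφ', ?_, ?_⟩
  · filter_upwards [h3, hψ.tendsto.eventually h1] with x hx hx'
    rw [hx', hx]
  · filter_upwards [h2, dφ'.tendsto.eventually h4] with x hx hx'
    rw [hx', hx]

theorem IsDiffeoGerm.prodMap_id {φ : E → E} (h : IsDiffeoGerm 𝕜 r φ) :
    IsDiffeoGerm 𝕜 r (fun z : E × F => (φ z.1, z.2)) := by
  obtain ⟨ψ, dψ, h1, h2⟩ := h.exists_symm
  have sφ : SmoothNear 𝕜 r φ (0 : E × F).1 := h.smooth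
  have sψ : SmoothNear 𝕜 r ψ (0 : E × F).1 := dψ.smooth
  have hf : Tendsto (Prod.fst : E × F → E) (𝓝 0) (𝓝 0) := continuous_fst.tendsto _
  refine ⟨by simp [h.map_zero], by fun_prop, fun z => (ψ z.1, z.2), by simp [dψ.map_zero],
    by fun_prop, ?_, ?_⟩
  · filter_upwards [hf.eventually h1] with z hz
    exact Prod.ext hz rfl
  · filter_upwards [hf.eventually h2] with z hz
    exact Prod.ext hz rfl

theorem IsDiffeoGerm.differentiableAt (hr : r = ∞ ∨ r = ω) {φ : E → E}
    (h : IsDiffeoGerm 𝕜 r φ) : DifferentiableAt 𝕜 φ 0 :=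
  h.smooth.differentiableAt (by rcases hr with rfl | rfl <;> simp)

theorem IsDiffeoGerm.det_ne_zero (hr : r = ∞ ∨ r = ω) {φ : E → E} (h : IsDiffeoGerm 𝕜 r φ) :
    (fderiv 𝕜 φ 0).det ≠ 0 := by
  obtain ⟨ψ, dψ, h1, h2⟩ := h.exists_symm
  have hφ : HasFDerivAt φ (fderiv 𝕜 φ 0) (ψ 0) := by
    rw [dψ.map_zero]
    exact (h.differentiableAt hr).hasFDerivAt
  have h3 := hφ.comp 0 (dψ.differentiableAt hr).hasFDerivAt
  have h4 : fderiv 𝕜 φ 0 ∘L fderiv 𝕜 ψ 0 = ContinuousLinearMap.id 𝕜 E :=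
    (h3.congr_of_eventuallyEq (f₁ := fun x => x)
      (by filter_upwards [h2] with x hx using hx.symm)).unique (hasFDerivAt_id 0)
  have h5 : (fderiv 𝕜 φ 0 ∘L fderiv 𝕜 ψ 0).det = 1 := by
    rw [h4]
    simp [ContinuousLinearMap.det]
  intro h0
  rw [det_comp_clm, h0, zero_mul] at h5
  exact zero_ne_one h5

end DiffeoGerms

/-! ### The group of families of diffeomorphisms -/

section FamilyGerms

variable {𝕜 : Type*} [RCLike 𝕜] {r : WithTop ℕ∞} {n p : ℕ}
  {θ θ' : (Fin n → 𝕜) → (Fin p → 𝕜) → (Fin p → 𝕜)} {φ : (Fin n → 𝕜) → (Fin n → 𝕜)}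

theorem IsFamilyGerm.smooth (h : IsFamilyGerm 𝕜 r θ) :
    SmoothNear 𝕜 r (fun z : (Fin n → 𝕜) × (Fin p → 𝕜) => θ z.1 z.2) 0 :=
  h.diffeo.smooth.snd

theorem IsFamilyGerm.map_zero (h : IsFamilyGerm 𝕜 r θ) : θ 0 0 = 0 :=
  h.fixes_zero.self_of_nhds

theorem IsFamilyGerm.tendsto (h : IsFamilyGerm 𝕜 r θ) :
    Tendsto (fun z : (Fin n → 𝕜) × (Fin p → 𝕜) => (z.1, θ z.1 z.2)) (𝓝 0) (𝓝 0) :=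
  h.diffeo.tendsto

theorem IsFamilyGerm.comp (h : IsFamilyGerm 𝕜 r θ) (h' : IsFamilyGerm 𝕜 r θ') :
    IsFamilyGerm 𝕜 r (fun x y => θ x (θ' x y)) := by
  refine ⟨?_, h.diffeo.comp h'.diffeo⟩
  filter_upwards [h.fixes_zero, h'.fixes_zero] with x hx hx'
  rw [hx', hx]

/-- The associated map of the product is the conjugate of `(x, y) ↦ (x, θ x y)` by `φ × id`. -/
theorem IsFamilyGerm.reparam (h : IsFamilyGerm 𝕜 r θ) (hφ : IsDiffeoGerm 𝕜 r φ) :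
    IsFamilyGerm 𝕜 r (fun x => θ (φ x)) := by
  refine ⟨hφ.tendsto.eventually h.fixes_zero, ?_⟩
  obtain ⟨ψ, dψ, h1, -⟩ := hφ.exists_symm
  refine ((dψ.prodMap_id (F := Fin p → 𝕜)).comp (h.diffeo.comp hφ.prodMap_id)).congr ?_
  have hf : Tendsto (Prod.fst : (Fin n → 𝕜) × (Fin p → 𝕜) → _) (𝓝 0) (𝓝 0) :=
    continuous_fst.tendsto _
  filter_upwards [hf.eventually h1] with z hz
  simp only [hz]

/-- The inverse of a diffeomorphism that preserves the first coordinate preserves it too, hence is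
again a family. -/
theorem IsFamilyGerm.exists_symm (h : IsFamilyGerm 𝕜 r θ) :
    ∃ η, IsFamilyGerm 𝕜 r η ∧
      (∀ᶠ z in 𝓝 (0 : (Fin n → 𝕜) × (Fin p → 𝕜)), η z.1 (θ z.1 z.2) = z.2) ∧
      (∀ᶠ z in 𝓝 (0 : (Fin n → 𝕜) × (Fin p → 𝕜)), θ z.1 (η z.1 z.2) = z.2) := by
  obtain ⟨N, dN, h1, h2⟩ := h.diffeo.exists_symm
  have hN : ∀ᶠ z in 𝓝 (0 : (Fin n → 𝕜) × (Fin p → 𝕜)), N z = (z.1, (N z).2) := by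
    filter_upwards [h2] with z hz
    have h3 : (N z).1 = z.1 := (Prod.ext_iff.1 hz).1
    exact Prod.ext h3 rfl
  refine ⟨fun x y => (N (x, y)).2, ⟨?_, dN.congr hN⟩, ?_, ?_⟩
  · have : Tendsto (fun x : Fin n → 𝕜 => (x, (0 : Fin p → 𝕜))) (𝓝 0) (𝓝 0) :=
      Continuous.tendsto' (by fun_prop) _ _ rfl
    filter_upwards [h.fixes_zero, this.eventually h1] with x hx hx'
    simp only [hx] at hx'
    rw [hx']
  · filter_upwards [h1] with z hz
    rw [hz]
  · filter_upwards [h2, hN] with z hz hz'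
    have h3 : θ (N z).1 (N z).2 = z.2 := (Prod.ext_iff.1 hz).2
    rwa [hz'] at h3

theorem IsFamilyGerm.at_zero (h : IsFamilyGerm 𝕜 r θ) : IsDiffeoGerm 𝕜 r (θ 0) := by
  obtain ⟨η, hη, h1, h2⟩ := h.exists_symm
  have ht : Tendsto (fun y : Fin p → 𝕜 => ((0 : Fin n → 𝕜), y)) (𝓝 0) (𝓝 0) :=
    Continuous.tendsto' (by fun_prop) _ _ rfl
  have key : ∀ {θ : (Fin n → 𝕜) → (Fin p → 𝕜) → (Fin p → 𝕜)}, IsFamilyGerm 𝕜 r θ →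
      SmoothNear 𝕜 r (θ 0) 0 := fun {θ} hθ =>
    SmoothNear.comp (g := fun z : (Fin n → 𝕜) × (Fin p → 𝕜) => θ z.1 z.2) (0 : Fin p → 𝕜)
      hθ.smooth (by fun_prop : SmoothNear 𝕜 r (fun y : Fin p → 𝕜 => ((0 : Fin n → 𝕜), y)) 0)
  exact ⟨h.map_zero, key h, η 0, hη.map_zero, key hη, ht.eventually h1, ht.eventually h2⟩

end FamilyGerms

/-! ### Composition and inversion in the Mather groups -/

section MatherGroups

variable {𝕜 : Type*} [RCLike 𝕜] {r : WithTop ℕ∞} {n p : ℕ} {G : Mather}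
  {θ θ' : (Fin n → 𝕜) → (Fin p → 𝕜) → (Fin p → 𝕜)} {φ φ' : (Fin n → 𝕜) → (Fin n → 𝕜)}

/-- The family of diffeomorphisms of the target is constant. -/
def IsConstantFamily (θ : (Fin n → 𝕜) → (Fin p → 𝕜) → (Fin p → 𝕜)) : Prop :=
  ∀ᶠ z in 𝓝 (0 : (Fin n → 𝕜) × (Fin p → 𝕜)), θ z.1 z.2 = θ 0 z.2

theorem tendsto_zero_fst : Tendsto (fun z : (Fin n → 𝕜) × (Fin p → 𝕜) =>
    ((0 : Fin n → 𝕜), z.2)) (𝓝 0) (𝓝 0) :=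
  Continuous.tendsto' (by fun_prop) _ _ rfl

theorem tendsto_map_fst (hφ : IsDiffeoGerm 𝕜 r φ) :
    Tendsto (fun z : (Fin n → 𝕜) × (Fin p → 𝕜) => (φ z.1, z.2)) (𝓝 0) (𝓝 0) :=
  hφ.prodMap_id.tendsto

theorem IsConstantFamily.comp (h : IsConstantFamily θ) (h' : IsConstantFamily θ')
    (hθ' : IsFamilyGerm 𝕜 r θ') :
    IsConstantFamily (fun x y => θ x (θ' x y)) := by
  filter_upwards [h', hθ'.tendsto.eventually h] with z hz hz'
  rw [hz', hz]

theorem IsConstantFamily.reparam (h : IsConstantFamily θ) (hφ : IsDiffeoGerm 𝕜 r φ) :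
    IsConstantFamily (fun x => θ (φ x)) := by
  filter_upwards [(tendsto_map_fst hφ).eventually h] with z hz
  rw [hφ.map_zero]
  exact hz

theorem IsConstantFamily.symm (h : IsConstantFamily θ) {η} (hη : IsFamilyGerm 𝕜 r η)
    (h1 : ∀ᶠ z in 𝓝 (0 : (Fin n → 𝕜) × (Fin p → 𝕜)), η z.1 (θ z.1 z.2) = z.2)
    (h2 : ∀ᶠ z in 𝓝 (0 : (Fin n → 𝕜) × (Fin p → 𝕜)), θ z.1 (η z.1 z.2) = z.2) :
    IsConstantFamily η := by
  have ht : Tendsto (fun z : (Fin n → 𝕜) × (Fin p → 𝕜) => ((0 : Fin n → 𝕜), η z.1 z.2))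
      (𝓝 0) (𝓝 0) := tendsto_zero_fst.comp hη.tendsto
  filter_upwards [h2, hη.tendsto.eventually h, ht.eventually h1] with z hz hz' hz''
  rw [hz] at hz'
  rw [← hz'] at hz''
  exact hz''.symm

/-- A uniform description that avoids repeating every group law for each group. The group `ℛ` would
need a further clause and admits neither notion of weak quasihomogeneity. -/
theorem Mather.mem_iff (hG : G ≠ .R) :
    G.Mem r φ θ ↔ IsDiffeoGerm 𝕜 r φ ∧ IsFamilyGerm 𝕜 r θ ∧
      (G = .L ∨ G = .C → ∀ᶠ x in 𝓝 (0 : Fin n → 𝕜), φ x = x) ∧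
      (G = .A ∨ G = .L → IsConstantFamily θ) := by
  cases G <;> simp_all [Mather.Mem, IsConstantFamily]

theorem Mather.Mem.comp (hG : G ≠ .R) (h : G.Mem r φ θ) (h' : G.Mem r φ' θ') :
    G.Mem r (fun x => φ' (φ x)) (fun x y => θ x (θ' (φ x) y)) := by
  rw [Mather.mem_iff hG] at h h' ⊢
  obtain ⟨a, b, c, d⟩ := h
  obtain ⟨a', b', c', d'⟩ := h'
  refine ⟨a'.comp a, b.comp (b'.reparam a), fun e => ?_, fun e => ?_⟩
  · filter_upwards [c e, a.tendsto.eventually (c' e)] with x hx hx'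
    rw [hx', hx]
  · exact (d e).comp ((d' e).reparam a) (b'.reparam a)

/-- The inverse of an element `(φ, θ)` of `G` is of the form `(ψ, x ↦ η (ψ x))`, where `ψ` is
inverse to `φ` and `η x` is inverse to `θ x`. -/
theorem Mather.Mem.exists_inverse (hG : G ≠ .R) (h : G.Mem r φ θ) :
    ∃ ψ η, G.Mem r ψ (fun x => η (ψ x)) ∧ IsDiffeoGerm 𝕜 r ψ ∧ IsFamilyGerm 𝕜 r η ∧
      (∀ᶠ x in 𝓝 (0 : Fin n → 𝕜), ψ (φ x) = x) ∧ (∀ᶠ x in 𝓝 (0 : Fin n → 𝕜), φ (ψ x) = x) ∧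
      (∀ᶠ z in 𝓝 (0 : (Fin n → 𝕜) × (Fin p → 𝕜)), η z.1 (θ z.1 z.2) = z.2) ∧
      (∀ᶠ z in 𝓝 (0 : (Fin n → 𝕜) × (Fin p → 𝕜)), θ z.1 (η z.1 z.2) = z.2) := by
  rw [Mather.mem_iff hG] at h
  obtain ⟨a, b, c, d⟩ := h
  obtain ⟨ψ, dψ, h1, h2⟩ := a.exists_symm
  obtain ⟨η, dη, h3, h4⟩ := b.exists_symm
  refine ⟨ψ, η, ?_, dψ, dη, h1, h2, h3, h4⟩
  rw [Mather.mem_iff hG]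
  refine ⟨dψ, dη.reparam dψ, fun e => ?_, fun e => ?_⟩
  · filter_upwards [h1, c e] with x hx hx'
    rwa [hx'] at hx
  · exact ((d e).symm dη h3 h4).reparam dψ

theorem IsImage.trans {f g h : (Fin n → 𝕜) → (Fin p → 𝕜)} (hφ : IsDiffeoGerm 𝕜 r φ)
    (h1 : IsImage φ θ f g) (h2 : IsImage φ' θ' h f) :
    IsImage (fun x => φ' (φ x)) (fun x y => θ x (θ' (φ x) y)) h g := by
  filter_upwards [h1, hφ.tendsto.eventually h2] with x hx hx'
  rw [hx, hx']

theorem IsMapGerm.tendsto {f : (Fin n → 𝕜) → (Fin p → 𝕜)} (hf : IsMapGerm r f) :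
    Tendsto f (𝓝 0) (𝓝 0) := by
  have := hf.smooth.continuousAt.tendsto
  rwa [hf.map_zero] at this

theorem IsMapGerm.tendsto_graph {f : (Fin n → 𝕜) → (Fin p → 𝕜)} (hf : IsMapGerm r f) :
    Tendsto (fun x => (x, f x)) (𝓝 0) (𝓝 0) := by
  have := tendsto_id.prodMk_nhds hf.tendsto
  exact this

theorem IsImage.symm {f g : (Fin n → 𝕜) → (Fin p → 𝕜)} (hf : IsMapGerm r f)
    (hφ : IsDiffeoGerm 𝕜 r φ) {ψ : (Fin n → 𝕜) → (Fin n → 𝕜)}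
    {η : (Fin n → 𝕜) → (Fin p → 𝕜) → (Fin p → 𝕜)} (hψ : IsDiffeoGerm 𝕜 r ψ)
    (h1 : ∀ᶠ x in 𝓝 (0 : Fin n → 𝕜), φ (ψ x) = x)
    (h2 : ∀ᶠ z in 𝓝 (0 : (Fin n → 𝕜) × (Fin p → 𝕜)), η z.1 (θ z.1 z.2) = z.2)
    (h : IsImage φ θ f g) : IsImage ψ (fun x => η (ψ x)) g f := by
  have ht : Tendsto (fun x => (x, f (φ x))) (𝓝 0) (𝓝 0) := by
    have := tendsto_id.prodMk_nhds (hf.tendsto.comp hφ.tendsto)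
    exact this
  filter_upwards [h1, hψ.tendsto.eventually h, hψ.tendsto.eventually (ht.eventually h2)]
    with x hx hx' hx''
  simp only [hx] at hx' hx''
  rw [hx', hx'']

end MatherGroups

/-! ### Pullback of densities -/

section Density

universe u

variable {𝕜 : Type u} [RCLike 𝕜] {r : WithTop ℕ∞} {n p : ℕ}

theorem SmoothNear.prod {E : Type*} [NormedAddCommGroup E] [NormedSpace 𝕜 E] {ι : Type*}
    {s : Finset ι} {f : ι → E → 𝕜} {a : E} (hf : ∀ i ∈ s, SmoothNear 𝕜 r (f i) a) :
    SmoothNear 𝕜 r (fun x => ∏ i ∈ s, f i x) a := by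
  have : ∀ᶠ x in 𝓝 a, ∀ i ∈ s, ContDiffAt 𝕜 r (f i) x := (Finset.eventually_all s).2 hf
  filter_upwards [this] with x hx
  exact contDiffAt_prod hx

theorem SmoothNear.det {E : Type*} [NormedAddCommGroup E] [NormedSpace 𝕜 E]
    {A : E → (Fin p → 𝕜) →L[𝕜] (Fin p → 𝕜)} {a : E} (hA : SmoothNear 𝕜 r A a) :
    SmoothNear 𝕜 r (fun x => (A x).det) a := by
  have h : (fun x => (A x).det) = fun x => ∑ σ : Equiv.Perm (Fin p),
      ((Equiv.Perm.sign σ : ℤ) : 𝕜) * ∏ i, A x (Pi.single i 1) (σ i) := by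
    funext x
    rw [ContinuousLinearMap.det, ← LinearMap.det_toMatrix', Matrix.det_apply']
    simp [LinearMap.toMatrix'_apply]
  rw [h]
  refine SmoothNear.sum fun σ _ => SmoothNear.mul (smoothNear_const _ _) (SmoothNear.prod fun i _ => ?_)
  exact SmoothNear.comp (g := fun y : Fin p → 𝕜 => y (σ i)) a (SmoothNear.apply _)
    (hA.clm_apply (smoothNear_const _ _))

/-- The density of the pullback of a family of volume forms with density `ρ` by the family `θ`. -/
noncomputable def familyPullback (θ : (Fin n → 𝕜) → (Fin p → 𝕜) → (Fin p → 𝕜))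
    (ρ : (Fin n → 𝕜) × (Fin p → 𝕜) → 𝕜) (z : (Fin n → 𝕜) × (Fin p → 𝕜)) : 𝕜 :=
  ρ (z.1, θ z.1 z.2) * (fderiv 𝕜 (θ z.1) z.2).det

/-- The density of the pullback of a volume form with density `ρ` by `φ`. -/
noncomputable def densityPullback (φ : (Fin n → 𝕜) → (Fin n → 𝕜)) (ρ : (Fin n → 𝕜) → 𝕜)
    (x : Fin n → 𝕜) : 𝕜 :=
  ρ (φ x) * (fderiv 𝕜 φ x).det

theorem densityPullback_comp (hr : r = ∞ ∨ r = ω) {φ ψ : (Fin n → 𝕜) → (Fin n → 𝕜)}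
    (hφ : IsDiffeoGerm 𝕜 r φ) (hψ : IsDiffeoGerm 𝕜 r ψ) (ρ : (Fin n → 𝕜) → 𝕜) :
    ∀ᶠ x in 𝓝 (0 : Fin n → 𝕜), densityPullback (fun x => φ (ψ x)) ρ x =
      densityPullback ψ (densityPullback φ ρ) x := by
  have hr0 : r ≠ 0 := by rcases hr with rfl | rfl <;> simp
  filter_upwards [hψ.smooth, hψ.tendsto.eventually hφ.smooth] with x hx hx'
  have h := ((hx'.differentiableAt hr0).hasFDerivAt.comp x (hx.differentiableAt hr0).hasFDerivAt)
  have h' : fderiv 𝕜 (fun x => φ (ψ x)) x = (fderiv 𝕜 φ (ψ x)).comp (fderiv 𝕜 ψ x) := h.fderiv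
  simp only [densityPullback, h', det_comp_clm]
  ring

theorem densityPullback_congr {φ φ' : (Fin n → 𝕜) → (Fin n → 𝕜)} (h : φ =ᶠ[𝓝 0] φ')
    (ρ : (Fin n → 𝕜) → 𝕜) : densityPullback φ ρ =ᶠ[𝓝 0] densityPullback φ' ρ := by
  filter_upwards [eventually_eventually_nhds.2 h] with x hx
  simp only [densityPullback]
  rw [EventuallyEq.fderiv_eq hx, hx.self_of_nhds]

theorem densityPullback_id (ρ : (Fin n → 𝕜) → 𝕜) : densityPullback (fun x => x) ρ = ρ := by
  funext x
  simp [densityPullback, ContinuousLinearMap.det]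

theorem SmoothNear.densityPullback (hr : r = ∞ ∨ r = ω) {φ : (Fin n → 𝕜) → (Fin n → 𝕜)}
    (hφ : IsDiffeoGerm 𝕜 r φ) {ρ : (Fin n → 𝕜) → 𝕜} (hρ : SmoothNear 𝕜 r ρ 0) :
    SmoothNear 𝕜 r (fun x => densityPullback φ ρ x) 0 := by
  have h1 : SmoothNear 𝕜 r ρ (φ 0) := by rwa [hφ.map_zero]
  have h2 := (hφ.smooth.fderiv_right hr).det
  have h3 := hφ.smooth
  unfold _root_.densityPullback
  fun_prop

theorem hasFDerivAt_section {θ : (Fin n → 𝕜) → (Fin p → 𝕜) → (Fin p → 𝕜)}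
    {z : (Fin n → 𝕜) × (Fin p → 𝕜)}
    (h : DifferentiableAt 𝕜 (fun z : (Fin n → 𝕜) × (Fin p → 𝕜) => θ z.1 z.2) z) :
    HasFDerivAt (θ z.1) ((fderiv 𝕜 (fun z : (Fin n → 𝕜) × (Fin p → 𝕜) => θ z.1 z.2) z).comp
      (ContinuousLinearMap.inr 𝕜 (Fin n → 𝕜) (Fin p → 𝕜))) z.2 := by
  have hinr : HasFDerivAt (fun y : Fin p → 𝕜 => (z.1, y))
      (ContinuousLinearMap.inr 𝕜 (Fin n → 𝕜) (Fin p → 𝕜)) z.2 := hasFDerivAt_prodMk_right z.1 z.2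
  exact HasFDerivAt.comp (g := fun z : (Fin n → 𝕜) × (Fin p → 𝕜) => θ z.1 z.2) z.2
    (by exact h.hasFDerivAt) hinr

theorem SmoothNear.familyPullback (hr : r = ∞ ∨ r = ω)
    {θ : (Fin n → 𝕜) → (Fin p → 𝕜) → (Fin p → 𝕜)} (hθ : IsFamilyGerm 𝕜 r θ)
    {ρ : (Fin n → 𝕜) × (Fin p → 𝕜) → 𝕜} (hρ : SmoothNear 𝕜 r ρ 0) :
    SmoothNear 𝕜 r (fun z => familyPullback θ ρ z) 0 := by
  have hr0 : r ≠ 0 := by rcases hr with rfl | rfl <;> simp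
  have h3 := hθ.smooth
  have h1 : SmoothNear 𝕜 r ρ ((0 : (Fin n → 𝕜) × (Fin p → 𝕜)).1,
      θ (0 : (Fin n → 𝕜) × (Fin p → 𝕜)).1 (0 : (Fin n → 𝕜) × (Fin p → 𝕜)).2) := by
    have : ((0 : (Fin n → 𝕜) × (Fin p → 𝕜)).1,
      θ (0 : (Fin n → 𝕜) × (Fin p → 𝕜)).1 (0 : (Fin n → 𝕜) × (Fin p → 𝕜)).2) = 0 :=
      Prod.ext rfl hθ.map_zero
    rwa [this]
  have h2 : SmoothNear 𝕜 r (fun z : (Fin n → 𝕜) × (Fin p → 𝕜) => (fderiv 𝕜 (θ z.1) z.2).det) 0 := by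
    have h4 : SmoothNear 𝕜 r (fun z =>
        (fderiv 𝕜 (fun z : (Fin n → 𝕜) × (Fin p → 𝕜) => θ z.1 z.2) z).comp
          (ContinuousLinearMap.inr 𝕜 (Fin n → 𝕜) (Fin p → 𝕜))) 0 := by
      have h5 := h3.fderiv_right hr
      filter_upwards [h5] with z hz
      exact hz.clm_comp contDiffAt_const
    refine h4.det.congr ?_
    filter_upwards [h3] with z hz
    rw [(hasFDerivAt_section (hz.differentiableAt hr0)).fderiv]
  have h4 : SmoothNear 𝕜 r (fun z : (Fin n → 𝕜) × (Fin p → 𝕜) => ρ (z.1, θ z.1 z.2)) 0 :=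
    SmoothNear.comp (0 : (Fin n → 𝕜) × (Fin p → 𝕜)) h1 (by fun_prop)
  exact h4.mul h2

theorem familyPullback_comp (hr : r = ∞ ∨ r = ω)
    {θ θ' : (Fin n → 𝕜) → (Fin p → 𝕜) → (Fin p → 𝕜)} (hθ : IsFamilyGerm 𝕜 r θ)
    (hθ' : IsFamilyGerm 𝕜 r θ') (ρ : (Fin n → 𝕜) × (Fin p → 𝕜) → 𝕜) :
    ∀ᶠ z in 𝓝 (0 : (Fin n → 𝕜) × (Fin p → 𝕜)), familyPullback (fun x y => θ x (θ' x y)) ρ z =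
      familyPullback θ' (familyPullback θ ρ) z := by
  have hr0 : r ≠ 0 := by rcases hr with rfl | rfl <;> simp
  filter_upwards [hθ'.smooth, hθ'.tendsto.eventually hθ.smooth] with z hz hz'
  have h1 := hasFDerivAt_section (hz.differentiableAt hr0)
  have h2 := hasFDerivAt_section (hz'.differentiableAt hr0)
  have h : fderiv 𝕜 (fun y => θ z.1 (θ' z.1 y)) z.2 =
      (fderiv 𝕜 (θ z.1) (θ' z.1 z.2)).comp (fderiv 𝕜 (θ' z.1) z.2) :=
    (h2.differentiableAt.hasFDerivAt.comp z.2 h1.differentiableAt.hasFDerivAt).fderiv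
  simp only [familyPullback, h, det_comp_clm]
  ring

theorem familyPullback_congr {θ θ' : (Fin n → 𝕜) → (Fin p → 𝕜) → (Fin p → 𝕜)}
    (h : ∀ᶠ z in 𝓝 (0 : (Fin n → 𝕜) × (Fin p → 𝕜)), θ z.1 z.2 = θ' z.1 z.2)
    (ρ : (Fin n → 𝕜) × (Fin p → 𝕜) → 𝕜) : familyPullback θ ρ =ᶠ[𝓝 0] familyPullback θ' ρ := by
  filter_upwards [eventually_eventually_nhds.2 h] with z hz
  have ht : Tendsto (fun y : Fin p → 𝕜 => (z.1, y)) (𝓝 z.2) (𝓝 z) :=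
    Continuous.tendsto' (by fun_prop) _ _ rfl
  have h1 : θ z.1 =ᶠ[𝓝 z.2] θ' z.1 := ht.eventually hz
  simp only [familyPullback]
  rw [h1.fderiv_eq, h1.self_of_nhds]

theorem familyPullback_congr_density {θ : (Fin n → 𝕜) → (Fin p → 𝕜) → (Fin p → 𝕜)}
    (hθ : IsFamilyGerm 𝕜 r θ) {ρ ρ' : (Fin n → 𝕜) × (Fin p → 𝕜) → 𝕜} (h : ρ =ᶠ[𝓝 0] ρ') :
    familyPullback θ ρ =ᶠ[𝓝 0] familyPullback θ ρ' := by
  filter_upwards [hθ.tendsto.eventually h] with z hz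
  simp only [familyPullback, hz]

theorem familyPullback_id (ρ : (Fin n → 𝕜) × (Fin p → 𝕜) → 𝕜) :
    familyPullback (fun _ y => y) ρ = ρ := by
  funext x
  simp [familyPullback, ContinuousLinearMap.det]

/-- The density does not depend on the first variable. -/
def IsConstantDensity (ρ : (Fin n → 𝕜) × (Fin p → 𝕜) → 𝕜) : Prop :=
  ∀ᶠ z in 𝓝 (0 : (Fin n → 𝕜) × (Fin p → 𝕜)), ρ z = ρ (0, z.2)

theorem IsConstantDensity.familyPullback {θ : (Fin n → 𝕜) → (Fin p → 𝕜) → (Fin p → 𝕜)}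
    (hθ : IsFamilyGerm 𝕜 r θ) (hc : IsConstantFamily θ)
    {ρ : (Fin n → 𝕜) × (Fin p → 𝕜) → 𝕜} (hρ : IsConstantDensity ρ) :
    IsConstantDensity (familyPullback θ ρ) := by
  filter_upwards [familyPullback_congr (θ' := fun _ => θ 0) hc ρ, hθ.tendsto.eventually hρ, hc,
    (hθ.tendsto.comp tendsto_zero_fst).eventually hρ] with z h1 h2 h3 h4
  rw [h1]
  simp only [_root_.familyPullback]
  rw [h3] at h2
  rw [h2]

theorem densityPullback_zero_ne_zero (hr : r = ∞ ∨ r = ω) {φ : (Fin n → 𝕜) → (Fin n → 𝕜)}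
    (hφ : IsDiffeoGerm 𝕜 r φ) {ρ : (Fin n → 𝕜) → 𝕜} (hρ : ρ 0 ≠ 0) :
    densityPullback φ ρ 0 ≠ 0 := by
  simp only [densityPullback, hφ.map_zero]
  exact mul_ne_zero hρ (hφ.det_ne_zero hr)

theorem familyPullback_zero (θ : (Fin n → 𝕜) → (Fin p → 𝕜) → (Fin p → 𝕜))
    (hθ : IsFamilyGerm 𝕜 r θ) (ρ : (Fin n → 𝕜) × (Fin p → 𝕜) → 𝕜) :
    familyPullback θ ρ 0 = ρ 0 * (fderiv 𝕜 (θ 0) 0).det := by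
  simp only [familyPullback, Prod.fst_zero, Prod.snd_zero, hθ.map_zero, Prod.mk_zero_zero]

theorem familyPullback_zero_ne_zero (hr : r = ∞ ∨ r = ω)
    {θ : (Fin n → 𝕜) → (Fin p → 𝕜) → (Fin p → 𝕜)}
    (hθ : IsFamilyGerm 𝕜 r θ) {ρ : (Fin n → 𝕜) × (Fin p → 𝕜) → 𝕜} (hρ : ρ 0 ≠ 0) :
    familyPullback θ ρ 0 ≠ 0 := by
  rw [familyPullback_zero θ hθ]
  exact mul_ne_zero hρ (hθ.at_zero.det_ne_zero hr)

/-- A condition on two nonzero numbers which is vacuous over the complex numbers and which means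
over the real numbers that they have the same sign. -/
def SameSign (a b : 𝕜) : Prop :=
  (RCLike.I : 𝕜) = 0 → ∃ c : ℝ, 0 < c ∧ b = (c : 𝕜) * a

theorem SameSign.mul_right {a b : 𝕜} (h : SameSign a b) (c : 𝕜) : SameSign (a * c) (b * c) := by
  intro hI
  obtain ⟨k, hk, hb⟩ := h hI
  exact ⟨k, hk, by rw [hb]; ring⟩

/-- Over the reals the quotient is positive and has a logarithm; over the complex numbers every
nonzero quotient has one. This is where the orientation hypothesis is used. -/
theorem SameSign.exists_exp {a b : 𝕜} (h : SameSign a b) (ha : a ≠ 0) (hb : b ≠ 0) :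
    ∃ s : 𝕜, NormedSpace.exp s * b = a := by
  by_cases hI : (RCLike.I : 𝕜) = 0
  · obtain ⟨c, hc, rfl⟩ := h hI
    refine ⟨((-Real.log c : ℝ) : 𝕜), ?_⟩
    have h1 : NormedSpace.exp ((-Real.log c : ℝ) : 𝕜) = ((Real.exp (-Real.log c) : ℝ) : 𝕜) := by
      rw [Real.exp_eq_exp_ℝ]
      exact (NormedSpace.map_exp (algebraMap ℝ 𝕜) RCLike.continuous_ofReal _).symm
    rw [h1, Real.exp_neg, Real.exp_log hc, ← mul_assoc, ← RCLike.ofReal_mul,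
      inv_mul_cancel₀ hc.ne', RCLike.ofReal_one, one_mul]
  · have him := (RCLike.I_eq_zero_or_im_I_eq_one (K := 𝕜)).resolve_left hI
    let e := RCLike.complexRingEquiv him
    have he : Continuous e := (RCLike.complexLinearIsometryEquiv him).continuous
    refine ⟨e.symm (Complex.log (e (a / b))), ?_⟩
    have h1 : e (NormedSpace.exp (e.symm (Complex.log (e (a / b))))) = e (a / b) := by
      rw [NormedSpace.map_exp e he, e.apply_symm_apply, ← Complex.exp_eq_exp_ℂ, Complex.exp_log]
      rw [Ne, EmbeddingLike.map_eq_zero_iff]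
      exact div_ne_zero ha hb
    rw [e.injective h1, div_mul_cancel₀ _ hb]

end Density

/-! ### Scalings as germs, and Moser's theorem for them -/

section ScalingGerms

universe u

variable {𝕜 : Type u} [RCLike 𝕜] {r : WithTop ℕ∞} {n p d : ℕ}

/-- The map `expScale a s` as a linear equivalence. -/
noncomputable def expScaleEquiv (a : Fin d → 𝕜) (s : 𝕜) : (Fin d → 𝕜) ≃L[𝕜] (Fin d → 𝕜) :=
  ContinuousLinearEquiv.equivOfInverse (diagonalCLM fun i => NormedSpace.exp (a i * s))
    (diagonalCLM fun i => NormedSpace.exp (a i * -s)) (expScale_neg_self a s) (expScale_self_neg a s)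

theorem isDiffeoGerm_expScale (hr : r = ∞ ∨ r = ω) (a : Fin d → 𝕜) {v : (Fin d → 𝕜) → 𝕜}
    (hv : SmoothNear 𝕜 r v 0) : IsDiffeoGerm 𝕜 r (fun x => expScale a (v x) x) := by
  have hr0 : r ≠ 0 := by rcases hr with rfl | rfl <;> simp
  have hs : SmoothNear 𝕜 r (fun x => expScale a (v x) x) 0 := by fun_prop
  refine hs.isDiffeoGerm hr (φ' := expScaleEquiv a (v 0)) (by simp) ?_
  refine (hasFDerivAt_expScale a (hv.differentiableAt hr0)).congr_fderiv ?_
  ext x i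
  simp [expScaleEquiv]

/-- A family of linear maps with smooth inverse is in Mather's group `𝒞`. -/
theorem isFamilyGerm_linear {A B : (Fin n → 𝕜) → (Fin p → 𝕜) →L[𝕜] (Fin p → 𝕜)}
    (hA : SmoothNear 𝕜 r A 0) (hB : SmoothNear 𝕜 r B 0) (hBA : ∀ x y, B x (A x y) = y)
    (hAB : ∀ x y, A x (B x y) = y) : IsFamilyGerm 𝕜 r (fun x y => A x y) := by
  have hA' : SmoothNear 𝕜 r A (0 : (Fin n → 𝕜) × (Fin p → 𝕜)).1 := hA
  have hB' : SmoothNear 𝕜 r B (0 : (Fin n → 𝕜) × (Fin p → 𝕜)).1 := hB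
  exact ⟨by simp, by simp, by fun_prop, fun z => (z.1, B z.1 z.2), by simp, by fun_prop,
    by simp [hBA], by simp [hAB]⟩

theorem isFamilyGerm_expScale (hr : r = ∞ ∨ r = ω) (a : Fin p → 𝕜)
    {v : (Fin n → 𝕜) × (Fin p → 𝕜) → 𝕜} (hv : SmoothNear 𝕜 r v 0) :
    IsFamilyGerm 𝕜 r (fun x y => expScale a (v (x, y)) y) := by
  have hr0 : r ≠ 0 := by rcases hr with rfl | rfl <;> simp
  refine ⟨by simp, ?_⟩
  have hs : SmoothNear 𝕜 r (fun z : (Fin n → 𝕜) × (Fin p → 𝕜) =>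
      (z.1, expScale a (v z) z.2)) 0 := by fun_prop
  refine hs.isDiffeoGerm hr (φ' := (ContinuousLinearEquiv.refl 𝕜 (Fin n → 𝕜)).prodCongr
    (expScaleEquiv a (v 0))) (by simp) ?_
  have h1 : HasFDerivAt (fun z : (Fin n → 𝕜) × (Fin p → 𝕜) => expScale a (v z) z.2)
      ((diagonalCLM fun i => NormedSpace.exp (a i * v 0)).comp
        (ContinuousLinearMap.snd 𝕜 (Fin n → 𝕜) (Fin p → 𝕜))) 0 := by
    rw [hasFDerivAt_pi']
    intro i
    have h2 : HasFDerivAt (fun z : (Fin n → 𝕜) × (Fin p → 𝕜) => z.2 i)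
        ((ContinuousLinearMap.proj (R := 𝕜) i).comp
          (ContinuousLinearMap.snd 𝕜 (Fin n → 𝕜) (Fin p → 𝕜))) 0 :=
      ((ContinuousLinearMap.proj (R := 𝕜) i).comp
          (ContinuousLinearMap.snd 𝕜 (Fin n → 𝕜) (Fin p → 𝕜))).hasFDerivAt
    have h3 := (_root_.hasDerivAt_exp (𝕂 := 𝕜) (x := a i * v 0)).comp_hasFDerivAt 0
      ((hv.differentiableAt hr0).hasFDerivAt.const_mul (a i))
    refine (h3.mul h2).congr_fderiv ?_
    ext z <;> simp
  exact (hasFDerivAt_fst (p := (0 : (Fin n → 𝕜) × (Fin p → 𝕜)))).prodMk h1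

@[fun_prop]
theorem smoothNear_ofReal {E : Type*} [NormedAddCommGroup E] [NormedSpace ℝ E] {t : E → ℝ} {a : E}
    (ht : SmoothNear ℝ r t a) : SmoothNear ℝ r (fun x => (t x : 𝕜)) a :=
  SmoothNear.comp a ((RCLike.ofRealCLM (K := 𝕜)).contDiff.smoothNear (t a)) ht

theorem exists_expScale_densityPullback (hr : r = ∞ ∨ r = ω) {w : Fin n → ℕ} (hw : 0 < ∑ i, w i)
    {ρ₀ ρ₁ : (Fin n → 𝕜) → 𝕜} (h₀ : SmoothNear 𝕜 r ρ₀ 0) (h₁ : SmoothNear 𝕜 r ρ₁ 0)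
    (hne₀ : ρ₀ 0 ≠ 0) (hne₁ : ρ₁ 0 ≠ 0) (hs : SameSign (ρ₀ 0) (ρ₁ 0)) :
    ∃ u : (Fin n → 𝕜) → 𝕜, SmoothNear 𝕜 r u 0 ∧
      densityPullback (fun x => expScale (fun i => (w i : 𝕜)) (u x) x) ρ₁ =ᶠ[𝓝 0] ρ₀ := by
  obtain ⟨s, hs⟩ := hs.exists_exp hne₀ hne₁
  have hW : (∑ i, (w i : 𝕜)) ≠ 0 := by exact_mod_cast hw.ne'
  have h₀' : SmoothNear 𝕜 r ρ₀ (0 : 𝕜 × (Fin n → 𝕜)).2 := h₀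
  have h₁' : SmoothNear 𝕜 r ρ₁ (0 : 𝕜 × (Fin n → 𝕜)).2 := h₁
  -- The parameter space is a dummy; the solution is restricted to its slice at `0`.
  obtain ⟨u, su, -, hu⟩ := exists_expScale_pullback (X := 𝕜) hr hw
    (ρ₀ := fun z => ρ₀ z.2) (ρ₁ := fun z => ρ₁ z.2) (by fun_prop) (by fun_prop) hne₁
    (u₀ := s / ∑ i, (w i : 𝕜)) (by rw [mul_div_cancel₀ _ hW]; exact hs)
  have ht : Tendsto (fun y : Fin n → 𝕜 => ((0 : 𝕜), y)) (𝓝 0) (𝓝 0) :=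
    Continuous.tendsto' (by fun_prop) _ _ rfl
  have su' : SmoothNear 𝕜 r u ((0 : 𝕜), (0 : Fin n → 𝕜)) := su
  refine ⟨fun y => u (0, y), by fun_prop, ?_⟩
  filter_upwards [ht.eventually hu] with y hy
  exact hy

/-- The last clause serves `𝒜` and `ℒ`, where the target map must not depend on `x`. For constant
densities the equation is solved on the slice `x = 0` and the solution is extended constantly, so
that independence of `x` holds by construction. -/
theorem exists_expScale_familyPullback (hr : r = ∞ ∨ r = ω) {w : Fin p → ℕ} (hw : 0 < ∑ i, w i)
    {ρ₀ ρ₁ : (Fin n → 𝕜) × (Fin p → 𝕜) → 𝕜} (h₀ : SmoothNear 𝕜 r ρ₀ 0)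
    (h₁ : SmoothNear 𝕜 r ρ₁ 0) (hne₀ : ρ₀ 0 ≠ 0) (hne₁ : ρ₁ 0 ≠ 0)
    (hs : SameSign (ρ₀ 0) (ρ₁ 0)) :
    ∃ u : (Fin n → 𝕜) × (Fin p → 𝕜) → 𝕜, SmoothNear 𝕜 r u 0 ∧
      familyPullback (fun x y => expScale (fun i => (w i : 𝕜)) (u (x, y)) y) ρ₁ =ᶠ[𝓝 0] ρ₀ ∧
      (IsConstantDensity ρ₀ → IsConstantDensity ρ₁ → ∀ z, u z = u (0, z.2)) := by
  by_cases hc : IsConstantDensity ρ₀ ∧ IsConstantDensity ρ₁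
  · have h₀' : SmoothNear 𝕜 r ρ₀ (0, (0 : Fin p → 𝕜)) := h₀
    have h₁' : SmoothNear 𝕜 r ρ₁ (0, (0 : Fin p → 𝕜)) := h₁
    obtain ⟨u, su, hu⟩ := exists_expScale_densityPullback hr hw (ρ₀ := fun y => ρ₀ (0, y))
      (ρ₁ := fun y => ρ₁ (0, y)) (by fun_prop) (by fun_prop) hne₀ hne₁ hs
    have su' : SmoothNear 𝕜 r u (0 : (Fin n → 𝕜) × (Fin p → 𝕜)).2 := su
    have ht : Tendsto (Prod.snd : (Fin n → 𝕜) × (Fin p → 𝕜) → _) (𝓝 0) (𝓝 0) :=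
      continuous_snd.tendsto _
    have ht' : Tendsto (fun z : (Fin n → 𝕜) × (Fin p → 𝕜) =>
        (z.1, expScale (fun i => (w i : 𝕜)) (u z.2) z.2)) (𝓝 0) (𝓝 0) :=
      (isFamilyGerm_expScale hr (fun i => (w i : 𝕜)) (v := fun z => u z.2) (by fun_prop)).tendsto
    refine ⟨fun z => u z.2, by fun_prop, ?_, fun _ _ z => rfl⟩
    filter_upwards [ht.eventually hu, hc.1, ht'.eventually hc.2] with z hz hz₀ hz₁
    rw [hz₀, ← hz]
    simp only [familyPullback, densityPullback]
    rw [hz₁]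
  · obtain ⟨s, hs⟩ := hs.exists_exp hne₀ hne₁
    have hW : (∑ i, (w i : 𝕜)) ≠ 0 := by exact_mod_cast hw.ne'
    obtain ⟨u, su, -, hu⟩ := exists_expScale_pullback hr hw h₀ h₁ hne₁
      (u₀ := s / ∑ i, (w i : 𝕜)) (by rw [mul_div_cancel₀ _ hW]; exact hs)
    exact ⟨u, su, hu, fun h h' => absurd ⟨h, h'⟩ hc⟩

end ScalingGerms

/-! ### Lifting scalings to the stabilizer -/

section MoserProperties

universe u

variable {𝕜 : Type u} [RCLike 𝕜] {r : WithTop ℕ∞} {n p : ℕ}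

/-- Any two volume forms on the source, given by their densities, are isotopic through source
components of the stabilizer of `f` in `𝒦`. -/
def SourceMoser (r : WithTop ℕ∞) (f : (Fin n → 𝕜) → (Fin p → 𝕜)) : Prop :=
  ∀ ρ₀ ρ₁ : (Fin n → 𝕜) → 𝕜, SmoothNear 𝕜 r ρ₀ 0 → SmoothNear 𝕜 r ρ₁ 0 → ρ₀ 0 ≠ 0 → ρ₁ 0 ≠ 0 →
    SameSign (ρ₀ 0) (ρ₁ 0) → ∃ Φ : ℝ → (Fin n → 𝕜) → (Fin n → 𝕜),
      (∀ t : ℝ, SmoothNear ℝ r (fun z : ℝ × (Fin n → 𝕜) => Φ z.1 z.2) (t, 0)) ∧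
      (∀ t, ∃ θ, Mather.K.Stabilizes r f (Φ t) θ) ∧
      (∀ᶠ x in 𝓝 (0 : Fin n → 𝕜), Φ 0 x = x) ∧ densityPullback (Φ 1) ρ₁ =ᶠ[𝓝 0] ρ₀

/-- Any two families of volume forms on the target, given by their densities, are isotopic through
target components of the stabilizer of `f` in `G`. -/
def TargetMoser (r : WithTop ℕ∞) (G : Mather) (f : (Fin n → 𝕜) → (Fin p → 𝕜)) : Prop :=
  ∀ ρ₀ ρ₁ : (Fin n → 𝕜) × (Fin p → 𝕜) → 𝕜, SmoothNear 𝕜 r ρ₀ 0 → SmoothNear 𝕜 r ρ₁ 0 →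
    ρ₀ 0 ≠ 0 → ρ₁ 0 ≠ 0 → SameSign (ρ₀ 0) (ρ₁ 0) →
    (G = .A ∨ G = .L → IsConstantDensity ρ₀ ∧ IsConstantDensity ρ₁) →
    ∃ Φ : ℝ → (Fin n → 𝕜) → (Fin p → 𝕜) → (Fin p → 𝕜),
      (∀ t : ℝ, SmoothNear ℝ r
        (fun z : ℝ × (Fin n → 𝕜) × (Fin p → 𝕜) => Φ z.1 z.2.1 z.2.2) (t, 0)) ∧
      (∀ t, ∃ φ, G.Stabilizes r f φ (Φ t)) ∧
      (∀ᶠ z in 𝓝 (0 : (Fin n → 𝕜) × (Fin p → 𝕜)), Φ 0 z.1 z.2 = z.2) ∧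
      familyPullback (Φ 1) ρ₁ =ᶠ[𝓝 0] ρ₀

/-- The dilations `expScale a s` lift to a family of symmetries of `f` in `𝒦`, consisting of linear
maps `L (x, s)` of the target, with inverses `M (x, s)` and determinants `exp (-D s)`. -/
structure DilationSymmetry (r : WithTop ℕ∞) (a : Fin n → 𝕜) (D : 𝕜)
    (f : (Fin n → 𝕜) → (Fin p → 𝕜))
    (L M : (Fin n → 𝕜) × 𝕜 → (Fin p → 𝕜) →L[𝕜] (Fin p → 𝕜)) : Prop where
  smooth : ∀ s, SmoothNear 𝕜 r L (0, s)
  smooth_inv : ∀ s, SmoothNear 𝕜 r M (0, s)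
  apply_zero : ∀ x y, L (x, 0) y = y
  left_inv : ∀ z y, M z (L z y) = y
  right_inv : ∀ z y, L z (M z y) = y
  det : ∀ z, (L z).det = NormedSpace.exp (-(D * z.2))
  map : ∀ s, ∀ᶠ z in 𝓝 ((0, s) : (Fin n → 𝕜) × 𝕜), L z (f (expScale a z.2 z.1)) = f z.1

variable {a : Fin n → 𝕜} {D : 𝕜} {f : (Fin n → 𝕜) → (Fin p → 𝕜)}
  {L M : (Fin n → 𝕜) × 𝕜 → (Fin p → 𝕜) →L[𝕜] (Fin p → 𝕜)}

theorem DilationSymmetry.isFamilyGerm (h : DilationSymmetry r a D f L M) {v : (Fin n → 𝕜) → 𝕜}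
    (hv : SmoothNear 𝕜 r v 0) : IsFamilyGerm 𝕜 r (fun x y => L (x, v x) y) := by
  have h1 := h.smooth (v 0)
  have h2 := h.smooth_inv (v 0)
  exact isFamilyGerm_linear (A := fun x => L (x, v x)) (B := fun x => M (x, v x)) (by fun_prop)
    (by fun_prop) (fun _ _ => h.left_inv _ _) (fun _ _ => h.right_inv _ _)

theorem DilationSymmetry.eventually_map (h : DilationSymmetry r a D f L M)
    {v : (Fin n → 𝕜) → 𝕜} (hv : SmoothNear 𝕜 r v 0) :
    ∀ᶠ x in 𝓝 (0 : Fin n → 𝕜), L (x, v x) (f (expScale a (v x) x)) = f x := by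
  have ht : Tendsto (fun x => (x, v x)) (𝓝 0) (𝓝 (0, v 0)) :=
    tendsto_id.prodMk_nhds hv.continuousAt.tendsto
  exact ht.eventually (h.map (v 0))

theorem DilationSymmetry.stabilizes (hr : r = ∞ ∨ r = ω) (h : DilationSymmetry r a D f L M)
    {v : (Fin n → 𝕜) → 𝕜} (hv : SmoothNear 𝕜 r v 0) :
    Mather.K.Stabilizes r f (fun x => expScale a (v x) x) (fun x y => L (x, v x) y) := by
  refine ⟨⟨isDiffeoGerm_expScale hr a hv, h.isFamilyGerm hv, trivial⟩, ?_⟩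
  filter_upwards [h.eventually_map hv] with x hx
  exact hx.symm

/-- In `𝒦` the compensating linear maps may depend on `x`, so a flow time varying with `x` is
allowed. Multiplying it by `t` gives the path. -/
theorem DilationSymmetry.sourceMoser (hr : r = ∞ ∨ r = ω) {w : Fin n → ℕ} (hw : 0 < ∑ i, w i)
    (h : DilationSymmetry r (fun i => (w i : 𝕜)) D f L M) : SourceMoser r f := by
  intro ρ₀ ρ₁ h₀ h₁ hne₀ hne₁ hs
  obtain ⟨u, su, hu⟩ := exists_expScale_densityPullback hr hw h₀ h₁ hne₀ hne₁ hs
  refine ⟨fun t x => expScale (fun i => (w i : 𝕜)) (t * u x) x, fun t => ?_, fun t => ?_, ?_, ?_⟩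
  · have := su.real
    fun_prop
  · exact ⟨_, h.stabilizes hr (v := fun x => (t : 𝕜) * u x) (by fun_prop)⟩
  · simp
  · simpa using hu

/-- Scaling the target with time `t u` sends `f x` to `f (χ x)`, where `χ` scales the source with
time `t u (0, f x)`; composing with the inverse of `χ` restores `f`. Since the averaging takes place
in the target only, the source weights `a` may have any sign. -/
theorem targetMoser_of_scaling (hr : r = ∞ ∨ r = ω) (hf : IsMapGerm r f) {δ : Fin p → ℕ}
    (hδ : 0 < ∑ j, δ j)
    (h : ∀ s, ∀ᶠ z in 𝓝 ((0, s) : (Fin n → 𝕜) × 𝕜),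
      f (expScale a z.2 z.1) = expScale (fun j => (δ j : 𝕜)) z.2 (f z.1)) :
    TargetMoser r .A f := by
  intro ρ₀ ρ₁ h₀ h₁ hne₀ hne₁ hs hc
  obtain ⟨u, su, hu, huc⟩ := exists_expScale_familyPullback hr hδ h₀ h₁ hne₀ hne₁ hs
  have huc := huc (hc (.inl rfl)).1 (hc (.inl rfl)).2
  refine ⟨fun t x y => expScale (fun j => (δ j : 𝕜)) (t * u (x, y)) y, fun t => ?_, fun t => ?_,
    ?_, ?_⟩
  · have := su.real
    fun_prop
  · have hθ := isFamilyGerm_expScale hr (fun j => (δ j : 𝕜)) (v := fun z => (t : 𝕜) * u z)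
      (by fun_prop)
    have su' : SmoothNear 𝕜 r u (0, f 0) := by rwa [hf.map_zero]
    have sf := hf.smooth
    have sv : SmoothNear 𝕜 r (fun x => (t : 𝕜) * u (0, f x)) 0 := by fun_prop
    have hχ := isDiffeoGerm_expScale hr a sv
    obtain ⟨φ, dφ, h1, h2⟩ := hχ.exists_symm
    refine ⟨φ, ⟨dφ, hθ, Eventually.of_forall fun z => by simp only [huc (z.1, z.2)]⟩, ?_⟩
    have ht : Tendsto (fun x => (x, (t : 𝕜) * u (0, f x))) (𝓝 0) (𝓝 (0, (t : 𝕜) * u (0, f 0))) :=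
      tendsto_id.prodMk_nhds sv.continuousAt.tendsto
    filter_upwards [h2, dφ.tendsto.eventually (ht.eventually (h _))] with x hx hx'
    simp only [hx] at hx'
    rw [huc, hx']
  · simp
  · simpa using hu

end MoserProperties

/-! ### Germs with a zero component -/

section ZeroComponent

universe u

variable {𝕜 : Type u} [RCLike 𝕜] {r : WithTop ℕ∞} {n p : ℕ} {G : Mather}
  {f g : (Fin n → 𝕜) → (Fin p → 𝕜)}

theorem expScale_single_of_eq_zero {j : Fin p} {y : Fin p → 𝕜} (hy : y j = 0) (s : 𝕜) :
    expScale (fun i => ((Pi.single j 1 : Fin p → ℕ) i : 𝕜)) s y = y := by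
  ext i
  rcases eq_or_ne i j with rfl | hij
  · simp [expScale, hy]
  · simp [expScale, hij]

/-- The points `θ x (f x)` lie in the hyperplane `y j = 0`, which is fixed pointwise by scalings of
the `j`-th coordinate with any flow time. Moser's theorem for the weight vector `Pi.single j 1`,
conjugated by `θ`, therefore fixes `f` with trivial source component, which suits all groups
considered. -/
theorem IsMapGerm.targetMoser_of_zero_component (hr : r = ∞ ∨ r = ω) (hG : G ≠ .R)
    (hf : IsMapGerm r f)
    {θ : (Fin n → 𝕜) → (Fin p → 𝕜) → (Fin p → 𝕜)} (hθ : IsFamilyGerm 𝕜 r θ)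
    (hθc : G = .A ∨ G = .L → IsConstantFamily θ) {j : Fin p}
    (hj : ∀ᶠ x in 𝓝 (0 : Fin n → 𝕜), θ x (f x) j = 0) : TargetMoser r G f := by
  intro ρ₀ ρ₁ h₀ h₁ hne₀ hne₁ hs hc
  obtain ⟨η, hη, h1, h2⟩ := hθ.exists_symm
  have hηc : G = .A ∨ G = .L → IsConstantFamily η := fun e => (hθc e).symm hη h1 h2
  have hw : 0 < ∑ i, (Pi.single j 1 : Fin p → ℕ) i := by simp
  -- Both densities are transported by the inverse family `η` to the coordinates in which the
  -- component vanishes.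
  obtain ⟨u, su, hu, huc⟩ := exists_expScale_familyPullback hr hw
    (SmoothNear.familyPullback hr hη h₀) (SmoothNear.familyPullback hr hη h₁)
    (familyPullback_zero_ne_zero hr hη hne₀) (familyPullback_zero_ne_zero hr hη hne₁)
    (by
      rw [familyPullback_zero η hη, familyPullback_zero η hη]
      exact hs.mul_right _)
  have huc' : G = .A ∨ G = .L → ∀ z, u z = u (0, z.2) := fun e =>
    huc ((hc e).1.familyPullback hη (hηc e)) ((hc e).2.familyPullback hη (hηc e))
  set a : Fin p → 𝕜 := fun i => ((Pi.single j 1 : Fin p → ℕ) i : 𝕜) with ha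
  have hΞ : ∀ t : 𝕜, IsFamilyGerm 𝕜 r (fun x y => expScale a (t * u (x, y)) y) := fun t =>
    isFamilyGerm_expScale hr a (v := fun z => t * u z) (by fun_prop)
  refine ⟨fun t x y => η x (expScale a (t * u (x, θ x y)) (θ x y)), fun t => ?_, fun t => ?_,
    ?_, ?_⟩
  · have sη := hη.smooth.real
    have sθ := hθ.smooth.real
    have su' := su.real
    have hz : ((0 : Fin n → 𝕜), θ 0 0) = 0 := Prod.ext rfl hθ.map_zero
    have e1 : SmoothNear ℝ r u ((t, (0 : (Fin n → 𝕜) × (Fin p → 𝕜))).2.1,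
        θ (t, (0 : (Fin n → 𝕜) × (Fin p → 𝕜))).2.1 (t, (0 : (Fin n → 𝕜) × (Fin p → 𝕜))).2.2) := by
      change SmoothNear ℝ r u ((0 : Fin n → 𝕜), θ 0 0)
      rwa [hz]
    have e2 : SmoothNear ℝ r (fun q : ℝ × (Fin n → 𝕜) × (Fin p → 𝕜) => θ q.2.1 q.2.2) (t, 0) :=
      SmoothNear.comp (g := fun z : (Fin n → 𝕜) × (Fin p → 𝕜) => θ z.1 z.2)
        (f := fun q : ℝ × (Fin n → 𝕜) × (Fin p → 𝕜) => q.2) (t, 0) sθ (by fun_prop)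
    have e3 : SmoothNear ℝ r (fun q : ℝ × (Fin n → 𝕜) × (Fin p → 𝕜) =>
        expScale a (q.1 * u (q.2.1, θ q.2.1 q.2.2)) (θ q.2.1 q.2.2)) (t, 0) := by
      have e4 : SmoothNear ℝ r (fun q : ℝ × (Fin n → 𝕜) × (Fin p → 𝕜) =>
          u (q.2.1, θ q.2.1 q.2.2)) (t, 0) := SmoothNear.comp _ e1 (by fun_prop)
      fun_prop
    refine SmoothNear.comp (g := fun z : (Fin n → 𝕜) × (Fin p → 𝕜) => η z.1 z.2)
      (f := fun q : ℝ × (Fin n → 𝕜) × (Fin p → 𝕜) =>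
        (q.2.1, expScale a (q.1 * u (q.2.1, θ q.2.1 q.2.2)) (θ q.2.1 q.2.2))) (t, 0) ?_ (by fun_prop)
    have : ((0 : Fin n → 𝕜), expScale a (t * u ((0 : Fin n → 𝕜), θ 0 0)) (θ 0 0)) = 0 := by
      rw [hθ.map_zero, expScale_zero_right]
      rfl
    change SmoothNear ℝ r (fun z : (Fin n → 𝕜) × (Fin p → 𝕜) => η z.1 z.2)
      ((0 : Fin n → 𝕜), expScale a (t * u ((0 : Fin n → 𝕜), θ 0 0)) (θ 0 0))
    rwa [this]
  · refine ⟨fun x => x, ?_, ?_⟩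
    · rw [Mather.mem_iff hG]
      refine ⟨IsDiffeoGerm.id, hη.comp ((hΞ t).comp hθ), by simp, fun e => ?_⟩
      refine (hηc e).comp (IsConstantFamily.comp
        (θ := fun x y => expScale a (t * u (x, y)) y) ?_ (hθc e) hθ) ((hΞ t).comp hθ)
      exact Eventually.of_forall fun z => by simp only [huc' e (z.1, z.2)]
    · filter_upwards [hj, hf.tendsto_graph.eventually h1] with x hx hx'
      rw [expScale_single_of_eq_zero hx, hx']
  · filter_upwards [h1] with z hz
    simpa using hz
  · have hΞ1 : IsFamilyGerm 𝕜 r (fun x y => expScale a (u (x, y)) y) := by simpa using hΞ 1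
    simp only [RCLike.ofReal_one, one_mul]
    have e1 := familyPullback_comp hr (hη.comp hΞ1) hθ ρ₁
    have e2 : familyPullback (fun x y => η x (expScale a (u (x, y)) y)) ρ₁ =ᶠ[𝓝 0]
        familyPullback η ρ₀ := by
      filter_upwards [familyPullback_comp hr hη hΞ1 ρ₁, hu] with z hz hz'
      rw [hz, hz']
    have e3 := familyPullback_congr_density hθ e2
    have e4 := familyPullback_comp hr hη hθ ρ₀
    have e5 := familyPullback_congr (θ := fun x y => η x (θ x y)) (θ' := fun _ y => y) h1 ρ₀
    rw [familyPullback_id] at e5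
    filter_upwards [e1, e3, e4, e5] with z z1 z3 z4 z5
    rw [z1, z3, ← z4, z5]

end ZeroComponent

/-! ### Target volume forms and contact equivalence -/

section TargetDilation

universe u

variable {𝕜 : Type u} [RCLike 𝕜] {r : WithTop ℕ∞} {n p : ℕ} {f : (Fin n → 𝕜) → (Fin p → 𝕜)}
  {a : Fin n → 𝕜} {D : 𝕜} {L M : (Fin n → 𝕜) × 𝕜 → (Fin p → 𝕜) →L[𝕜] (Fin p → 𝕜)}

theorem expScale_one_eq_smul (s : 𝕜) (y : Fin p → 𝕜) :
    expScale 1 s y = NormedSpace.exp s • y := by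
  ext i
  simp [expScale]

/-- Radial maps (all weights one) relate `ρ₁`, a constant density and `ρ₀`, but they need not fix
`f`. Between them one may insert, for any function `v` of `x`, the map `exp (b v) • L (x, v)`, which
preserves volume for `b = D / p`. Radial maps commute with linear ones up to reparametrization, so
the composite is a positive-time or negative-time radial scaling after `L`, and `v` is chosen to
make its exponent vanish at `f x`. The condition `D ≠ 0` makes the equation for `v` solvable. -/
theorem DilationSymmetry.targetMoser (hr : r = ∞ ∨ r = ω) (hf : IsMapGerm r f) (hp : 0 < p)
    (hD : D ≠ 0) (h : DilationSymmetry r a D f L M) : TargetMoser r .K f := by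
  intro ρ₀ ρ₁ h₀ h₁ hne₀ hne₁ hs _
  have hp' : (p : 𝕜) ≠ 0 := by exact_mod_cast hp.ne'
  have hw : 0 < ∑ _i : Fin p, 1 := by simpa using hp
  have hsum : (∑ i : Fin p, (((fun _ => 1 : Fin p → ℕ) i : ℕ) : 𝕜)) = p := by simp
  have hone : (fun i : Fin p => (((fun _ => 1 : Fin p → ℕ) i : ℕ) : 𝕜)) = 1 := by
    ext
    simp
  -- radial families of diffeomorphisms making both families of densities constant
  obtain ⟨κ₁, sκ₁, zκ₁, hκ₁⟩ := exists_expScale_pullback hr hw (ρ₀ := fun _ => ρ₁ 0) (ρ₁ := ρ₁)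
    (by fun_prop) h₁ hne₁ (u₀ := 0) (by simp)
  obtain ⟨s, hs⟩ := hs.exists_exp hne₀ hne₁
  obtain ⟨κ₀, sκ₀, zκ₀, hκ₀⟩ := exists_expScale_pullback hr hw (ρ₀ := ρ₀) (ρ₁ := fun _ => ρ₁ 0)
    h₀ (by fun_prop) hne₁ (u₀ := s / p) (by rw [hsum, mul_div_cancel₀ _ hp']; exact hs)
  rw [hone] at hκ₀ hκ₁
  have sf := hf.smooth
  set b : 𝕜 := D / p with hb
  have hb0 : b ≠ 0 := div_ne_zero hD hp'
  -- The total radial exponent of the composite, expressed at the point `y` obtained after applying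
  -- `L (x, s)`; hence the `M` in the argument of `κ₀`.
  let m : (Fin n → 𝕜) × 𝕜 × (Fin p → 𝕜) → 𝕜 := fun q =>
    κ₀ (q.1, M (q.1, q.2.1) q.2.2) + b * q.2.1 +
      κ₁ (q.1, expScale 1 (b * q.2.1 + κ₀ (q.1, M (q.1, q.2.1) q.2.2)) q.2.2)
  have m0 : ∀ s, m (0, s, 0) = κ₀ 0 + b * s + κ₁ 0 := by
    intro s
    simp only [m, map_zero, expScale_zero_right, Prod.mk_zero_zero]
  have sm : ∀ s, SmoothNear 𝕜 r m (0, s, 0) := by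
    intro s
    have sM := h.smooth_inv s
    have e1 : SmoothNear 𝕜 r κ₀ ((0 : Fin n → 𝕜), M ((0 : Fin n → 𝕜), s) (0 : Fin p → 𝕜)) := by
      rw [map_zero]
      exact sκ₀
    have e2 : SmoothNear 𝕜 r (fun q : (Fin n → 𝕜) × 𝕜 × (Fin p → 𝕜) =>
        κ₀ (q.1, M (q.1, q.2.1) q.2.2)) (0, s, 0) := by fun_prop
    have e3 : SmoothNear 𝕜 r κ₁ ((0 : Fin n → 𝕜), expScale 1
        (b * s + κ₀ ((0 : Fin n → 𝕜), M ((0 : Fin n → 𝕜), s) (0 : Fin p → 𝕜))) (0 : Fin p → 𝕜)) := by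
      rw [expScale_zero_right]
      exact sκ₁
    fun_prop
  -- At the origin `m (0, s, 0) = κ₀ 0 + b * s` because `κ₁ 0 = 0`, which dictates the initial value
  -- and the slope `b`.
  obtain ⟨v, sv, hv0, hv⟩ : ∃ v : (Fin n → 𝕜) → 𝕜, SmoothNear 𝕜 r v 0 ∧ v 0 = -(κ₀ 0) / b ∧
      ∀ᶠ x in 𝓝 (0 : Fin n → 𝕜), m (x, v x, f x) = 0 := by
    have hm : m (0, -(κ₀ 0) / b, f 0) = 0 := by
      rw [hf.map_zero, m0, zκ₁]
      field_simp
      ring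
    refine SmoothNear.exists_implicit (G := fun q : (Fin n → 𝕜) × 𝕜 => m (q.1, q.2, f q.1)) hr ?_ hm
      hb0 ?_
    · have := sm (-(κ₀ 0) / b)
      rw [← hf.map_zero] at this
      fun_prop
    · simp only [hf.map_zero, m0]
      have := ((hasDerivAt_id (-(κ₀ 0) / b)).const_mul b).const_add (κ₀ 0) |>.add_const (κ₁ 0)
      simpa using this
  let Λ : (Fin n → 𝕜) × (Fin p → 𝕜) → 𝕜 := fun z => m (z.1, v z.1, z.2)
  have sΛ : SmoothNear 𝕜 r Λ 0 := by
    have e1 := sm (v 0)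
    have e2 : SmoothNear 𝕜 r v (0 : (Fin n → 𝕜) × (Fin p → 𝕜)).1 := sv
    exact SmoothNear.comp (g := m) (f := fun z : (Fin n → 𝕜) × (Fin p → 𝕜) => (z.1, v z.1, z.2))
      0 e1 (by fun_prop)
  have hLf : ∀ t : 𝕜, IsFamilyGerm 𝕜 r (fun x y => L (x, t * v x) y) := fun t =>
    h.isFamilyGerm (v := fun x => t * v x) (by fun_prop)
  have hΛf : ∀ t : 𝕜, IsFamilyGerm 𝕜 r (fun x y => expScale 1 (t * Λ (x, y)) y) := fun t =>
    isFamilyGerm_expScale hr 1 (v := fun z => t * Λ z) (by fun_prop)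
  -- The exponent `Λ` vanishes on the graph of `f`, hence so does `t * Λ`. Thus for every `t` the
  -- family acts on the relevant points just as `L (x, t * v x)` does, and stabilizes `f`.
  refine ⟨fun t x y => expScale 1 (t * Λ (x, L (x, t * v x) y)) (L (x, t * v x) y),
    fun t => ?_, fun t => ⟨fun x => expScale a (t * v x) x, ?_, ?_⟩, ?_, ?_⟩
  · have sΛ' := sΛ.real
    have sv' := sv.real
    have sL := (h.smooth (t * v 0)).real
    have e1 : SmoothNear ℝ r (fun q : ℝ × (Fin n → 𝕜) × (Fin p → 𝕜) => (q.2.1, (q.1 : 𝕜) * v q.2.1))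
        (t, 0) := by fun_prop
    have e2 : SmoothNear ℝ r (fun q : ℝ × (Fin n → 𝕜) × (Fin p → 𝕜) =>
        L (q.2.1, (q.1 : 𝕜) * v q.2.1)) (t, 0) := SmoothNear.comp _ sL e1
    have e3 : SmoothNear ℝ r (fun q : ℝ × (Fin n → 𝕜) × (Fin p → 𝕜) =>
        L (q.2.1, (q.1 : 𝕜) * v q.2.1) q.2.2) (t, 0) := by
      filter_upwards [e2] with q hq
      exact (((ContinuousLinearMap.restrictScalarsL 𝕜 (Fin p → 𝕜) (Fin p → 𝕜) ℝ ℝ).contDiff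
        |>.contDiffAt).comp q hq).clm_apply contDiffAt_snd.snd
    have e4 : SmoothNear ℝ r Λ ((0 : Fin n → 𝕜), L (0, (t : 𝕜) * v 0) 0) := by
      rw [map_zero]
      exact sΛ'
    have e5 : SmoothNear ℝ r (fun q : ℝ × (Fin n → 𝕜) × (Fin p → 𝕜) =>
        Λ (q.2.1, L (q.2.1, (q.1 : 𝕜) * v q.2.1) q.2.2)) (t, 0) :=
      SmoothNear.comp (g := Λ) (t, 0) e4 ((by fun_prop : SmoothNear ℝ r
        (fun q : ℝ × (Fin n → 𝕜) × (Fin p → 𝕜) => q.2.1) (t, 0)).prodMk e3)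
    exact SmoothNear.expScale_real 1 (SmoothNear.mul (by fun_prop) e5) e3
  · exact ⟨isDiffeoGerm_expScale hr a (v := fun x => (t : 𝕜) * v x) (by fun_prop),
      (hΛf t).comp (hLf t), trivial⟩
  · filter_upwards [h.eventually_map (v := fun x => (t : 𝕜) * v x) (by fun_prop), hv] with x hx hx'
    rw [hx]
    simp only [Λ, hx', mul_zero, expScale_zero]
  · simp [h.apply_zero]
  · simp only [RCLike.ofReal_one, one_mul]
    -- the final map is the composition of the two radial maps and a volume preserving linear map
    have hA1 : IsFamilyGerm 𝕜 r (fun x y => expScale 1 (κ₁ (x, y)) y) :=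
      isFamilyGerm_expScale hr 1 sκ₁
    have hA0 : IsFamilyGerm 𝕜 r (fun x y => expScale 1 (κ₀ (x, y)) y) :=
      isFamilyGerm_expScale hr 1 sκ₀
    have sv' : SmoothNear 𝕜 r v (0 : (Fin n → 𝕜) × (Fin p → 𝕜)).1 := sv
    have hB : IsFamilyGerm 𝕜 r (fun (x : Fin n → 𝕜) (y : Fin p → 𝕜) => expScale 1 (b * v x) y) :=
      isFamilyGerm_expScale hr 1 (v := fun z => b * v z.1) (by fun_prop)
    have hC : IsFamilyGerm 𝕜 r (fun x y => L (x, v x) y) := h.isFamilyGerm sv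
    have hfact : (fun x y => expScale 1 (Λ (x, L (x, v x) y)) (L (x, v x) y)) =
        fun x y => expScale 1 (κ₁ (x, expScale 1 (b * v x) (L (x, v x) (expScale 1 (κ₀ (x, y)) y))))
          (expScale 1 (b * v x) (L (x, v x) (expScale 1 (κ₀ (x, y)) y))) := by
      funext x y
      simp only [expScale_one_eq_smul, map_smul, Λ, m, h.left_inv, smul_smul, ← NormedSpace.exp_add]
      congr 2
      ring
    rw [hfact]
    have c1 : familyPullback (fun x y => expScale 1 (κ₁ (x, y)) y) ρ₁ =ᶠ[𝓝 0] fun _ => ρ₁ 0 := hκ₁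
    have c0 : familyPullback (fun x y => expScale 1 (κ₀ (x, y)) y) (fun _ => ρ₁ 0) =ᶠ[𝓝 0] ρ₀ := hκ₀
    -- The radial factor has determinant `exp (p b v) = exp (D v)`, cancelling the determinant of
    -- `L`.
    have c2 : familyPullback (fun (x : Fin n → 𝕜) (y : Fin p → 𝕜) =>
        expScale 1 (b * v x) (L (x, v x) y)) (fun _ => ρ₁ 0) = fun _ => ρ₁ 0 := by
      funext z
      have hlin : (fun y => expScale 1 (b * v z.1) (L (z.1, v z.1) y)) =
          (diagonalCLM fun i => NormedSpace.exp ((1 : Fin p → 𝕜) i * (b * v z.1))).comp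
            (L (z.1, v z.1)) := rfl
      have hpb : (p : 𝕜) * (b * v z.1) = D * v z.1 := by
        rw [hb]
        field_simp
      simp only [familyPullback]
      rw [hlin, ContinuousLinearMap.fderiv, det_comp_clm, det_diagonalCLM, h.det,
        ← NormedSpace.exp_sum, ← NormedSpace.exp_add]
      simp [hpb]
    have d1 := familyPullback_comp hr hA1 ((hB.comp hC).comp hA0) ρ₁
    have d2 := familyPullback_congr_density ((hB.comp hC).comp hA0) c1
    have d3 := familyPullback_comp hr (hB.comp hC) hA0 (fun _ => ρ₁ 0)
    rw [c2] at d3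
    filter_upwards [d1, d2, d3, c0] with z z1 z2 z3 z4
    rw [z1, z2, z3, z4]

end TargetDilation

/-! ### Symmetries of quasihomogeneous germs -/

section Quasihomogeneous

universe u

variable {𝕜 : Type u} [RCLike 𝕜] {r : WithTop ℕ∞} {n p : ℕ} {f : (Fin n → 𝕜) → (Fin p → 𝕜)}

theorem zpow_mul_eq_expScale {d : ℕ} (w : Fin d → ℤ) (s : 𝕜) (y : Fin d → 𝕜) :
    (fun i => NormedSpace.exp s ^ w i * y i) = expScale (fun i => (w i : 𝕜)) s y := by
  ext i
  rw [expScale_apply, ← NormedSpace.exp_zsmul, zsmul_eq_mul]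

/-- The hypothesis only concerns scalars near `1`, whereas Moser's theorem may require a flow time
far from `0` already at the origin. A long time is reached by iterating a short one, since scalings
fix the origin and all intermediate points stay near it. -/
theorem IsQuasihomogeneous.eventually_expScale {w : Fin n → ℤ} {δ : Fin p → ℤ}
    (h : IsQuasihomogeneous w δ f) (s₀ : 𝕜) :
    ∀ᶠ z in 𝓝 ((0, s₀) : (Fin n → 𝕜) × 𝕜),
      f (expScale (fun i => (w i : 𝕜)) z.2 z.1) = expScale (fun j => (δ j : 𝕜)) z.2 (f z.1) := by
  set a : Fin n → 𝕜 := fun i => (w i : 𝕜) with ha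
  set b : Fin p → 𝕜 := fun j => (δ j : 𝕜) with hb
  have hcexp : Continuous (NormedSpace.exp : 𝕜 → 𝕜) :=
    (contDiff_normedSpaceExp (𝕜 := 𝕜) (r := 0)).continuous
  have ht : Tendsto (fun q : 𝕜 × (Fin n → 𝕜) => (NormedSpace.exp q.1, q.2)) (𝓝 (0, 0))
      (𝓝 (1, 0)) :=
    Continuous.tendsto' (by fun_prop) _ _ (by simp)
  have h1 : ∀ᶠ q in 𝓝 ((0, 0) : 𝕜 × (Fin n → 𝕜)),
      f (expScale a q.1 q.2) = expScale b q.1 (f q.2) := by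
    filter_upwards [ht.eventually h] with q hq
    rw [← zpow_mul_eq_expScale, ← zpow_mul_eq_expScale]
    funext j
    exact hq j
  rw [nhds_prod_eq, eventually_prod_iff] at h1
  obtain ⟨P, hP, Q, hQ, hPQ⟩ := h1
  -- A number of iterations that makes `s / N` short, uniformly for `s` near `s₀`.
  obtain ⟨N, hN0, hN⟩ : ∃ N : ℕ, 0 < N ∧ ∀ᶠ s in 𝓝 s₀, P (s / N) := by
    have h2 : Tendsto (fun N : ℕ => s₀ / (N : 𝕜)) atTop (𝓝 0) :=
      tendsto_const_div_atTop_nhds_zero_nat s₀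
    obtain ⟨N, hN, hN0⟩ := ((h2.eventually (eventually_eventually_nhds.2 hP)).and
      (eventually_gt_atTop 0)).exists
    have h3 : Tendsto (fun s : 𝕜 => s / (N : 𝕜)) (𝓝 s₀) (𝓝 (s₀ / N)) :=
      Continuous.tendsto' (by fun_prop) _ _ rfl
    exact ⟨N, hN0, h3.eventually hN⟩
  have h4 : ∀ᶠ z in 𝓝 ((0, s₀) : (Fin n → 𝕜) × 𝕜), ∀ k ∈ Finset.range N,
      Q (expScale a (k * (z.2 / N)) z.1) := by
    refine (Finset.eventually_all _).2 fun k _ => ?_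
    have h5 : Tendsto (fun z : (Fin n → 𝕜) × 𝕜 => expScale a (k * (z.2 / N)) z.1) (𝓝 (0, s₀))
        (𝓝 0) := by
      refine Continuous.tendsto' ?_ _ _ (by simp)
      unfold expScale
      fun_prop
    exact h5.eventually hQ
  have h6 : Tendsto (Prod.snd : (Fin n → 𝕜) × 𝕜 → 𝕜) (𝓝 (0, s₀)) (𝓝 s₀) :=
    continuous_snd.tendsto _
  filter_upwards [h4, h6.eventually hN] with z hz hz'
  have key : ∀ k ≤ N, f (expScale a (k * (z.2 / N)) z.1) = expScale b (k * (z.2 / N)) (f z.1) := by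
    intro k
    induction k with
    | zero => simp
    | succ k ih =>
      intro hk
      have e : ((k + 1 : ℕ) : 𝕜) * (z.2 / N) = z.2 / N + k * (z.2 / N) := by
        push_cast
        ring
      rw [e, expScale_add, expScale_add, hPQ hz' (hz k (Finset.mem_range.2 hk)),
        ih (Nat.le_of_succ_le hk)]
  have := key N le_rfl
  rwa [mul_div_cancel₀ _ (by exact_mod_cast hN0.ne' : (N : 𝕜) ≠ 0)] at this

@[fun_prop]
theorem smoothNear_diagonalCLM {d : ℕ} {E : Type*} [NormedAddCommGroup E] [NormedSpace 𝕜 E]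
    {e : E → Fin d → 𝕜} {x : E} (he : SmoothNear 𝕜 r e x) :
    SmoothNear 𝕜 r (fun x => diagonalCLM (e x)) x := by
  have h : ∀ v : Fin d → 𝕜, diagonalCLM v = ∑ i, v i •
      (ContinuousLinearMap.single 𝕜 (fun _ : Fin d => 𝕜) i).comp (ContinuousLinearMap.proj i) := by
    intro v
    ext y j
    simp [Pi.single_apply]
  simp only [h]
  fun_prop

theorem IsQuasihomogeneous.dilationSymmetry {w : Fin n → ℤ} {δ : Fin p → ℤ}
    (h : IsQuasihomogeneous w δ f) :
    DilationSymmetry r (fun i => (w i : 𝕜)) ((∑ j, δ j : ℤ) : 𝕜) f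
      (fun z => diagonalCLM fun j => NormedSpace.exp ((δ j : 𝕜) * -z.2))
      (fun z => diagonalCLM fun j => NormedSpace.exp ((δ j : 𝕜) * z.2)) where
  smooth s := by fun_prop
  smooth_inv s := by fun_prop
  apply_zero x y := by ext; simp
  left_inv z y := expScale_self_neg _ _ _
  right_inv z y := expScale_neg_self _ _ _
  det z := by
    rw [det_diagonalCLM, ← NormedSpace.exp_sum]
    push_cast
    rw [Finset.sum_mul, ← Finset.sum_neg_distrib]
    simp
  map s := by
    filter_upwards [h.eventually_expScale s] with z hz
    rw [hz]
    exact expScale_neg_self _ _ _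

end Quasihomogeneous

/-! ### Hadamard's lemma and a scaling symmetry for germs of positive rank -/

section PositiveRank

open MeasureTheory intervalIntegral

universe u

variable {𝕜 : Type u} [RCLike 𝕜] {r : WithTop ℕ∞} {n p : ℕ}

/-- Hadamard's lemma. -/
theorem SmoothNear.exists_hadamard (hr : r = ∞ ∨ r = ω) {f : (Fin n → 𝕜) → 𝕜}
    (hf : SmoothNear 𝕜 r f 0) (i : Fin n) :
    ∃ h : (Fin n → 𝕜) → 𝕜, SmoothNear 𝕜 r h 0 ∧
      ∀ᶠ x in 𝓝 0, f x = f (Function.update x i 0) + x i * h x := by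
  have hr0 : r ≠ 0 := by rcases hr with rfl | rfl <;> simp
  let T : ℝ → (Fin n → 𝕜) →L[𝕜] (Fin n → 𝕜) := fun τ =>
    diagonalCLM (Function.update (fun _ => 1) i (τ : 𝕜))
  have hT : ∀ τ x, T τ x = Function.update x i ((τ : 𝕜) * x i) := by
    intro τ x
    ext k
    rcases eq_or_ne k i with rfl | hk
    · simp [T]
    · simp [T, hk]
  have hTc : Continuous T := by
    have h : ∀ τ, T τ = diagonalCLM (Function.update (fun _ => 1) i 0) +
        (τ : 𝕜) • (ContinuousLinearMap.single 𝕜 (fun _ : Fin n => 𝕜) i).comp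
          (ContinuousLinearMap.proj i) := by
      intro τ
      ext x k
      rcases eq_or_ne k i with rfl | hk
      · simp [T, RCLike.real_smul_eq_coe_mul]
      · simp [T, hk]
    have h' : T = fun τ => _ := funext h
    rw [h']
    fun_prop
  have hT1 : ∀ τ ∈ Icc (0 : ℝ) 1, ‖T τ‖ ≤ 1 := by
    intro τ hτ
    refine ContinuousLinearMap.opNorm_le_bound _ zero_le_one fun x => ?_
    rw [one_mul, hT]
    refine (pi_norm_le_iff_of_nonneg (norm_nonneg _)).2 fun k => ?_
    rcases eq_or_ne k i with rfl | hk
    · rw [Function.update_self, norm_mul, RCLike.norm_ofReal, abs_of_nonneg hτ.1]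
      exact (mul_le_of_le_one_left (norm_nonneg _) hτ.2).trans (norm_le_pi_norm _ _)
    · rw [Function.update_of_ne hk]
      exact norm_le_pi_norm _ _
  have hf' : SmoothNear 𝕜 r (fun x => fderiv 𝕜 f x (Pi.single i 1)) 0 :=
    (hf.fderiv_right hr).clm_apply (smoothNear_const _ _)
  -- The factor `1` is the coefficient function expected by `SmoothNear.integral_contraction`.
  refine ⟨fun x => ∫ τ in (0 : ℝ)..1, 1 * fderiv 𝕜 f (T τ x) (Pi.single i 1),
    hf'.integral_contraction hr hTc hT1 continuous_const, ?_⟩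
  obtain ⟨ε, hε, h⟩ := Metric.eventually_nhds_iff_ball.1 (hf.and hf')
  filter_upwards [Metric.ball_mem_nhds (0 : Fin n → 𝕜) hε] with x hx
  have hmem : ∀ τ ∈ Icc (0 : ℝ) 1, T τ x ∈ Metric.ball (0 : Fin n → 𝕜) ε := fun τ hτ =>
    mem_ball_contraction hT1 hx hτ
  have hder : ∀ τ ∈ uIcc (0 : ℝ) 1, HasDerivAt (fun τ : ℝ => f (T τ x))
      (x i * (1 * fderiv 𝕜 f (T τ x) (Pi.single i 1))) τ := by
    intro τ hτ
    rw [uIcc_of_le zero_le_one] at hτ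
    have h1 : HasDerivAt (fun s : 𝕜 => Function.update x i (s * x i))
        (x i • (Pi.single i 1 : Fin n → 𝕜)) (τ : 𝕜) := by
      refine hasDerivAt_pi.2 fun k => ?_
      rcases eq_or_ne k i with rfl | hk
      · simpa using (hasDerivAt_id (τ : 𝕜)).mul_const (x k)
      · simpa [hk] using hasDerivAt_const (τ : 𝕜) (x k)
    have h2 : HasFDerivAt f (fderiv 𝕜 f (T τ x)) (Function.update x i ((τ : 𝕜) * x i)) := by
      rw [← hT]
      exact ((h _ (hmem τ hτ)).1.differentiableAt hr0).hasFDerivAt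
    have h3 : HasDerivAt (fun τ : ℝ => (τ : 𝕜)) 1 τ := by
      simpa using (RCLike.ofRealCLM (K := 𝕜)).hasDerivAt (x := τ)
    have h4 := (h2.comp_hasDerivAt (τ : 𝕜) h1).scomp τ h3
    have h5 : (fun τ : ℝ => f (T τ x)) =
        (f ∘ fun s : 𝕜 => Function.update x i (s * x i)) ∘ fun τ : ℝ => (τ : 𝕜) := by
      funext τ
      simp only [Function.comp_apply, hT]
    rw [h5]
    refine h4.congr_deriv ?_
    rw [one_smul, map_smul, smul_eq_mul, one_mul]
  have hint : IntervalIntegrable (fun τ : ℝ => x i * (1 * fderiv 𝕜 f (T τ x) (Pi.single i 1)))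
      volume 0 1 := by
    refine ContinuousOn.intervalIntegrable ?_
    rw [uIcc_of_le zero_le_one]
    have hc : ContinuousOn (fun y => fderiv 𝕜 f y (Pi.single i 1)) (Metric.ball 0 ε) :=
      fun y hy => (h y hy).2.continuousAt.continuousWithinAt
    have hc' : ContinuousOn (fun τ : ℝ => T τ x) (Icc 0 1) :=
      (hTc.clm_apply continuous_const).continuousOn
    exact continuousOn_const.mul (continuousOn_const.mul (hc.comp hc' hmem))
  have key := intervalIntegral.integral_eq_sub_of_hasDerivAt hder hint
  rw [intervalIntegral.integral_const_mul, hT, hT] at key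
  rw [key]
  simp

theorem expScale_single_eq_update (i : Fin n) (s : 𝕜) (x : Fin n → 𝕜) :
    expScale (fun k => ((Pi.single i 1 : Fin n → ℕ) k : 𝕜)) s x =
      Function.update x i (NormedSpace.exp s * x i) := by
  ext k
  rcases eq_or_ne k i with rfl | hk
  · simp [expScale]
  · simp [expScale, hk]

/-- A map-germ one of whose components is a coordinate function has a dilation symmetry. -/
theorem exists_dilationSymmetry_of_component (hr : r = ∞ ∨ r = ω)
    {f : (Fin n → 𝕜) → (Fin p → 𝕜)} (hf : IsMapGerm r f) {i : Fin n} {j : Fin p}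
    (hj : ∀ᶠ x in 𝓝 0, f x j = x i) :
    ∃ L M, DilationSymmetry r (fun k => ((Pi.single i 1 : Fin n → ℕ) k : 𝕜)) 1 f L M := by
  obtain ⟨h, sh, hhj, hh⟩ : ∃ h : (Fin n → 𝕜) → (Fin p → 𝕜), SmoothNear 𝕜 r h 0 ∧
      (∀ x, h x j = 1) ∧ ∀ᶠ x in 𝓝 0, f x = f (Function.update x i 0) + x i • h x := by
    have sf : ∀ k, SmoothNear 𝕜 r (fun x => f x k) 0 := fun k => by
      have := hf.smooth
      fun_prop
    choose h sh hh using fun k => (sf k).exists_hadamard hr i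
    -- Since `f j` is the coordinate `x i` near the origin, the `j`-th Hadamard quotient may be
    -- replaced by the constant `1`. The algebraic identities for `L` and `M` then hold everywhere,
    -- not just near the origin.
    refine ⟨fun x => Function.update (fun k => h k x) j 1, ?_, by simp, ?_⟩
    · refine smoothNear_pi fun k => ?_
      rcases eq_or_ne k j with rfl | hk
      · simpa using smoothNear_const (1 : 𝕜) _
      · simpa [hk] using sh k
    · have ht : Tendsto (fun x : Fin n → 𝕜 => Function.update x i 0) (𝓝 0) (𝓝 0) :=
        Continuous.tendsto' (by fun_prop) _ _ (by simp)
      filter_upwards [eventually_all.2 hh, hj, ht.eventually hj] with x hx hx' hx''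
      ext k
      rcases eq_or_ne k j with rfl | hk
      · simp [hx', hx'']
      · simp [hk, hx k]
  let x' : (Fin n → 𝕜) × 𝕜 → Fin n → 𝕜 := fun z =>
    expScale (fun k => ((Pi.single i 1 : Fin n → ℕ) k : 𝕜)) z.2 z.1
  -- With `x'` the scaled point, `f x' = f (x with x i = 0) + exp s * x i • h x'`. Adding `f x' j •
  -- l`, where `f x' j = exp s * x i`, turns the last term into `x i • h x` and so gives `f x`. As
  -- `l j = exp (-s) - 1`, this linear map has determinant `exp (-s)`.
  let l : (Fin n → 𝕜) × 𝕜 → Fin p → 𝕜 := fun z => NormedSpace.exp (-z.2) • h z.1 - h (x' z)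
  have hx'0 : ∀ s, x' (0, s) = 0 := fun s => by simp [x']
  have sx' : ∀ s, SmoothNear 𝕜 r x' (0, s) := fun s => by fun_prop
  have sl : ∀ s, SmoothNear 𝕜 r l (0, s) := by
    intro s
    have h1 := sx' s
    have h2 : SmoothNear 𝕜 r h (x' (0, s)) := by rwa [hx'0]
    fun_prop
  have hlj : ∀ z, l z j = NormedSpace.exp (-z.2) - 1 := by
    intro z
    simp [l, hhj]
  have hexp : ∀ s : 𝕜, NormedSpace.exp s * NormedSpace.exp (-s) = 1 := by
    intro s
    rw [← NormedSpace.exp_add]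
    simp
  have ssm : ∀ (c : (Fin n → 𝕜) × 𝕜 → 𝕜) (s : 𝕜), SmoothNear 𝕜 r c (0, s) → SmoothNear 𝕜 r
      (fun z => (ContinuousLinearMap.proj (R := 𝕜) (φ := fun _ : Fin p => 𝕜) j).smulRight
        (c z • l z)) (0, s) := by
    intro c s hc
    have h1 := sl s
    have h2 : SmoothNear 𝕜 r (fun z => ContinuousLinearMap.smulRightL 𝕜 (Fin p → 𝕜) (Fin p → 𝕜)
        (ContinuousLinearMap.proj (R := 𝕜) (φ := fun _ : Fin p => 𝕜) j) (c z • l z)) (0, s) := by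
      fun_prop
    exact h2
  refine ⟨fun z => ContinuousLinearMap.id 𝕜 (Fin p → 𝕜) +
      (ContinuousLinearMap.proj (R := 𝕜) (φ := fun _ : Fin p => 𝕜) j).smulRight (l z),
    fun z => ContinuousLinearMap.id 𝕜 (Fin p → 𝕜) -
      (ContinuousLinearMap.proj (R := 𝕜) (φ := fun _ : Fin p => 𝕜) j).smulRight
        (NormedSpace.exp z.2 • l z), ?_, ?_, ?_, ?_, ?_, ?_, ?_⟩
  · intro s
    have := ssm (fun _ => 1) s (by fun_prop)
    simp only [one_smul] at this
    fun_prop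
  · intro s
    have := ssm (fun z => NormedSpace.exp z.2) s (by fun_prop)
    fun_prop
  · intro x y
    have : l (x, 0) = 0 := by simp [l, x']
    simp [this]
  · intro z y
    ext k
    simp only [add_apply, sub_apply, ContinuousLinearMap.id_apply,
      ContinuousLinearMap.smulRight_apply, ContinuousLinearMap.proj_apply, Pi.add_apply,
      Pi.sub_apply, Pi.smul_apply, smul_eq_mul, hlj]
    linear_combination (-(y j * l z k)) * hexp z.2
  · intro z y
    ext k
    simp only [add_apply, sub_apply, ContinuousLinearMap.id_apply,
      ContinuousLinearMap.smulRight_apply, ContinuousLinearMap.proj_apply, Pi.add_apply,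
      Pi.sub_apply, Pi.smul_apply, smul_eq_mul, hlj]
    linear_combination (-(y j * l z k)) * hexp z.2
  · intro z
    rw [det_id_add_smulRight, ContinuousLinearMap.proj_apply, hlj]
    simp
  · intro s
    have t1 : Tendsto x' (𝓝 (0, s)) (𝓝 0) := by
      have := (sx' s).continuousAt.tendsto
      rwa [hx'0] at this
    have t2 : Tendsto (Prod.fst : (Fin n → 𝕜) × 𝕜 → _) (𝓝 (0, s)) (𝓝 0) :=
      continuous_fst.tendsto _
    filter_upwards [t1.eventually hh, t1.eventually hj, t2.eventually hh] with z h1 h2 h3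
    change f (x' z) + f (x' z) j • l z = f z.1
    have e1 : x' z = Function.update z.1 i (NormedSpace.exp z.2 * z.1 i) :=
      expScale_single_eq_update _ _ _
    have e2 : x' z i = NormedSpace.exp z.2 * z.1 i := by rw [e1, Function.update_self]
    have e3 : Function.update (x' z) i 0 = Function.update z.1 i 0 := by
      rw [e1, Function.update_idem]
    rw [h2, h1, h3, e3, e2]
    ext k
    simp only [l, Pi.add_apply, Pi.sub_apply, Pi.smul_apply, smul_eq_mul]
    linear_combination (z.1 i * h z.1 k) * hexp z.2

end PositiveRank

/-! ### Changes of source coordinates -/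

section SourceConjugation

universe u

variable {𝕜 : Type u} [RCLike 𝕜] {r : WithTop ℕ∞} {n p : ℕ} {f g : (Fin n → 𝕜) → (Fin p → 𝕜)}
  {χ : (Fin n → 𝕜) → (Fin n → 𝕜)}

theorem densityPullback_congr_density {φ : (Fin n → 𝕜) → (Fin n → 𝕜)} (hφ : IsDiffeoGerm 𝕜 r φ)
    {ρ ρ' : (Fin n → 𝕜) → 𝕜} (h : ρ =ᶠ[𝓝 0] ρ') :
    densityPullback φ ρ =ᶠ[𝓝 0] densityPullback φ ρ' := by
  filter_upwards [hφ.tendsto.eventually h] with x hx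
  simp only [densityPullback, hx]

theorem densityPullback_of_inverse (hr : r = ∞ ∨ r = ω) {φ ψ : (Fin n → 𝕜) → (Fin n → 𝕜)}
    (hφ : IsDiffeoGerm 𝕜 r φ) (hψ : IsDiffeoGerm 𝕜 r ψ)
    (h : ∀ᶠ x in 𝓝 (0 : Fin n → 𝕜), φ (ψ x) = x) (ρ : (Fin n → 𝕜) → 𝕜) :
    densityPullback ψ (densityPullback φ ρ) =ᶠ[𝓝 0] ρ := by
  have h1 := densityPullback_congr (φ := fun x => φ (ψ x)) (φ' := fun x => x) h ρ
  rw [densityPullback_id] at h1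
  filter_upwards [densityPullback_comp hr hφ hψ ρ, h1] with x hx hx'
  rw [← hx, hx']

/-- The isotopy is conjugated by `χ`, after transporting both densities by its inverse `σ`. -/
theorem SourceMoser.comp_diffeo (hr : r = ∞ ∨ r = ω) (hg : SourceMoser r g)
    (hχ : IsDiffeoGerm 𝕜 r χ) (hgf : ∀ᶠ x in 𝓝 (0 : Fin n → 𝕜), g (χ x) = f x) :
    SourceMoser r f := by
  intro ρ₀ ρ₁ h₀ h₁ hne₀ hne₁ hs
  obtain ⟨σ, hσ, h1, h2⟩ := hχ.exists_symm
  have e : ∀ ρ : (Fin n → 𝕜) → 𝕜, densityPullback σ ρ 0 = ρ 0 * (fderiv 𝕜 σ 0).det := by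
    intro ρ
    simp only [densityPullback, hσ.map_zero]
  obtain ⟨Φ, sΦ, stΦ, Φ0, hΦ⟩ := hg _ _ (SmoothNear.densityPullback hr hσ h₀)
    (SmoothNear.densityPullback hr hσ h₁) (densityPullback_zero_ne_zero hr hσ hne₀)
    (densityPullback_zero_ne_zero hr hσ hne₁) (by
      rw [e, e]
      exact hs.mul_right _)
  have dΦ : ∀ t, IsDiffeoGerm 𝕜 r (Φ t) := fun t => by
    obtain ⟨θ, hθ, -⟩ := stΦ t
    exact hθ.1
  refine ⟨fun t x => σ (Φ t (χ x)), fun t => ?_, fun t => ?_, ?_, ?_⟩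
  · have sχ : SmoothNear ℝ r χ ((t, (0 : Fin n → 𝕜)) : ℝ × (Fin n → 𝕜)).2 := hχ.smooth.real
    have s1 : SmoothNear ℝ r (fun z : ℝ × (Fin n → 𝕜) => Φ z.1 z.2) (t, χ 0) := by
      rw [hχ.map_zero]
      exact sΦ t
    have s2 : SmoothNear ℝ r (fun z : ℝ × (Fin n → 𝕜) => Φ z.1 (χ z.2)) (t, 0) :=
      SmoothNear.comp (g := fun z : ℝ × (Fin n → 𝕜) => Φ z.1 z.2)
        (f := fun z : ℝ × (Fin n → 𝕜) => (z.1, χ z.2)) (t, 0) s1 (by fun_prop)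
    have s3 : SmoothNear ℝ r σ (Φ t (χ 0)) := by
      rw [hχ.map_zero, (dΦ t).map_zero]
      exact hσ.smooth.real
    exact SmoothNear.comp (g := σ) (t, (0 : Fin n → 𝕜)) s3 s2
  · obtain ⟨θ, ⟨-, hθ, -⟩, him⟩ := stΦ t
    refine ⟨fun x => θ (χ x), ⟨hσ.comp ((dΦ t).comp hχ), hθ.reparam hχ, trivial⟩, ?_⟩
    have t1 := (dΦ t).tendsto.comp hχ.tendsto
    filter_upwards [hgf, hχ.tendsto.eventually him, t1.eventually h2,
      (hσ.tendsto.comp t1).eventually hgf] with x x1 x2 x3 x4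
    simp only [Function.comp_apply] at x3 x4
    rw [← x1, x2, ← x4, x3]
  · filter_upwards [h1, hχ.tendsto.eventually Φ0] with x hx hx'
    rw [hx', hx]
  · have e1 := densityPullback_comp hr hσ ((dΦ 1).comp hχ) ρ₁
    have e2 := densityPullback_comp hr (dΦ 1) hχ (densityPullback σ ρ₁)
    have e3 := densityPullback_congr_density hχ hΦ
    have e4 := densityPullback_of_inverse hr hσ hχ h1 ρ₀
    filter_upwards [e1, e2, e3, e4] with x x1 x2 x3 x4
    rw [x1, x2, x3]
    exact x4

theorem familyPullback_reparam {Φ : (Fin n → 𝕜) → (Fin p → 𝕜) → (Fin p → 𝕜)}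
    {φ ψ : (Fin n → 𝕜) → (Fin n → 𝕜)} {z : (Fin n → 𝕜) × (Fin p → 𝕜)} (h : ψ (φ z.1) = z.1)
    (ρ : (Fin n → 𝕜) × (Fin p → 𝕜) → 𝕜) :
    familyPullback (fun x => Φ (φ x)) ρ z =
      familyPullback Φ (fun z => ρ (ψ z.1, z.2)) (φ z.1, z.2) := by
  simp only [familyPullback, h]

/-- A change of source coordinates merely reparametrizes the family, so no Jacobian enters. -/
theorem TargetMoser.comp_diffeo (hg : TargetMoser r .K g) (hχ : IsDiffeoGerm 𝕜 r χ)
    (hgf : ∀ᶠ x in 𝓝 (0 : Fin n → 𝕜), g (χ x) = f x) :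
    TargetMoser r .K f := by
  intro ρ₀ ρ₁ h₀ h₁ hne₀ hne₁ hs _
  obtain ⟨σ, hσ, h1, h2⟩ := hχ.exists_symm
  have hz : (σ (0 : (Fin n → 𝕜) × (Fin p → 𝕜)).1, (0 : (Fin n → 𝕜) × (Fin p → 𝕜)).2) = 0 :=
    Prod.ext hσ.map_zero rfl
  have sρ : ∀ ρ : (Fin n → 𝕜) × (Fin p → 𝕜) → 𝕜, SmoothNear 𝕜 r ρ 0 →
      SmoothNear 𝕜 r (fun z : (Fin n → 𝕜) × (Fin p → 𝕜) => ρ (σ z.1, z.2)) 0 := by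
    intro ρ hρ
    refine SmoothNear.comp (g := ρ) (0 : (Fin n → 𝕜) × (Fin p → 𝕜)) ?_ hσ.prodMap_id.smooth
    rwa [hz]
  obtain ⟨Φ, sΦ, stΦ, Φ0, hΦ⟩ := hg (fun z => ρ₀ (σ z.1, z.2)) (fun z => ρ₁ (σ z.1, z.2))
    (sρ ρ₀ h₀) (sρ ρ₁ h₁) (by rwa [hz]) (by rwa [hz]) (by rwa [hz]) (by simp)
  have tχ : Tendsto (fun z : (Fin n → 𝕜) × (Fin p → 𝕜) => (χ z.1, z.2)) (𝓝 0) (𝓝 0) :=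
    tendsto_map_fst hχ
  have tf : Tendsto (Prod.fst : (Fin n → 𝕜) × (Fin p → 𝕜) → _) (𝓝 0) (𝓝 0) :=
    continuous_fst.tendsto _
  refine ⟨fun t x => Φ t (χ x), fun t => ?_, fun t => ?_, tχ.eventually Φ0, ?_⟩
  · have sχ : SmoothNear ℝ r χ ((t, (0 : Fin n → 𝕜), (0 : Fin p → 𝕜)) :
      ℝ × (Fin n → 𝕜) × (Fin p → 𝕜)).2.1 := hχ.smooth.real
    have s1 : SmoothNear ℝ r (fun z : ℝ × (Fin n → 𝕜) × (Fin p → 𝕜) => Φ z.1 z.2.1 z.2.2)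
        (t, χ 0, 0) := by
      rw [hχ.map_zero]
      exact sΦ t
    exact SmoothNear.comp (g := fun z : ℝ × (Fin n → 𝕜) × (Fin p → 𝕜) => Φ z.1 z.2.1 z.2.2)
      (f := fun z : ℝ × (Fin n → 𝕜) × (Fin p → 𝕜) => (z.1, χ z.2.1, z.2.2))
      (t, (0 : Fin n → 𝕜), (0 : Fin p → 𝕜)) s1 (by fun_prop)
  · obtain ⟨φ, ⟨dφ, hθ, -⟩, him⟩ := stΦ t
    refine ⟨fun x => σ (φ (χ x)), ⟨hσ.comp (dφ.comp hχ), hθ.reparam hχ, trivial⟩, ?_⟩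
    have t1 := dφ.tendsto.comp hχ.tendsto
    filter_upwards [hgf, hχ.tendsto.eventually him, t1.eventually h2,
      (hσ.tendsto.comp t1).eventually hgf] with x x1 x2 x3 x4
    simp only [Function.comp_apply] at x3 x4
    rw [← x1, x2, ← x4, x3]
  · filter_upwards [tf.eventually h1, tχ.eventually hΦ] with z hz hz'
    rw [familyPullback_reparam hz, hz', hz]

theorem HasPositiveRank.exists_partial_ne_zero (h : HasPositiveRank f) :
    ∃ i j, fderiv 𝕜 f 0 (Pi.single i 1) j ≠ 0 := by
  by_contra! hc
  have h0 : (fderiv 𝕜 f 0 : (Fin n → 𝕜) →ₗ[𝕜] (Fin p → 𝕜)) = 0 := by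
    refine LinearMap.pi_ext' fun i => LinearMap.ext_ring (funext fun j => ?_)
    simpa using hc i j
  rw [HasPositiveRank, h0, LinearMap.range_zero, finrank_bot] at h
  exact lt_irrefl _ h

/-- A map-germ of positive rank can be written, in suitable coordinates of the source, such that
one of its components is a coordinate function. -/
theorem HasPositiveRank.exists_normal_form (hr : r = ∞ ∨ r = ω) (hf : IsMapGerm r f)
    (h : HasPositiveRank f) :
    ∃ (g : (Fin n → 𝕜) → (Fin p → 𝕜)) (χ : (Fin n → 𝕜) → (Fin n → 𝕜)) (i : Fin n) (j : Fin p),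
      IsMapGerm r g ∧ IsDiffeoGerm 𝕜 r χ ∧ (∀ᶠ x in 𝓝 (0 : Fin n → 𝕜), g (χ x) = f x) ∧
      ∀ᶠ x in 𝓝 (0 : Fin n → 𝕜), g x j = x i := by
  have hr0 : r ≠ 0 := by rcases hr with rfl | rfl <;> simp
  obtain ⟨i, j, hij⟩ := h.exists_partial_ne_zero
  have sf := hf.smooth
  -- The component `f j` is used as a new `i`-th coordinate; the Jacobian determinant at `0` is the
  -- nonzero partial derivative.
  let χ : (Fin n → 𝕜) → (Fin n → 𝕜) := fun x => Function.update x i (f x j)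
  have sχ : SmoothNear 𝕜 r χ 0 := by
    refine smoothNear_pi fun k => ?_
    rcases eq_or_ne k i with rfl | hk
    · simp only [χ, Function.update_self]
      fun_prop
    · simp only [χ, Function.update_of_ne hk]
      fun_prop
  let A : (Fin n → 𝕜) →L[𝕜] (Fin n → 𝕜) := ContinuousLinearMap.id 𝕜 (Fin n → 𝕜) +
    ((ContinuousLinearMap.proj (R := 𝕜) (φ := fun _ : Fin p => 𝕜) j).comp (fderiv 𝕜 f 0) -
      ContinuousLinearMap.proj (R := 𝕜) (φ := fun _ : Fin n => 𝕜) i).smulRight (Pi.single i 1)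
  have hA : A.det ≠ 0 := by
    rw [det_id_add_smulRight]
    simpa using hij
  have hdf : HasFDerivAt f (fderiv 𝕜 f 0) 0 := (sf.differentiableAt hr0).hasFDerivAt
  have hdχ : HasFDerivAt χ A 0 := by
    rw [hasFDerivAt_pi']
    intro k
    rcases eq_or_ne k i with rfl | hk
    · simp only [χ, Function.update_self]
      refine ((ContinuousLinearMap.proj (R := 𝕜) (φ := fun _ : Fin p => 𝕜)
        j).hasFDerivAt.comp 0 hdf).congr_fderiv ?_
      ext v
      simp [A]
    · simp only [χ, Function.update_of_ne hk]
      refine (ContinuousLinearMap.proj (R := 𝕜) (φ := fun _ : Fin n => 𝕜)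
        k).hasFDerivAt.congr_fderiv ?_
      ext v
      simp [A, hk]
  have hχ : IsDiffeoGerm 𝕜 r χ :=
    sχ.isDiffeoGerm hr (φ' := A.toContinuousLinearEquivOfDetNeZero hA)
      (by simp [χ, hf.map_zero]) (by simpa using hdχ)
  obtain ⟨σ, hσ, h1, h2⟩ := hχ.exists_symm
  have sσ := hσ.smooth
  have sf' : SmoothNear 𝕜 r f (σ 0) := by rwa [hσ.map_zero]
  refine ⟨fun x => f (σ x), χ, i, j, ⟨by rw [hσ.map_zero, hf.map_zero], by fun_prop⟩, hχ, ?_, ?_⟩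
  · filter_upwards [h1] with x hx
    rw [hx]
  · filter_upwards [h2] with x hx
    have := congrFun hx i
    simpa [χ] using this

theorem HasPositiveRank.sourceMoser (hr : r = ∞ ∨ r = ω) (hf : IsMapGerm r f)
    (h : HasPositiveRank f) : SourceMoser r f := by
  obtain ⟨g, χ, i, j, hg, hχ, hgf, hj⟩ := h.exists_normal_form hr hf
  obtain ⟨L, M, hLM⟩ := exists_dilationSymmetry_of_component hr hg hj
  exact (hLM.sourceMoser hr (by simp)).comp_diffeo hr hχ hgf

theorem HasPositiveRank.targetMoser (hr : r = ∞ ∨ r = ω) (hf : IsMapGerm r f)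
    (h : HasPositiveRank f) : TargetMoser r .K f := by
  obtain ⟨g, χ, i, j, hg, hχ, hgf, hj⟩ := h.exists_normal_form hr hf
  obtain ⟨L, M, hLM⟩ := exists_dilationSymmetry_of_component hr hg hj
  exact (hLM.targetMoser hr hg j.pos one_ne_zero).comp_diffeo hχ hgf

end SourceConjugation

/-! ### From volume forms to densities -/

section VolumeDensities

universe u

variable {𝕜 : Type u} [RCLike 𝕜] {r : WithTop ℕ∞} {n p d : ℕ}

/-- The density of a differential form of top degree with respect to the standard volume form. -/
def TopForm.density (Ω : TopForm 𝕜 d) (x : Fin d → 𝕜) : 𝕜 :=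
  Ω x fun i => Pi.single i 1

theorem continuousAlternatingMap_eq_iff {α β : (Fin d → 𝕜) [⋀^Fin d]→L[𝕜] 𝕜} :
    α = β ↔ (α fun i => Pi.single i 1) = β fun i => Pi.single i 1 := by
  refine ⟨fun h => by rw [h], fun h => ?_⟩
  apply ContinuousAlternatingMap.toAlternatingMap_injective
  rw [AlternatingMap.eq_smul_basis_det (Pi.basisFun 𝕜 (Fin d)) α.toAlternatingMap,
    AlternatingMap.eq_smul_basis_det (Pi.basisFun 𝕜 (Fin d)) β.toAlternatingMap]
  have e : (⇑(Pi.basisFun 𝕜 (Fin d))) = fun i => Pi.single i 1 := by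
    funext i
    simp
  simp only [e]
  congr 1

theorem TopForm.eq_iff_density_eq {Ω Ω' : TopForm 𝕜 d} {x : Fin d → 𝕜} :
    Ω x = Ω' x ↔ Ω.density x = Ω'.density x :=
  continuousAlternatingMap_eq_iff

theorem density_pullbackForm (Φ : (Fin d → 𝕜) → (Fin d → 𝕜)) (Ω : TopForm 𝕜 d) (x : Fin d → 𝕜) :
    (pullbackForm Φ Ω).density x = densityPullback Φ Ω.density x := by
  have h := AlternatingMap.eq_smul_basis_det (Pi.basisFun 𝕜 (Fin d)) (Ω (Φ x)).toAlternatingMap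
  have e : (⇑(Pi.basisFun 𝕜 (Fin d))) = fun i => Pi.single i 1 := by
    funext i
    simp
  have h1 := congrArg (fun α => α fun i => fderiv 𝕜 Φ x (Pi.single i 1)) h
  have h2 := (Pi.basisFun 𝕜 (Fin d)).det_comp (fderiv 𝕜 Φ x : (Fin d → 𝕜) →ₗ[𝕜] (Fin d → 𝕜))
    (Pi.basisFun 𝕜 (Fin d))
  rw [Module.Basis.det_self, mul_one, e] at h2
  simp only [AlternatingMap.smul_apply, smul_eq_mul, e] at h1
  refine h1.trans ?_
  congr 1

theorem IsVolumeForm.smooth_density {Ω : TopForm 𝕜 d} (h : IsVolumeForm r Ω) :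
    SmoothNear 𝕜 r Ω.density 0 :=
  SmoothNear.comp (g := ContinuousAlternatingMap.apply 𝕜 (Fin d → 𝕜) 𝕜 fun i => Pi.single i 1) 0
    ((ContinuousAlternatingMap.apply 𝕜 (Fin d → 𝕜) 𝕜 fun i => Pi.single i 1).contDiff.smoothNear _)
    h.smooth

theorem IsVolumeForm.density_zero_ne_zero {Ω : TopForm 𝕜 d} (h : IsVolumeForm r Ω) :
    Ω.density 0 ≠ 0 := by
  intro h0
  exact h.ne_zero (TopForm.eq_iff_density_eq (Ω' := fun _ => 0).2 h0)

theorem SameOrientation.sameSign {Ω Ω' : TopForm 𝕜 d}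
    (h : (RCLike.I : 𝕜) = 0 → SameOrientation Ω Ω') : SameSign (Ω.density 0) (Ω'.density 0) := by
  intro hI
  obtain ⟨c, hc, hΩ⟩ := h hI
  exact ⟨c, hc, by simp [TopForm.density, hΩ]⟩

theorem sameSign_mul_self {a : 𝕜} (b : 𝕜) (h : (RCLike.I : 𝕜) = 0 → 0 < RCLike.re a) :
    SameSign b (b * a) := by
  intro hI
  refine ⟨RCLike.re a, h hI, ?_⟩
  have := RCLike.re_add_im a
  rw [hI, mul_zero, add_zero] at this
  rw [this, mul_comm]

variable {φ : (Fin n → 𝕜) → (Fin n → 𝕜)} {θ : (Fin n → 𝕜) → (Fin p → 𝕜) → (Fin p → 𝕜)}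

theorem pullsBack_source_iff {Ω Ω' : TopForm 𝕜 n} :
    PullsBack φ θ .source Ω' Ω ↔ densityPullback φ Ω'.density =ᶠ[𝓝 0] Ω.density := by
  refine eventually_congr (Eventually.of_forall fun x => ?_)
  rw [TopForm.eq_iff_density_eq, density_pullbackForm]

theorem pullsBack_target_iff {Ω Ω' : TopForm 𝕜 p} :
    PullsBack φ θ .target Ω' Ω ↔
      familyPullback θ (fun z => Ω'.density z.2) =ᶠ[𝓝 0] fun z => Ω.density z.2 := by
  refine eventually_congr (Eventually.of_forall fun z => ?_)
  rw [TopForm.eq_iff_density_eq, density_pullbackForm]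
  rfl

end VolumeDensities

/-! ### From isotopy to volume-preserving equivalence -/

section VolumeEquivalence

universe u

variable {𝕜 : Type u} [RCLike 𝕜] {r : WithTop ℕ∞} {n p d : ℕ} {G : Mather} {q : Side}
  {f g h : (Fin n → 𝕜) → (Fin p → 𝕜)}

theorem Mather.VolumeEquivalent.symm (hr : r = ∞ ∨ r = ω) (hG : G ≠ .R) (hf : IsMapGerm r f)
    {Ω : TopForm 𝕜 (q.dim n p)} (hgf : G.VolumeEquivalent r q Ω g f) :
    G.VolumeEquivalent r q Ω f g := by
  obtain ⟨φ, θ, hm, hp, hi⟩ := hgf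
  obtain ⟨ψ, η, hm', dψ, dη, h1, h2, h3, h4⟩ := hm.exists_inverse hG
  refine ⟨ψ, fun x => η (ψ x), hm', ?_, hi.symm hf hm.1 dψ h2 h3⟩
  cases q
  · have hp := pullsBack_source_iff.1 hp
    refine pullsBack_source_iff.2 ?_
    exact (densityPullback_congr_density dψ hp).symm.trans
      (densityPullback_of_inverse hr hm.1 dψ h2 _)
  · have hp := pullsBack_target_iff.1 hp
    refine pullsBack_target_iff.2 ?_
    have e1 := familyPullback_congr_density dη hp
    have e2 := familyPullback_comp hr hm.2.1 dη (fun z => TopForm.density Ω z.2)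
    have e3 := familyPullback_congr (θ := fun x y => θ x (η x y)) (θ' := fun _ y => y) h4
      (fun z => TopForm.density Ω z.2)
    rw [familyPullback_id] at e3
    filter_upwards [(tendsto_map_fst dψ).eventually e1, (tendsto_map_fst dψ).eventually e2,
      (tendsto_map_fst dψ).eventually e3] with z z1 z2 z3
    exact z1.symm.trans (z2.symm.trans z3)

theorem Mather.VolumeEquivalent.trans (hr : r = ∞ ∨ r = ω) (hG : G ≠ .R)
    {Ω : TopForm 𝕜 (q.dim n p)} (hgf : G.VolumeEquivalent r q Ω g f)
    (hfh : G.VolumeEquivalent r q Ω f h) : G.VolumeEquivalent r q Ω g h := by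
  obtain ⟨φ, θ, hm, hp, hi⟩ := hgf
  obtain ⟨φ', θ', hm', hp', hi'⟩ := hfh
  refine ⟨_, _, hm.comp hG hm', ?_, hi.trans hm.1 hi'⟩
  cases q
  · have hp := pullsBack_source_iff.1 hp
    have hp' := pullsBack_source_iff.1 hp'
    refine pullsBack_source_iff.2 ?_
    exact EventuallyEq.trans (densityPullback_comp hr hm'.1 hm.1 _)
      ((densityPullback_congr_density hm.1 hp').trans hp)
  · have hp := pullsBack_target_iff.1 hp
    have hp' := pullsBack_target_iff.1 hp'
    refine pullsBack_target_iff.2 ?_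
    have dθ := hm'.2.1.reparam hm.1
    filter_upwards [familyPullback_comp hr hm.2.1 dθ (fun z => TopForm.density Ω z.2),
      familyPullback_congr_density dθ hp, (tendsto_map_fst hm.1).eventually hp'] with z z1 z2 z3
    exact z1.trans (z2.trans z3)

theorem SourceMoser.isotopic (hM : SourceMoser r f) {Ω Ω' : TopForm 𝕜 n} (hΩ : IsVolumeForm r Ω)
    (hΩ' : IsVolumeForm r Ω') (h : (RCLike.I : 𝕜) = 0 → SameOrientation Ω Ω') :
    Mather.K.Isotopic r f .source Ω Ω' := by
  obtain ⟨Φ, h1, h2, h3, h4⟩ := hM _ _ hΩ.smooth_density hΩ'.smooth_density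
    hΩ.density_zero_ne_zero hΩ'.density_zero_ne_zero (SameOrientation.sameSign h)
  exact ⟨Φ, fun t _ => h1 t, fun t _ => h2 t, h3, pullsBack_source_iff.2 h4⟩

theorem IsVolumeForm.smooth_density_snd {Ω : TopForm 𝕜 p} (h : IsVolumeForm r Ω) :
    SmoothNear 𝕜 r (fun z : (Fin n → 𝕜) × (Fin p → 𝕜) => Ω.density z.2) 0 := by
  have h' : SmoothNear 𝕜 r Ω.density (0 : (Fin n → 𝕜) × (Fin p → 𝕜)).2 := h.smooth_density
  fun_prop

theorem isConstantDensity_snd (ρ : (Fin p → 𝕜) → 𝕜) :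
    IsConstantDensity (fun z : (Fin n → 𝕜) × (Fin p → 𝕜) => ρ z.2) :=
  Eventually.of_forall fun _ => rfl

theorem TargetMoser.isotopic (hM : TargetMoser r G f) {Ω Ω' : TopForm 𝕜 p} (hΩ : IsVolumeForm r Ω)
    (hΩ' : IsVolumeForm r Ω') (h : (RCLike.I : 𝕜) = 0 → SameOrientation Ω Ω') :
    G.Isotopic r f .target Ω Ω' := by
  obtain ⟨Φ, h1, h2, h3, h4⟩ := hM _ _ hΩ.smooth_density_snd hΩ'.smooth_density_snd
    hΩ.density_zero_ne_zero hΩ'.density_zero_ne_zero (SameOrientation.sameSign h)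
    fun _ => ⟨isConstantDensity_snd _, isConstantDensity_snd _⟩
  exact ⟨Φ, fun t _ => h1 t, fun t _ => h2 t, h3, pullsBack_target_iff.2 h4⟩

variable {φ : (Fin n → 𝕜) → (Fin n → 𝕜)} {θ : (Fin n → 𝕜) → (Fin p → 𝕜) → (Fin p → 𝕜)}

/-- With `ψ` inverse to `φ`, Moser's theorem gives `Φ 1` in the stabilizer pulling `Ω` back to `ψ^*
Ω`. Then `Φ 1 ∘ φ` preserves `Ω` and still takes `f` to `g`. -/
theorem SourceMoser.volumeEquivalent (hr : r = ∞ ∨ r = ω) (hM : SourceMoser r f)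
    {Ω : TopForm 𝕜 n} (hΩ : IsVolumeForm r Ω) (hm : Mather.K.Mem r φ θ) (hi : IsImage φ θ f g)
    (ho : (RCLike.I : 𝕜) = 0 → PreservesOrientation φ θ .source) :
    Mather.K.VolumeEquivalent r .source Ω g f := by
  obtain ⟨ψ, dψ, h1, h2⟩ := hm.1.exists_symm
  have e := densityPullback_of_inverse hr dψ hm.1 h1 Ω.density
  have hs : SameSign (densityPullback ψ Ω.density 0) (Ω.density 0) := by
    have := e.self_of_nhds
    simp only [densityPullback, hm.1.map_zero] at this
    conv_rhs => rw [← this]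
    simp only [densityPullback]
    exact sameSign_mul_self _ ho
  obtain ⟨Φ, -, hΦ, -, h4⟩ := hM _ _ (SmoothNear.densityPullback hr dψ hΩ.smooth_density)
    hΩ.smooth_density (densityPullback_zero_ne_zero hr dψ hΩ.density_zero_ne_zero)
    hΩ.density_zero_ne_zero hs
  obtain ⟨θ₁, hm₁, hi₁⟩ := hΦ 1
  refine ⟨_, _, hm.comp (by simp) hm₁, pullsBack_source_iff.2 ?_, hi.trans hm.1 hi₁⟩
  exact EventuallyEq.trans (densityPullback_comp hr hm₁.1 hm.1 _)
    ((densityPullback_congr_density hm.1 h4).trans e)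

theorem IsConstantDensity.reparam {ρ : (Fin n → 𝕜) × (Fin p → 𝕜) → 𝕜} (h : IsConstantDensity ρ)
    (hφ : IsDiffeoGerm 𝕜 r φ) : IsConstantDensity fun z => ρ (φ z.1, z.2) := by
  filter_upwards [(tendsto_map_fst hφ).eventually h] with z hz
  rw [hφ.map_zero]
  exact hz

/-- Even for a single form `Ω` the pullback by `θ x` depends on `x`; this is why `TargetMoser`
concerns families of densities. The reparametrization by `ψ` occurs because the composite uses the
stabilizing family at `φ x`. -/
theorem TargetMoser.volumeEquivalent (hr : r = ∞ ∨ r = ω) (hG : G ≠ .R) (hM : TargetMoser r G f)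
    {Ω : TopForm 𝕜 p} (hΩ : IsVolumeForm r Ω) (hm : G.Mem r φ θ) (hi : IsImage φ θ f g)
    (ho : (RCLike.I : 𝕜) = 0 → PreservesOrientation φ θ .target) :
    G.VolumeEquivalent r .target Ω g f := by
  obtain ⟨ψ, dψ, h1, h2⟩ := hm.1.exists_symm
  let ρ : (Fin n → 𝕜) × (Fin p → 𝕜) → 𝕜 := fun z => Ω.density z.2
  have hc : G = .A ∨ G = .L → IsConstantFamily θ := ((Mather.mem_iff hG).1 hm).2.2.2
  have hz : (ψ (0 : (Fin n → 𝕜) × (Fin p → 𝕜)).1, (0 : (Fin n → 𝕜) × (Fin p → 𝕜)).2) = 0 :=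
    Prod.ext dψ.map_zero rfl
  have s1 : SmoothNear 𝕜 r (fun z : (Fin n → 𝕜) × (Fin p → 𝕜) =>
      familyPullback θ ρ (ψ z.1, z.2)) 0 := by
    refine SmoothNear.comp (g := familyPullback θ ρ) (0 : (Fin n → 𝕜) × (Fin p → 𝕜)) ?_
      dψ.prodMap_id.smooth
    rw [hz]
    exact SmoothNear.familyPullback hr hm.2.1 hΩ.smooth_density_snd
  obtain ⟨Φ, -, hΦ, -, h4⟩ := hM ρ (fun z => familyPullback θ ρ (ψ z.1, z.2))
    hΩ.smooth_density_snd s1 hΩ.density_zero_ne_zero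
    (by
      rw [hz]
      exact familyPullback_zero_ne_zero hr hm.2.1 hΩ.density_zero_ne_zero)
    (by
      rw [hz, familyPullback_zero θ hm.2.1]
      exact sameSign_mul_self _ ho)
    (fun h => ⟨isConstantDensity_snd _,
      ((isConstantDensity_snd _).familyPullback hm.2.1 (hc h)).reparam dψ⟩)
  obtain ⟨φ₁, hm₁, hi₁⟩ := hΦ 1
  refine ⟨_, _, hm.comp hG hm₁, pullsBack_target_iff.2 ?_, hi.trans hm.1 hi₁⟩
  have tf : Tendsto (Prod.fst : (Fin n → 𝕜) × (Fin p → 𝕜) → _) (𝓝 0) (𝓝 0) :=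
    continuous_fst.tendsto _
  filter_upwards [familyPullback_comp hr hm.2.1 (hm₁.2.1.reparam hm.1) ρ, tf.eventually h1,
    (tendsto_map_fst hm.1).eventually h4] with z z1 z2 z3
  exact z1.trans ((familyPullback_reparam z2 _).trans z3)

/-- Substituting the inverse of `φ` removes the source component: the vanishing becomes a condition
on `θ (ψ x) (f x)`. -/
theorem HasZeroComponent.targetMoser (hr : r = ∞ ∨ r = ω) (hG : G ≠ .R) (hf : IsMapGerm r f)
    (h : HasZeroComponent r G f) : TargetMoser r G f := by
  obtain ⟨g, -, ⟨φ, θ, hm, hi⟩, j, hj⟩ := h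
  obtain ⟨ψ, dψ, -, h2⟩ := hm.1.exists_symm
  have hc : G = .A ∨ G = .L → IsConstantFamily θ := ((Mather.mem_iff hG).1 hm).2.2.2
  refine hf.targetMoser_of_zero_component hr hG (hm.2.1.reparam dψ) (fun e => (hc e).reparam dψ)
    (j := j) ?_
  filter_upwards [h2, dψ.tendsto.eventually hi, dψ.tendsto.eventually hj] with x x1 x2 x3
  rw [x1] at x2
  rw [← x2, x3]

theorem IsQuasihomogeneous.targetMoser_A (hr : r = ∞ ∨ r = ω) (hf : IsMapGerm r f)
    {w : Fin n → ℤ} {δ : Fin p → ℤ} (h : IsQuasihomogeneous w δ f) (hδ : ∀ j, 0 ≤ δ j)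
    (hδ' : 0 < ∑ j, δ j) : TargetMoser r .A f := by
  lift δ to Fin p → ℕ using hδ
  refine targetMoser_of_scaling (δ := δ) (a := fun i => (w i : 𝕜)) hr hf (by zify; exact hδ')
    fun s => ?_
  simpa using h.eventually_expScale s

theorem IsQuasihomogeneous.sourceMoser (hr : r = ∞ ∨ r = ω)
    {w : Fin n → ℤ} {δ : Fin p → ℤ} (h : IsQuasihomogeneous w δ f) (hw : ∀ i, 0 ≤ w i)
    (hw' : 0 < ∑ i, w i) : SourceMoser r f := by
  lift w to Fin n → ℕ using hw
  have h' := h.dilationSymmetry (r := r)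
  simp only [Int.cast_natCast] at h'
  exact h'.sourceMoser hr (by zify; exact hw')

theorem IsQuasihomogeneous.targetMoser_K (hr : r = ∞ ∨ r = ω) (hf : IsMapGerm r f)
    {w : Fin n → ℤ} {δ : Fin p → ℤ} (h : IsQuasihomogeneous w δ f) (hδ : ∑ j, δ j ≠ 0) :
    TargetMoser r .K f := by
  refine h.dilationSymmetry.targetMoser hr hf (Nat.pos_of_ne_zero ?_) (by exact_mod_cast hδ)
  rintro rfl
  simp at hδ

theorem sourceMoser_or_targetMoser (hr : r = ∞ ∨ r = ω) (hf : IsMapGerm r f)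
    (h : IsWeaklyQuasihomogeneous G q f ∨ IsTriviallyWeaklyQuasihomogeneous r G q f) :
    (q = .source ∧ G = .K ∧ SourceMoser r f) ∨ (q = .target ∧ G ≠ .R ∧ TargetMoser r G f) := by
  rcases h with ⟨w, δ, h, hwδ⟩ | h
  · cases G <;> cases q <;> first | exact hwδ.elim | skip
    · exact .inr ⟨rfl, by simp, h.targetMoser_A hr hf hwδ.1 hwδ.2⟩
    · exact .inl ⟨rfl, rfl, h.sourceMoser hr hwδ.1 hwδ.2⟩
    · exact .inr ⟨rfl, by simp, h.targetMoser_K hr hf hwδ⟩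
  · cases G <;> cases q <;> first | exact h.elim | skip
    · exact .inr ⟨rfl, by simp, HasZeroComponent.targetMoser hr (by simp) hf h⟩
    · exact .inl ⟨rfl, rfl, HasPositiveRank.sourceMoser hr hf h⟩
    · refine .inr ⟨rfl, by simp, ?_⟩
      rcases h with h | h
      · exact h.targetMoser hr (by simp) hf
      · exact h.targetMoser hr hf
    · exact .inr ⟨rfl, by simp, HasZeroComponent.targetMoser hr (by simp) hf h⟩
    · exact .inr ⟨rfl, by simp, HasZeroComponent.targetMoser hr (by simp) hf h⟩

end VolumeEquivalence

/-! ### The theorem -/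

theorem mainTheorem2 {𝕜 : Type*} [RCLike 𝕜] (r : WithTop ℕ∞) (hr : r = ∞ ∨ r = ω) {n p : ℕ}
    (G : Mather) (q : Side) (f : (Fin n → 𝕜) → (Fin p → 𝕜)) (hf : IsMapGerm r f)
    (hwqh : IsWeaklyQuasihomogeneous G q f ∨ IsTriviallyWeaklyQuasihomogeneous r G q f) :
    -- (i): all volume forms (over the reals: of the same orientation) are isotopic
    (∀ Ω Ω' : TopForm 𝕜 (q.dim n p), IsVolumeForm r Ω → IsVolumeForm r Ω' →
      ((RCLike.I : 𝕜) = 0 → SameOrientation Ω Ω') → G.Isotopic r f q Ω Ω') ∧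
    -- (ii): equivalence implies volume preserving equivalence
    (∀ Ω : TopForm 𝕜 (q.dim n p), IsVolumeForm r Ω →
      ∀ f' : (Fin n → 𝕜) → (Fin p → 𝕜), IsMapGerm r f' →
        (((RCLike.I : 𝕜) ≠ 0 ∧ G.Equivalent r f' f) ∨
          ((RCLike.I : 𝕜) = 0 ∧ G.PlusEquivalent r q f' f)) →
        G.VolumeEquivalent r q Ω f' f) ∧
    -- (iii): over the complex numbers, the orbits of every germ in the orbit of `f` coincide
    ((RCLike.I : 𝕜) ≠ 0 → ∀ Ω : TopForm 𝕜 (q.dim n p), IsVolumeForm r Ω →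
      ∀ g f' : (Fin n → 𝕜) → (Fin p → 𝕜), IsMapGerm r g → IsMapGerm r f' →
        G.Equivalent r g f → (G.Equivalent r f' g ↔ G.VolumeEquivalent r q Ω f' g)) := by
  have hM := sourceMoser_or_targetMoser hr hf hwqh
  have hG : G ≠ .R := by
    rcases hM with ⟨-, rfl, -⟩ | ⟨-, h, -⟩
    · simp
    · exact h
  have hii : ∀ Ω : TopForm 𝕜 (q.dim n p), IsVolumeForm r Ω →
      ∀ f' : (Fin n → 𝕜) → (Fin p → 𝕜),
        (((RCLike.I : 𝕜) ≠ 0 ∧ G.Equivalent r f' f) ∨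
          ((RCLike.I : 𝕜) = 0 ∧ G.PlusEquivalent r q f' f)) →
        G.VolumeEquivalent r q Ω f' f := by
    intro Ω hΩ f' h
    obtain ⟨φ, θ, hm, hi, ho⟩ : ∃ φ θ, G.Mem r φ θ ∧ IsImage φ θ f f' ∧
        ((RCLike.I : 𝕜) = 0 → PreservesOrientation φ θ q) := by
      rcases h with ⟨hI, φ, θ, hm, hi⟩ | ⟨-, φ, θ, hm, ho, hi⟩
      · exact ⟨φ, θ, hm, hi, fun h => absurd h hI⟩
      · exact ⟨φ, θ, hm, hi, fun _ => ho⟩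
    rcases hM with ⟨rfl, rfl, hM⟩ | ⟨rfl, -, hM⟩
    · exact hM.volumeEquivalent hr hΩ hm hi ho
    · exact hM.volumeEquivalent hr hG hΩ hm hi ho
  refine ⟨?_, fun Ω hΩ f' _ h => hii Ω hΩ f' h, ?_⟩
  · intro Ω Ω' hΩ hΩ' h
    rcases hM with ⟨rfl, rfl, hM⟩ | ⟨rfl, -, hM⟩
    · exact hM.isotopic hΩ hΩ' h
    · exact hM.isotopic hΩ hΩ' h
  · intro hI Ω hΩ g f' hg hf' hgf
    refine ⟨?_, fun ⟨φ, θ, hm, _, hi⟩ => ⟨φ, θ, hm, hi⟩⟩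
    rintro ⟨φ, θ, hm, hi⟩
    obtain ⟨φ', θ', hm', hi'⟩ := hgf
    -- Both `f'` and `g` are `G`-equivalent to `f`, hence volume-equivalent to it, so they are
    -- volume-equivalent to each other.
    have h1 := hii Ω hΩ f' (.inl ⟨hI, _, _, hm.comp hG hm', hi.trans hm.1 hi'⟩)
    have h2 := hii Ω hΩ g (.inl ⟨hI, φ', θ', hm', hi'⟩)
    exact h1.trans hr hG (h2.symm hr hG hf)
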